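/- Let $\mathbb N=\{1,2,\dots\}$. For finite sets write $E<F$ if every element of $E$ is smaller than every element of $F$, and $n\le E$ if $n\le m$ for all $m\in E$. **Schreier families.** $\mathcal S_0$ consists of $\varnothing$ and the singletons, $\mathcal S_1=\{E:|E|\le\min E\}\cup\{\varnothing\}$, $\mathcal S_{\xi+1}$ is the set of all unions $E_1\cup\dots\cup E_d$ with $E_1<\dots<E_d$ non-empty members of $\mathcal S_\xi$ and $\{\min E_1,\dots,\min E_d\}\in\mathcal S_1$, and for a countable limit ordinal $\xi$ one fixes a strictly increasing sequence $\xi_n\uparrow\xi$ with $\mathcal S_{\xi_n}\subset\mathcal S_{\xi_{n+1}}$ for all $n$ and lets $\mathcal S_\xi=\{E:\exists n\ (n\le E\text{ and }E\in\mathcal S_{\xi_n})\}$. The theorem holds for every such choice of sequences. **The index.** Let $X$ be a Banach space with Schauder basis $(e_i)$. A block sequence of $(e_i)$ is an infinite sequence of non-zero linear combinations of the $e_i$ over successive finite sets. For a family $\mathcal F$ of finite sets, an equivalent norm $|\cdot|$ on $X$ is a $t$-$\mathcal F$ distortion if for every normalized block sequence $(x_i)$ there are $E\in\mathcal F$ and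 $x,y\in\operatorname{span}\{x_i:i\in E\}$ with $\|x\|=\|y\|=1$ and $|x|/|y|>t$. $AD(X)$ is the least $\xi<\omega_1$ such that for every $t\ge1$ there is a $t$-$\mathcal S_\xi$ distortion of $X$, and $AD(X)=\omega_1$ if there is no such $\xi$. A block subspace is the closed span of a block sequence, and its index is taken with respect to that block sequence as basis. **Spreading models.** A basic sequence $(x_i)$ is an $\ell_1^{\zeta}$ (respectively $c_0^{\zeta}$) spreading model if there are $c,C>0$ such that for all $E\in\mathcal S_\zeta$ and scalars $(a_i)_{i\in E}$ the norm $\|\sum_{i\in E}a_ix_i\|$ lies between $c^{-1}N$ and $CN$, where $N=\sum_{i\in E}|a_i|$ (respectively $N=\max_{i\in E}|a_i|$). **The space.** Let $\xi<\omega_1$. Let $W_0=\{\pm e_n\}\subset c_{00}(\mathbb N)$. Given $W_m$, an $\alpha$-average of size $\ell\ge2$ over $W_m$ is a vector $\frac1\ell\sum_{q=1}^d f_q$ with $f_1<\dots<f_d$ (successive supports) in $W_m$ and $1\le d\le\ell$. Let $W_{m+1}$ consist of $W_m$, of all $\alpha$-averages over $W_m$, and of all sums $\sum_{q=1}^d\alpha_q$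 with $d\ge1$, where $\alpha_1<\dots<\alpha_d$ are elements of $W_m$ that are $\alpha$-averages over $W_m$ of sizes $s_1<\dots<s_d$, with $s_q>\max\operatorname{supp}\alpha_{q-1}$ for $q>1$ and $\{\min\operatorname{supp}\alpha_q:q\le d\}\in\mathcal S_{\omega^\xi}$. Let $W=\bigcup_mW_m$ and let $\mathfrak X_{0,1}^{\omega^\xi}$ be the completion of the real space $c_{00}(\mathbb N)$ in the norm $\|x\|=\sup\{\sum_if(i)x(i):f\in W\}$, with its unit vector basis. **Theorem.** For every countable ordinal $\xi$: (1) $\mathfrak X_{0,1}^{\omega^\xi}$ is reflexive. (2) Every block sequence of the unit vector basis is basic, and every block subspace $X$ of $\mathfrak X_{0,1}^{\omega^\xi}$ satisfies $AD(X)=\omega^\xi+1$. (3) Every infinite-dimensional subspace of $\mathfrak X_{0,1}^{\omega^\xi}$ contains a $c_0^1$ spreading model and an $\ell_1^{\omega^\xi}$ spreading model. (4) For every $n\in\mathbb N$, $|x|_n=\sup\{\sum_{i=1}^n\|I_ix\|: I_1<\dots<I_n\text{ intervals of }\mathbb N\}$, where $I_ix$ is the restriction of $x$ to $I_i$, is an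 equivalent norm on $\mathfrak X_{0,1}^{\omega^\xi}$ that is an $(n-\delta)$-$\mathcal S_{\omega^\xi+1}$ distortion for every $\delta>0$. -/

import Mathlib

open scoped Ordinal

noncomputable section

/-! ## Schreier families

The natural numbers start at one, so all sequences are indexed by `ℕ+`. -/

/-- `F < G` for finite sets of positive integers: every element of `F` is below every
element of `G`. -/
def FinsetBefore (F G : Finset ℕ+) : Prop := ∀ m ∈ F, ∀ n ∈ G, m < n

/-- `𝓢₀`: the empty set and the singletons. -/
def schreierZero : Set (Finset ℕ+) := {E | E = ∅ ∨ ∃ n, E = {n}}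

/-- `𝓢₁ = {E : |E| ≤ min E}`. -/
def schreierOne : Set (Finset ℕ+) := {E | ∀ n ∈ E, E.card ≤ (n : ℕ)}

/-- `𝓕[𝓖]`: the unions `E₁ ∪ ⋯ ∪ E_d` of successive members of `𝓖` such that the set of the
minima of the `E_i` belongs to `𝓕`. -/
def familyComp (F G : Set (Finset ℕ+)) : Set (Finset ℕ+) :=
  {A | ∃ (d : ℕ) (E : Fin d → Finset ℕ+) (k : Fin d → ℕ+),
    (∀ i, E i ∈ G) ∧ (∀ i j, i < j → FinsetBefore (E i) (E j)) ∧
    (∀ i, IsLeast (E i : Set ℕ+) (k i)) ∧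
    Finset.univ.image k ∈ F ∧ A = Finset.univ.biUnion E}

/-- The Schreier family `𝓢_ξ`, for a choice `φ` of a sequence `φ ξ 1, φ ξ 2, …` of ordinals
below each limit ordinal `ξ`: `𝓢_{ξ+1} = 𝓢₁[𝓢_ξ]`, and for a limit ordinal `ξ` the family `𝓢_ξ`
consists of the `E` with `n ≤ E ∈ 𝓢_{φ ξ n}` for some `n`. -/
def schreier (φ : Ordinal.{0} → ℕ+ → Ordinal.{0}) (ξ : Ordinal.{0}) : Set (Finset ℕ+) :=
  Ordinal.limitRecOn (motive := fun _ => Set (Finset ℕ+)) ξ schreierZero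
    (fun _ G => familyComp schreierOne G)
    (fun ξ _ S => {E | ∃ (n : ℕ+) (h : φ ξ n < ξ), (∀ m ∈ E, n ≤ m) ∧ E ∈ S (φ ξ n) h})

theorem schreier_zero (φ : Ordinal.{0} → ℕ+ → Ordinal.{0}) : schreier φ 0 = schreierZero := by
  unfold schreier
  exact Ordinal.limitRecOn_zero ..

theorem schreier_add_one (φ : Ordinal.{0} → ℕ+ → Ordinal.{0}) (ξ : Ordinal.{0}) :
    schreier φ (ξ + 1) = familyComp schreierOne (schreier φ ξ) := by
  unfold schreier
  exact Ordinal.limitRecOn_add_one ..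

theorem schreier_limit (φ : Ordinal.{0} → ℕ+ → Ordinal.{0}) (ξ : Ordinal.{0})
    (hξ : Order.IsSuccLimit ξ) :
    schreier φ ξ =
      {E | ∃ n : ℕ+, φ ξ n < ξ ∧ (∀ m ∈ E, n ≤ m) ∧ E ∈ schreier φ (φ ξ n)} := by
  unfold schreier
  rw [Ordinal.limitRecOn_limit _ _ _ _ hξ]
  ext E
  simp only [Set.mem_ofPred_eq, exists_prop]

theorem schreier_one (φ : Ordinal.{0} → ℕ+ → Ordinal.{0}) : schreier φ 1 = schreierOne := by
  rw [← zero_add (1 : Ordinal.{0}), schreier_add_one, schreier_zero]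
  ext A
  constructor
  · rintro ⟨d, E, k, hE, -, hk, hF, rfl⟩
    have hEk : ∀ i, E i = {k i} := fun i => by
      have h1 : k i ∈ E i := (hk i).1
      rcases hE i with h | ⟨n, h⟩
      · simp [h] at h1
      · rw [h, Finset.mem_singleton] at h1
        rw [h, h1]
    have : Finset.univ.biUnion E = Finset.univ.image k := by
      ext m
      simp [hEk, eq_comm]
    rwa [this]
  · intro hA
    have himg : Finset.univ.image (fun i => A.orderEmbOfFin rfl i) = A := by
      ext m
      simp
    refine ⟨A.card, fun i => {A.orderEmbOfFin rfl i}, fun i => A.orderEmbOfFin rfl i,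
      fun i => Or.inr ⟨_, rfl⟩, fun i j hij m hm n hn => ?_, fun i => by simp, ?_, ?_⟩
    · rw [Finset.mem_singleton] at hm hn
      rw [hm, hn]
      exact (A.orderEmbOfFin rfl).strictMono hij
    · rw [himg]
      exact hA
    · rw [Finset.biUnion_singleton, himg]

/-- `φ` is an admissible choice of sequences for the definition of the Schreier families: for each
countable limit ordinal `ξ`, `φ ξ n` increases strictly to `ξ`, and
`𝓢_{φ ξ n} ⊆ 𝓢_{φ ξ (n+1)}` for every `n`. -/
structure IsSchreierChoice (φ : Ordinal.{0} → ℕ+ → Ordinal.{0}) : Prop where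
  strictMono : ∀ ξ < ω₁, Order.IsSuccLimit ξ → StrictMono (φ ξ)
  isLUB : ∀ ξ < ω₁, Order.IsSuccLimit ξ → IsLUB (Set.range (φ ξ)) ξ
  nested : ∀ ξ < ω₁, Order.IsSuccLimit ξ → ∀ n : ℕ+,
    schreier φ (φ ξ n) ⊆ schreier φ (φ ξ (n + 1))

/-! ## Block sequences, basic sequences, spreading models and the distortion index -/

section Banach

variable {X : Type*} [NormedAddCommGroup X] [NormedSpace ℝ X]

/-- `x` is an (infinite) block sequence of `e`: non-zero linear combinations of the `e j` over
successive finite sets. -/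
def IsBlockSeq (e x : ℕ+ → X) : Prop :=
  ∃ (E : ℕ+ → Finset ℕ+) (a : ℕ+ → ℝ), (∀ i j, i < j → FinsetBefore (E i) (E j)) ∧
    ∀ i, x i = ∑ j ∈ E i, a j • e j ∧ x i ≠ 0

/-- The closed linear span of a sequence. -/
def closedSpan (x : ℕ+ → X) : Submodule ℝ X :=
  (Submodule.span ℝ (Set.range x)).topologicalClosure

/-- A sequence, as a sequence in its closed linear span. -/
def toClosedSpan (x : ℕ+ → X) (i : ℕ+) : closedSpan x :=
  ⟨x i, Submodule.le_topologicalClosure _ (Submodule.subset_span (Set.mem_range_self i))⟩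

/-- `x` is a Schauder basic sequence: a Schauder basis of its closed linear span. -/
def IsBasicSeq (x : ℕ+ → X) : Prop :=
  ∃ b : GeneralSchauderBasis ℕ+ ℝ (closedSpan x) (SummationFilter.conditional ℕ+),
    b.basis = toClosedSpan x

/-- `x` is a `K`-`ℓ₁^𝓕` spreading model. -/
def IsEllOneSpreadingModel (F : Set (Finset ℕ+)) (K : ℝ) (x : ℕ+ → X) : Prop :=
  IsBasicSeq x ∧ ∃ c > 0, ∃ C > 0, c * C ≤ K ∧ ∀ E ∈ F, ∀ a : ℕ+ → ℝ,
    c⁻¹ * ∑ i ∈ E, |a i| ≤ ‖∑ i ∈ E, a i • x i‖ ∧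
    ‖∑ i ∈ E, a i • x i‖ ≤ C * ∑ i ∈ E, |a i|

/-- `x` is a `K`-`c₀^𝓕` spreading model. The supremum over the empty set is zero. -/
def IsCZeroSpreadingModel (F : Set (Finset ℕ+)) (K : ℝ) (x : ℕ+ → X) : Prop :=
  IsBasicSeq x ∧ ∃ c > 0, ∃ C > 0, c * C ≤ K ∧ ∀ E ∈ F, ∀ a : ℕ+ → ℝ,
    c⁻¹ * ((E.sup fun i => ‖a i‖₊ : NNReal) : ℝ) ≤ ‖∑ i ∈ E, a i • x i‖ ∧
    ‖∑ i ∈ E, a i • x i‖ ≤ C * ((E.sup fun i => ‖a i‖₊ : NNReal) : ℝ)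

/-- The equivalent norm `p` is a `t`-`𝓕` distortion of the space `X` with basis `e`: every
normalized block sequence `x` of `e` admits `E ∈ 𝓕` and norm-one vectors `u`, `v` in the span of
the `x i`, `i ∈ E`, with `p u / p v > t`. -/
def IsDistortion (F : Set (Finset ℕ+)) (t : ℝ) (e : ℕ+ → X) (p : Seminorm ℝ X) : Prop :=
  (∃ c > 0, ∃ C > 0, ∀ x, c * ‖x‖ ≤ p x ∧ p x ≤ C * ‖x‖) ∧
  ∀ x : ℕ+ → X, IsBlockSeq e x → (∀ i, ‖x i‖ = 1) →
    ∃ E ∈ F, ∃ u ∈ Submodule.span ℝ (x '' (E : Set ℕ+)),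
      ∃ v ∈ Submodule.span ℝ (x '' (E : Set ℕ+)), ‖u‖ = 1 ∧ ‖v‖ = 1 ∧ t < p u / p v

/-- The space `X` with basis `e` is `𝓕` arbitrarily distortable. -/
def IsArbitrarilyDistortable (F : Set (Finset ℕ+)) (e : ℕ+ → X) : Prop :=
  ∀ t : ℝ, 1 ≤ t → ∃ p : Seminorm ℝ X, IsDistortion F t e p

/-- The index `AD(X)` of the space `X` with basis `e`: the least `ξ < ω₁` such that `X` is `𝓢_ξ`
arbitrarily distortable, and `ω₁` if there is no such `ξ`. -/
def distortionIndex (φ : Ordinal.{0} → ℕ+ → Ordinal.{0}) (e : ℕ+ → X) : Ordinal.{0} :=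
  sInf (insert ω₁ {ξ | ξ < ω₁ ∧ IsArbitrarilyDistortable (schreier φ ξ) e})

end Banach

/-- Reflexivity: the canonical map into the bidual is onto. -/
def IsReflexiveSpace (X : Type*) [NormedAddCommGroup X] [NormedSpace ℝ X] : Prop :=
  Function.Surjective (NormedSpace.inclusionInDoubleDual ℝ X)

/-! ## The norming set -/

/-- `f < g` for finitely supported vectors. -/
def SuppBefore (f g : ℕ+ →₀ ℝ) : Prop := FinsetBefore f.support g.support

/-- `α` is an average of size `l` of successive members of `G`: `α = (1/l) (f₁ + ⋯ + f_d)` with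
`f₁ < ⋯ < f_d` in `G`, `1 ≤ d ≤ l` and `2 ≤ l`. -/
def IsAverage (G : Set (ℕ+ →₀ ℝ)) (l : ℕ) (α : ℕ+ →₀ ℝ) : Prop :=
  2 ≤ l ∧ ∃ (d : ℕ) (f : Fin d → (ℕ+ →₀ ℝ)), 1 ≤ d ∧ d ≤ l ∧ (∀ q, f q ∈ G) ∧
    (∀ q r, q < r → SuppBefore (f q) (f r)) ∧ α = (l : ℝ)⁻¹ • ∑ q, f q

/-- `g = α₁ + ⋯ + α_d` for an `S`-admissible and very fast growing sequence of `α`-averages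
`α_q ∈ G`, where `s q` is a size of `α_q` and `k q` is the minimum of its support. -/
def IsSchreierFunctional (S : Set (Finset ℕ+)) (G : Set (ℕ+ →₀ ℝ)) (g : ℕ+ →₀ ℝ) : Prop :=
  ∃ (d : ℕ) (α : Fin d → (ℕ+ →₀ ℝ)) (s : Fin d → ℕ) (k : Fin d → ℕ+), 1 ≤ d ∧
    (∀ q, α q ∈ G ∧ IsAverage G (s q) (α q)) ∧
    (∀ q r, q < r → SuppBefore (α q) (α r)) ∧
    (∀ q, IsLeast ((α q).support : Set ℕ+) (k q)) ∧ Finset.univ.image k ∈ S ∧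
    (∀ q r, q < r → s q < s r ∧ ∀ i ∈ (α q).support, (i : ℕ) < s r) ∧
    g = ∑ q, α q

/-- The sets `W₀ ⊆ W₁ ⊆ ⋯`. -/
def normingLevel (S : Set (Finset ℕ+)) : ℕ → Set (ℕ+ →₀ ℝ)
  | 0 => {f | ∃ n, f = Finsupp.single n 1 ∨ f = -Finsupp.single n 1}
  | m + 1 => {f | ∃ l, IsAverage (normingLevel S m) l f} ∪
      {f | IsSchreierFunctional S (normingLevel S m) f} ∪ normingLevel S m

/-- The norming set `W = ⋃ₘ Wₘ`. -/
def normingSet (S : Set (Finset ℕ+)) : Set (ℕ+ →₀ ℝ) := ⋃ m, normingLevel S m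

theorem IsAverage.neg {G : Set (ℕ+ →₀ ℝ)} (hG : ∀ f ∈ G, -f ∈ G) {l : ℕ} {α : ℕ+ →₀ ℝ}
    (h : IsAverage G l α) : IsAverage G l (-α) := by
  obtain ⟨hl, d, f, h1, h2, h3, h4, rfl⟩ := h
  refine ⟨hl, d, fun q => -f q, h1, h2, fun q => hG _ (h3 q), fun q r hqr => ?_, ?_⟩
  · simpa [SuppBefore] using h4 q r hqr
  · simp

theorem normingLevel_neg (S : Set (Finset ℕ+)) (m : ℕ) :
    ∀ f ∈ normingLevel S m, -f ∈ normingLevel S m := by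
  induction m with
  | zero =>
    rintro f ⟨n, rfl | rfl⟩
    · exact ⟨n, Or.inr rfl⟩
    · exact ⟨n, Or.inl (neg_neg _)⟩
  | succ m ih =>
    rintro f ((⟨l, hf⟩ | ⟨d, α, s, k, h1, h2, h3, h4, h5, h6, rfl⟩) | hf)
    · exact Or.inl (Or.inl ⟨l, hf.neg ih⟩)
    · refine Or.inl (Or.inr ⟨d, fun q => -α q, s, k, h1,
        fun q => ⟨ih _ (h2 q).1, (h2 q).2.neg ih⟩, ?_, ?_, h5, ?_, ?_⟩)
      · simpa [SuppBefore] using h3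
      · simpa using h4
      · simpa using h6
      · simp
    · exact Or.inr (ih f hf)

theorem normingLevel_abs_le (S : Set (Finset ℕ+)) (m : ℕ) :
    ∀ f ∈ normingLevel S m, ∀ i, |f i| ≤ 1 := by
  induction m with
  | zero =>
    rintro f ⟨n, rfl | rfl⟩ i <;> by_cases h : n = i <;> simp [h]
  | succ m ih =>
    rintro f ((⟨l, hl, d, f, h1, h2, h3, h4, rfl⟩ |
      ⟨d, α, s, k, h1, h2, h3, h4, h5, h6, rfl⟩) | hf) i
    · have hl0 : (0 : ℝ) < l := by exact_mod_cast (by omega : 0 < l)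
      rw [Finsupp.smul_apply, Finsupp.finsetSum_apply, smul_eq_mul, abs_mul, abs_inv,
        abs_of_pos hl0, inv_mul_le_iff₀ hl0, mul_one]
      calc |∑ q, f q i| ≤ ∑ q, |f q i| := Finset.abs_sum_le_sum_abs _ _
        _ ≤ ∑ _q : Fin d, (1 : ℝ) := Finset.sum_le_sum fun q _ => ih _ (h3 q) i
        _ = d := by simp
        _ ≤ l := by exact_mod_cast h2
    · rw [Finsupp.finsetSum_apply]
      by_cases hq : ∃ q, α q i ≠ 0
      · obtain ⟨q, hq⟩ := hq
        rw [Finset.sum_eq_single q]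
        · exact ih _ (h2 q).1 i
        · intro r _ hrq
          by_contra hr
          rcases lt_or_gt_of_ne hrq with h | h
          · exact lt_irrefl _ (h3 r q h i (by simpa using hr) i (by simpa using hq))
          · exact lt_irrefl _ (h3 q r h i (by simpa using hq) i (by simpa using hr))
        · simp
      · push Not at hq
        simp [hq]
    · exact ih f hf i

theorem normingSet_neg {S : Set (Finset ℕ+)} {f : ℕ+ →₀ ℝ} (hf : f ∈ normingSet S) :
    -f ∈ normingSet S := by
  obtain ⟨m, hm⟩ := Set.mem_iUnion.1 hf
  exact Set.mem_iUnion.2 ⟨m, normingLevel_neg S m f hm⟩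

theorem single_mem_normingSet (S : Set (Finset ℕ+)) (n : ℕ+) :
    Finsupp.single n (1 : ℝ) ∈ normingSet S :=
  Set.mem_iUnion.2 ⟨0, n, Or.inl rfl⟩

/-! ## The space -/

/-- The space `c₀₀(ℕ)`, to be normed by the set `W` that is built from the family `S`. -/
def PreX01 (_S : Set (Finset ℕ+)) : Type := ℕ+ →₀ ℝ

instance (S : Set (Finset ℕ+)) : AddCommGroup (PreX01 S) :=
  inferInstanceAs (AddCommGroup (ℕ+ →₀ ℝ))

instance (S : Set (Finset ℕ+)) : Module ℝ (PreX01 S) :=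
  inferInstanceAs (Module ℝ (ℕ+ →₀ ℝ))

/-- The vector of `c₀₀(ℕ)` that underlies an element of `PreX01 S`. -/
def PreX01.vec (S : Set (Finset ℕ+)) : PreX01 S ≃ₗ[ℝ] (ℕ+ →₀ ℝ) := LinearEquiv.refl ℝ _

/-- The action `f(x) = ∑ f(i) x(i)` of a functional `f ∈ c₀₀(ℕ)` on `x ∈ c₀₀(ℕ)`. -/
def pairing (f : ℕ+ →₀ ℝ) : (ℕ+ →₀ ℝ) →ₗ[ℝ] ℝ := Finsupp.lsum ℝ fun i => f i • LinearMap.id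

theorem pairing_apply (f x : ℕ+ →₀ ℝ) : pairing f x = ∑ i ∈ x.support, f i * x i := by
  simp [pairing, Finsupp.sum]

/-- `‖x‖ = sup {f(x) : f ∈ W}`. -/
instance (S : Set (Finset ℕ+)) : Norm (PreX01 S) :=
  ⟨fun x => sSup ((fun f => pairing f (PreX01.vec S x)) '' normingSet S)⟩

theorem PreX01.norm_def {S : Set (Finset ℕ+)} (x : PreX01 S) :
    ‖x‖ = sSup ((fun f => pairing f (PreX01.vec S x)) '' normingSet S) := rfl

theorem bddAbove_pairing (S : Set (Finset ℕ+)) (x : ℕ+ →₀ ℝ) :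
    BddAbove ((fun f => pairing f x) '' normingSet S) := by
  refine ⟨∑ i ∈ x.support, |x i|, ?_⟩
  rintro _ ⟨f, hf, rfl⟩
  obtain ⟨m, hm⟩ := Set.mem_iUnion.1 hf
  simp only [pairing_apply]
  refine Finset.sum_le_sum fun i _ => (le_abs_self _).trans ?_
  rw [abs_mul]
  exact mul_le_of_le_one_left (abs_nonneg _) (normingLevel_abs_le S m f hm i)

theorem PreX01.abs_pairing_le {S : Set (Finset ℕ+)} (x : PreX01 S) {f : ℕ+ →₀ ℝ}
    (hf : f ∈ normingSet S) : |pairing f (PreX01.vec S x)| ≤ ‖x‖ := by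
  refine abs_le'.2 ⟨le_csSup (bddAbove_pairing S _) ⟨f, hf, rfl⟩,
    le_csSup (bddAbove_pairing S _) ⟨-f, normingSet_neg hf, ?_⟩⟩
  simp [pairing_apply]

theorem PreX01.norm_le {S : Set (Finset ℕ+)} (x : PreX01 S) {r : ℝ}
    (h : ∀ f ∈ normingSet S, pairing f (PreX01.vec S x) ≤ r) : ‖x‖ ≤ r := by
  refine csSup_le ⟨_, _, single_mem_normingSet S 1, rfl⟩ ?_
  rintro _ ⟨f, hf, rfl⟩
  exact h f hf

theorem PreX01.abs_coord_le {S : Set (Finset ℕ+)} (x : PreX01 S) (i : ℕ+) :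
    |PreX01.vec S x i| ≤ ‖x‖ := by
  have h := PreX01.abs_pairing_le x (single_mem_normingSet S i)
  have h2 : pairing (Finsupp.single i 1) (PreX01.vec S x) = PreX01.vec S x i := by
    simp [pairing_apply, Finsupp.single_apply]
    exact fun h => h.symm
  rwa [h2] at h

theorem PreX01.normCore (S : Set (Finset ℕ+)) : NormedSpace.Core ℝ (PreX01 S) where
  norm_nonneg x := (abs_nonneg _).trans (PreX01.abs_coord_le x 1)
  norm_smul c x := by
    have key : ∀ (c : ℝ) (x : PreX01 S), ‖c • x‖ ≤ ‖c‖ * ‖x‖ := fun c x => by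
      refine PreX01.norm_le _ fun f hf => (le_abs_self _).trans ?_
      rw [map_smul, map_smul, smul_eq_mul, abs_mul]
      exact mul_le_mul_of_nonneg_left (PreX01.abs_pairing_le x hf) (abs_nonneg c)
    refine le_antisymm (key c x) ?_
    rcases eq_or_ne c 0 with rfl | hc
    · simpa using (abs_nonneg _).trans (PreX01.abs_coord_le ((0 : ℝ) • x) 1)
    · have h := key c⁻¹ (c • x)
      rw [smul_smul, inv_mul_cancel₀ hc, one_smul, norm_inv] at h
      have hc' : 0 < ‖c‖ := norm_pos_iff.2 hc
      calc ‖c‖ * ‖x‖ ≤ ‖c‖ * (‖c‖⁻¹ * ‖c • x‖) := mul_le_mul_of_nonneg_left h hc'.le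
        _ = ‖c • x‖ := by field_simp
  norm_triangle x y := by
    refine PreX01.norm_le _ fun f hf => ?_
    rw [map_add, map_add]
    exact add_le_add ((le_abs_self _).trans (PreX01.abs_pairing_le x hf))
      ((le_abs_self _).trans (PreX01.abs_pairing_le y hf))
  norm_eq_zero_iff x := by
    constructor
    · intro h
      apply (PreX01.vec S).injective
      ext i
      simpa [h] using PreX01.abs_coord_le x i
    · rintro rfl
      refine le_antisymm (PreX01.norm_le _ fun f _ => by simp)
        ((abs_nonneg _).trans (PreX01.abs_coord_le 0 1))

instance (S : Set (Finset ℕ+)) : NormedAddCommGroup (PreX01 S) :=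
  NormedAddCommGroup.ofCore (PreX01.normCore S)

instance (S : Set (Finset ℕ+)) : NormedSpace ℝ (PreX01 S) :=
  NormedSpace.ofCore (PreX01.normCore S)

/-- The completion of `(c₀₀(ℕ), ‖·‖)`. For `S = 𝓢_{ω^ξ}` this is the space `𝔛_{0,1}^{ω^ξ}`. -/
abbrev X01 (S : Set (Finset ℕ+)) : Type := UniformSpace.Completion (PreX01 S)

/-- The unit vector basis. -/
def X01.e (S : Set (Finset ℕ+)) (i : ℕ+) : X01 S :=
  ((PreX01.vec S).symm (Finsupp.single i 1) : PreX01 S)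

/-- The `i`-th coordinate functional on `c₀₀(ℕ)`. -/
def PreX01.coord (S : Set (Finset ℕ+)) (i : ℕ+) : PreX01 S →L[ℝ] ℝ :=
  (Finsupp.lapply i ∘ₗ (PreX01.vec S).toLinearMap).mkContinuous 1 fun x => by
    simpa using PreX01.abs_coord_le x i

/-- The `i`-th coordinate functional: the continuous extension of `x ↦ x i`. -/
def X01.coord (S : Set (Finset ℕ+)) (i : ℕ+) : X01 S →L[ℝ] ℝ :=
  (PreX01.coord S i).extend (UniformSpace.Completion.toComplL (𝕜 := ℝ) (E := PreX01 S))

theorem X01.coord_coe (S : Set (Finset ℕ+)) (i : ℕ+) (x : PreX01 S) :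
    X01.coord S i (x : X01 S) = PreX01.vec S x i :=
  ContinuousLinearMap.extend_eq (e := UniformSpace.Completion.toComplL (𝕜 := ℝ) (E := PreX01 S))
    (PreX01.coord S i) UniformSpace.Completion.denseRange_coe
    (UniformSpace.Completion.isUniformInducing_coe _) x

/-- The restriction `I x` of a vector to the interval `I = [a, b]`. -/
def X01.restrict (S : Set (Finset ℕ+)) (a b : ℕ+) (x : X01 S) : X01 S :=
  ∑ i ∈ Finset.Icc a b, X01.coord S i x • X01.e S i

/-- The sums `‖I₁ x‖ + ⋯ + ‖I_n x‖` over intervals `I₁ < ⋯ < I_n`; their supremum is `|x|_n`. -/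
def X01.intervalSums (S : Set (Finset ℕ+)) (n : ℕ) (x : X01 S) : Set ℝ :=
  {r | ∃ a b : Fin n → ℕ+, (∀ q, a q ≤ b q) ∧ (∀ q q', q < q' → b q < a q') ∧
    r = ∑ q, ‖X01.restrict S (a q) (b q) x‖}

end

noncomputable section

section

/-! ## Recursive choice of sequences -/

/-! Write `S` for the family of order `ω ^ ξ`. Only a few properties of `S` matter, collected in
`IsIndecomposableFamily`: `S` is the diagonal union of an increasing sequence of regular families `A
n`; since `ω ^ ξ` is additively indecomposable, unions of successive members of `A m` along a member
of `A n` lie, far out, in a single `A k`; and `S` carries convex combinations that give little mass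
to members of `A m`.

The engine is a dichotomy for a block sequence (`isIndexZero_or_exists_ellOne`). If averages of
large size with minima in a fixed `A m` act on it asymptotically as zero, it has index zero
(`IsIndexZero`). Otherwise functionals that do not tend to zero are concatenated along a subsequence
into elements of the norming set, because `A m` is absorbed by `S`, and this gives a lower
`ℓ₁`-estimate over `S`. Index zero yields a subsequence with the upper `c₀`-estimate over
`schreierOne` with constant `1 + ε` (`actsSmall_of_mem`): very fast growth forces all averages after
the first one that meets a vector to have large size. The two alternatives feed each other: special
convex combinations of an `ℓ₁`-sequence have index zero (`isIndexZero_of_smallOn`), while long sums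
of a `c₀`-sequence are normed by averages of growing size and hence are `ℓ₁` over `S`
(`exists_ellOne_of_averages`). A James-type argument (`exists_almost_isometric_ellOne_blocks`)
improves the `ℓ₁`-constant. So every normalized block sequence has further blocks, over members of
`S`, of both kinds.

For the distortion, a sum of `n` vectors of `c₀`-type has norm about `1` and interval norm at least
`n`. A sum of `N` vectors of `ℓ₁`-type, `N` large, has norm at least `N` and interval norm about
`N`, because `n` intervals cut at most `n` blocks more than once. Both sums fit into one member of
`𝓢₁[S]`. At the orders up to `ω ^ ξ` the James argument, applied to an arbitrary equivalent norm on
`ℓ₁`-blocks, makes both norms comparable to the same `ℓ₁`-norm, so no norm distorts by more than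
`4`.

Reflexivity follows James's scheme: the basis is boundedly complete because blocks with bounded sums
contradict the `ℓ₁`-estimate for long sums, and shrinking because a functional bounded below on
blocks stays so on convex combinations and contradicts the `c₀`-estimate. Arbitrary subspaces are
reached by perturbing blocks; the basis is unconditional with constant one, since the norming set is
stable under restriction to any set of coordinates. -/

theorem exists_seq {T : Type*} (P Q : ℕ+ → T → Prop) (b : T → ℕ+)
    (hQ : ∀ m n τ, m ≤ n → Q n τ → Q m τ) (h : ∀ i n, ∃ τ, P i τ ∧ Q n τ) :
    ∃ τ : ℕ+ → T, (∀ i, P i (τ i)) ∧ ∀ i j, i < j → Q (b (τ i)) (τ j) := by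
  choose f hf using h
  -- The second component is the running maximum of `b`. Since `Q` passes to smaller thresholds, a
  -- choice made against this maximum satisfies `Q` against every earlier term.
  let r : ℕ → T × ℕ+ := fun n => Nat.rec (f 1 1, b (f 1 1))
    (fun k p => (f k.succ.succPNat p.2, max p.2 (b (f k.succ.succPNat p.2)))) n
  have hr : ∀ k, r (k + 1) = (f k.succ.succPNat (r k).2,
      max (r k).2 (b (f k.succ.succPNat (r k).2))) := fun k => rfl
  have hmono : Monotone fun k => (r k).2 := monotone_nat_of_le_succ fun k => by
    rw [hr]; exact le_max_left _ _
  have hb : ∀ k, b (r k).1 ≤ (r k).2 := by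
    rintro (_ | k)
    · exact le_rfl
    · rw [hr]; exact le_max_right _ _
  have hP : ∀ k : ℕ, P k.succPNat (r k).1 := by
    rintro (_ | k)
    · exact (hf 1 1).1
    · rw [hr]; exact (hf _ _).1
  refine ⟨fun i => (r i.natPred).1, fun i => ?_, fun i j hij => ?_⟩
  · simpa using hP i.natPred
  · have hij' : i.natPred < j.natPred := PNat.natPred_lt_natPred.2 hij
    obtain ⟨k, hk⟩ : ∃ k, j.natPred = k + 1 := ⟨j.natPred - 1, by omega⟩
    simp only [hk]
    rw [hr]
    exact hQ _ _ _ ((hb _).trans (hmono (by omega : i.natPred ≤ k))) (hf _ _).2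

/-! ## Families of finite sets -/

theorem FinsetBefore.mono {F G F' G' : Finset ℕ+} (h : FinsetBefore F G) (hF : F' ⊆ F)
    (hG : G' ⊆ G) : FinsetBefore F' G' :=
  fun m hm n hn => h m (hF hm) n (hG hn)

/-- A hereditary and spreading family that contains the singletons. -/
structure IsRegularFamily (F : Set (Finset ℕ+)) : Prop where
  hereditary : ∀ E ∈ F, ∀ E' ⊆ E, E' ∈ F
  spreading : ∀ E ∈ F, ∀ g : ℕ+ → ℕ+, StrictMonoOn g E → (∀ i ∈ E, i ≤ g i) → E.image g ∈ F
  singleton : ∀ k, {k} ∈ F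

theorem IsRegularFamily.empty_mem {F : Set (Finset ℕ+)} (h : IsRegularFamily F) : ∅ ∈ F :=
  h.hereditary _ (h.singleton 1) _ (Finset.empty_subset _)

/-- The map sending `k q` to `k' q` is a spread. This form of spreading compares two enumerations of
the same index set, which is how minima of supports are moved to the right later. -/
theorem IsRegularFamily.image_mem {F : Set (Finset ℕ+)} (hF : IsRegularFamily F) {κ : Type*}
    [LinearOrder κ] {Q : Finset κ} {k k' : κ → ℕ+} (h : Q.image k ∈ F)
    (hk : StrictMonoOn k Q) (hk' : StrictMonoOn k' Q) (hle : ∀ q ∈ Q, k q ≤ k' q) :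
    Q.image k' ∈ F := by
  rcases Q.eq_empty_or_nonempty with rfl | ⟨q0, -⟩
  · simpa using hF.empty_mem
  have : Nonempty κ := ⟨q0⟩
  have hinv : ∀ q ∈ Q, Function.invFunOn k Q (k q) = q := fun q hq =>
    hk.injOn.leftInvOn_invFunOn hq
  have := hF.spreading _ h (fun n => k' (Function.invFunOn k Q n)) ?_ ?_
  · rw [Finset.image_image] at this
    convert this using 1
    refine Finset.image_congr fun q hq => ?_
    simp only [Function.comp, hinv q hq]
  · intro a ha b hb hab
    simp only [Finset.coe_image, Set.mem_image, Finset.mem_coe] at ha hb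
    obtain ⟨q, hq, rfl⟩ := ha
    obtain ⟨r, hr, rfl⟩ := hb
    simp only [hinv q hq, hinv r hr]
    exact hk' hq hr ((hk.lt_iff_lt hq hr).1 hab)
  · intro i hi
    obtain ⟨q, hq, rfl⟩ := Finset.mem_image.1 hi
    simp only [hinv q hq]
    exact hle q hq

theorem isRegularFamily_schreierZero : IsRegularFamily schreierZero where
  hereditary := by
    rintro E (rfl | ⟨n, rfl⟩) E' h
    · exact Or.inl (Finset.subset_empty.1 h)
    · rcases Finset.subset_singleton_iff.1 h with h | h
      · exact Or.inl h
      · exact Or.inr ⟨n, h⟩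
  spreading := by
    rintro E (rfl | ⟨n, rfl⟩) g _ _
    · exact Or.inl (by simp)
    · exact Or.inr ⟨g n, by simp⟩
  singleton k := Or.inr ⟨k, rfl⟩

theorem isRegularFamily_card_le (n : ℕ) (hn : 1 ≤ n) :
    IsRegularFamily {E | E.card ≤ n} where
  hereditary _ h _ h' := (Finset.card_le_card h').trans h
  spreading _ h _ _ _ := Finset.card_image_le.trans h
  singleton k := by simpa using hn

/-- Together with `familyComp_schreierOne_dest` this trades the set of minima for the condition that
the number of pieces is at most every element. Empty pieces are allowed here: dropping them only
lowers their number. -/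
theorem familyComp_schreierOne_mk {G : Set (Finset ℕ+)} {d : ℕ} (E : Fin d → Finset ℕ+)
    (hG : ∀ i, E i ∈ G) (hlt : ∀ i j, i < j → FinsetBefore (E i) (E j))
    (hd : ∀ i, ∀ n ∈ E i, d ≤ (n : ℕ)) :
    Finset.univ.biUnion E ∈ familyComp schreierOne G := by
  classical
  set I : Finset (Fin d) := Finset.univ.filter fun i => (E i).Nonempty with hI
  set o := I.orderEmbOfFin rfl
  have hne : ∀ q, (E (o q)).Nonempty := fun q =>
    (Finset.mem_filter.1 (I.orderEmbOfFin_mem rfl q)).2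
  refine ⟨I.card, fun q => E (o q), fun q => (E (o q)).min' (hne q), fun q => hG _,
    fun i j hij => hlt _ _ (o.strictMono hij), fun q => ?_, fun n hn => ?_, ?_⟩
  · exact ⟨Finset.min'_mem _ _, fun n hn => Finset.min'_le _ _ hn⟩
  · obtain ⟨q, -, rfl⟩ := Finset.mem_image.1 hn
    calc _ ≤ Fintype.card (Fin I.card) := Finset.card_image_le
      _ = I.card := Fintype.card_fin _
      _ ≤ d := (Finset.card_le_univ I).trans (by simp)
      _ ≤ _ := hd (o q) _ (Finset.min'_mem _ _)
  · ext n
    simp only [Finset.mem_biUnion, Finset.mem_univ, true_and]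
    constructor
    · rintro ⟨i, hi⟩
      have : i ∈ Set.range o := by
        rw [Finset.range_orderEmbOfFin]
        simpa [hI] using ⟨n, hi⟩
      obtain ⟨q, rfl⟩ := this
      exact ⟨q, hi⟩
    · rintro ⟨q, hq⟩
      exact ⟨_, hq⟩

theorem familyComp_schreierOne_dest {G : Set (Finset ℕ+)} {A : Finset ℕ+}
    (h : A ∈ familyComp schreierOne G) : ∃ (d : ℕ) (E : Fin d → Finset ℕ+),
      (∀ i, E i ∈ G) ∧ (∀ i j, i < j → FinsetBefore (E i) (E j)) ∧
      (∀ i, ∀ n ∈ E i, d ≤ (n : ℕ)) ∧ A = Finset.univ.biUnion E := by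
  obtain ⟨d, E, k, h1, h2, h3, h4, rfl⟩ := h
  refine ⟨d, E, h1, h2, fun i n hn => ?_, rfl⟩
  have hk : StrictMono k := fun i j hij => h2 i j hij _ (h3 i).1 _ (h3 j).1
  have hc : (Finset.univ.image k).card = d := by
    rw [Finset.card_image_of_injective _ hk.injective, Finset.card_univ, Fintype.card_fin]
  have := h4 (k i) (Finset.mem_image_of_mem _ (Finset.mem_univ _))
  rw [hc] at this
  exact this.trans (by exact_mod_cast (h3 i).2 hn)

theorem IsRegularFamily.familyComp {G : Set (Finset ℕ+)} (h : IsRegularFamily G) :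
    IsRegularFamily (familyComp schreierOne G) where
  hereditary E hE E' hE' := by
    obtain ⟨d, B, h1, h2, h3, rfl⟩ := familyComp_schreierOne_dest hE
    have : E' = Finset.univ.biUnion fun i => B i ∩ E' := by
      rw [← Finset.biUnion_inter, Finset.inter_eq_right.2 hE']
    rw [this]
    exact familyComp_schreierOne_mk _ (fun i => h.hereditary _ (h1 i) _ Finset.inter_subset_left)
      (fun i j hij => (h2 i j hij).mono Finset.inter_subset_left Finset.inter_subset_left)
      fun i n hn => h3 i n (Finset.inter_subset_left hn)
  spreading E hE g hg hle := by
    obtain ⟨d, B, h1, h2, h3, rfl⟩ := familyComp_schreierOne_dest hE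
    have hsub : ∀ i, B i ⊆ Finset.univ.biUnion B := fun i =>
      Finset.subset_biUnion_of_mem B (Finset.mem_univ i)
    rw [Finset.biUnion_image]
    refine familyComp_schreierOne_mk _ (fun i => h.spreading _ (h1 i) _
      (hg.mono (by exact_mod_cast hsub i)) fun n hn => hle n (hsub i hn)) (fun i j hij => ?_) ?_
    · intro m hm n hn
      obtain ⟨m, hm', rfl⟩ := Finset.mem_image.1 hm
      obtain ⟨n, hn', rfl⟩ := Finset.mem_image.1 hn
      exact hg (hsub i hm') (hsub j hn') (h2 i j hij m hm' n hn')
    · intro i n hn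
      obtain ⟨n, hn', rfl⟩ := Finset.mem_image.1 hn
      exact (h3 i n hn').trans (by exact_mod_cast hle n (hsub i hn'))
  singleton k := by
    have := familyComp_schreierOne_mk (G := G) (d := 1) (fun _ => {k})
      (fun _ => h.singleton k) (fun i j hij => absurd hij (by omega)) fun _ n _ => n.pos
    simpa using this

theorem subset_familyComp {G : Set (Finset ℕ+)} : G ⊆ familyComp schreierOne G := fun E hE => by
  have := familyComp_schreierOne_mk (G := G) (d := 1) (fun _ => E)
      (fun _ => hE) (fun i j hij => absurd hij (by omega)) fun _ n _ => n.pos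
  simpa using this

/-! ### Comparison and convolution of Schreier families -/

section Schreier

variable {φ : Ordinal.{0} → ℕ+ → Ordinal.{0}}

theorem IsSchreierChoice.lt (hφ : IsSchreierChoice φ) {ξ : Ordinal.{0}} (hξ : ξ < ω₁)
    (h : Order.IsSuccLimit ξ) (n : ℕ+) : φ ξ n < ξ :=
  (hφ.strictMono ξ hξ h (PNat.lt_add_right n 1)).trans_le
    ((hφ.isLUB ξ hξ h).1 (Set.mem_range_self _))

theorem IsSchreierChoice.exists_lt (hφ : IsSchreierChoice φ) {ξ : Ordinal.{0}} (hξ : ξ < ω₁)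
    (h : Order.IsSuccLimit ξ) {γ : Ordinal.{0}} (hγ : γ < ξ) : ∃ n, γ < φ ξ n := by
  obtain ⟨_, ⟨n, rfl⟩, hn⟩ := (lt_isLUB_iff (hφ.isLUB ξ hξ h)).1 hγ
  exact ⟨n, hn⟩

theorem IsSchreierChoice.mono (hφ : IsSchreierChoice φ) {ξ : Ordinal.{0}} (hξ : ξ < ω₁)
    (h : Order.IsSuccLimit ξ) {m n : ℕ+} (hmn : m ≤ n) :
    schreier φ (φ ξ m) ⊆ schreier φ (φ ξ n) := by
  induction n using PNat.recOn with
  | one => rw [le_antisymm hmn one_le]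
  | succ n ih =>
    rcases hmn.lt_or_eq with h' | rfl
    · exact (ih (PNat.lt_add_one_iff.1 h')).trans (hφ.nested ξ hξ h n)
    · exact subset_rfl

theorem isRegularFamily_schreier (hφ : IsSchreierChoice φ) (ξ : Ordinal.{0}) :
    ξ < ω₁ → IsRegularFamily (schreier φ ξ) := by
  induction ξ using Ordinal.limitRecOn with
  | zero => intro _; rw [schreier_zero]; exact isRegularFamily_schreierZero
  | add_one ξ ih =>
    intro h
    rw [schreier_add_one]
    exact (ih ((lt_add_one ξ).trans h)).familyComp
  | limit ξ hl ih =>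
    intro h
    have hr : ∀ n, IsRegularFamily (schreier φ (φ ξ n)) := fun n =>
      ih _ (hφ.lt h hl n) ((hφ.lt h hl n).trans h)
    rw [schreier_limit φ ξ hl]
    refine ⟨?_, ?_, ?_⟩
    · rintro E ⟨n, h1, h2, h3⟩ E' hE'
      exact ⟨n, h1, fun m hm => h2 m (hE' hm), (hr n).hereditary _ h3 _ hE'⟩
    · rintro E ⟨n, h1, h2, h3⟩ g hg hle
      refine ⟨n, h1, fun m hm => ?_, (hr n).spreading _ h3 g hg hle⟩
      obtain ⟨i, hi, rfl⟩ := Finset.mem_image.1 hm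
      exact (h2 i hi).trans (hle i hi)
    · exact fun k => ⟨1, hφ.lt h hl 1, fun m _ => one_le, (hr 1).singleton k⟩

/-- The families need not be nested in the order, only eventually so. At a limit `δ` some term of
its sequence lies above `γ`, and the threshold must also exceed the index of that term. -/
theorem exists_schreier_subset (hφ : IsSchreierChoice φ) (γ δ : Ordinal.{0}) :
    γ ≤ δ → δ < ω₁ → ∃ l : ℕ+, ∀ E ∈ schreier φ γ, (∀ i ∈ E, l ≤ i) → E ∈ schreier φ δ := by
  induction δ using Ordinal.limitRecOn with
  | zero => intro h _; exact ⟨1, fun E hE _ => by rwa [nonpos_iff_eq_zero.1 h] at hE⟩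
  | add_one δ ih =>
    intro h h1
    rcases h.lt_or_eq with h | rfl
    · obtain ⟨l, hl⟩ := ih (Order.lt_add_one_iff.1 h) ((lt_add_one δ).trans h1)
      refine ⟨l, fun E hE hlE => ?_⟩
      rw [schreier_add_one]
      exact subset_familyComp (hl E hE hlE)
    · exact ⟨1, fun E hE _ => hE⟩
  | limit δ hl ih =>
    intro h h1
    rcases h.lt_or_eq with h | rfl
    · obtain ⟨n, hn⟩ := hφ.exists_lt h1 hl h
      obtain ⟨l, hl'⟩ := ih _ (hφ.lt h1 hl n) hn.le ((hφ.lt h1 hl n).trans h1)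
      refine ⟨max l n, fun E hE hlE => ?_⟩
      rw [schreier_limit φ δ hl]
      exact ⟨n, hφ.lt h1 hl n, fun m hm => (le_max_right _ _).trans (hlE m hm),
        hl' E hE fun i hi => (le_max_left _ _).trans (hlE i hi)⟩
    · exact ⟨1, fun E hE _ => hE⟩

/-- Unions of successive members `B i`, `M i ≤ B i`, of `G` along members of `F` belong to `H`. -/
def ConvolvesInto (F G H : Set (Finset ℕ+)) (M : ℕ+ → ℕ+) : Prop :=
  ∀ E ∈ F, ∀ B : ℕ+ → Finset ℕ+, (∀ i ∈ E, B i ∈ G ∧ ∀ b ∈ B i, M i ≤ b) →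
    (∀ i ∈ E, ∀ j ∈ E, i < j → FinsetBefore (B i) (B j)) → E.biUnion B ∈ H

/-- The recursion is on the outer order `α`, so the inner order `β` stands on the left of the sum.
-/
theorem exists_schreier_convolvesInto (hφ : IsSchreierChoice φ) (β α : Ordinal.{0}) :
    β + α < ω₁ → ∃ M : ℕ+ → ℕ+, (∀ i, i ≤ M i) ∧
      ConvolvesInto (schreier φ α) (schreier φ β) (schreier φ (β + α)) M := by
  induction α using Ordinal.limitRecOn with
  | zero =>
    intro h
    rw [add_zero, schreier_zero]
    rw [add_zero] at h
    refine ⟨id, fun i => le_rfl, ?_⟩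
    rintro E (rfl | ⟨n, rfl⟩) B hB _
    · simpa using (isRegularFamily_schreier hφ β h).empty_mem
    · simpa using (hB n (by simp)).1
  | add_one α ih =>
    intro h
    rw [← add_assoc] at h ⊢
    obtain ⟨M, hM, hM'⟩ := ih ((lt_add_one _).trans h)
    refine ⟨M, hM, ?_⟩
    rw [schreier_add_one, schreier_add_one]
    intro E hE B hB hlt
    obtain ⟨d, A, h1, h2, h3, rfl⟩ := familyComp_schreierOne_dest hE
    have hsub : ∀ i, A i ⊆ Finset.univ.biUnion A := fun i =>
      Finset.subset_biUnion_of_mem A (Finset.mem_univ i)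
    rw [Finset.biUnion_biUnion]
    refine familyComp_schreierOne_mk _ (fun i => hM' _ (h1 i) B (fun j hj => hB j (hsub i hj))
      fun j hj k hk => hlt j (hsub i hj) k (hsub i hk)) ?_ ?_
    · intro i j hij m hm n hn
      obtain ⟨p, hp, hm⟩ := Finset.mem_biUnion.1 hm
      obtain ⟨q, hq, hn⟩ := Finset.mem_biUnion.1 hn
      exact hlt p (hsub i hp) q (hsub j hq) (h2 i j hij p hp q hq) m hm n hn
    · intro i n hn
      obtain ⟨p, hp, hn⟩ := Finset.mem_biUnion.1 hn
      exact (h3 i p hp).trans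
        (by exact_mod_cast (hM p).trans ((hB p (hsub i hp)).2 n hn))
  | limit α hl ih =>
    intro h
    have hα : α < ω₁ := (le_add_self).trans_lt h
    have hl' : Order.IsSuccLimit (β + α) := Ordinal.isSuccLimit_add β hl
    have key : ∀ n : ℕ+, ∃ (k l : ℕ+) (M : ℕ+ → ℕ+),
        ConvolvesInto (schreier φ (φ α n)) (schreier φ β) (schreier φ (β + φ α n)) M ∧
        ∀ E ∈ schreier φ (β + φ α n), (∀ i ∈ E, l ≤ i) → E ∈ schreier φ (φ (β + α) k) := by
      intro n
      have hlt : β + φ α n < β + α := by simpa using hφ.lt hα hl n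
      obtain ⟨k, hk⟩ := hφ.exists_lt h hl' hlt
      obtain ⟨l, hl1⟩ := exists_schreier_subset hφ _ _ hk.le ((hφ.lt h hl' k).trans h)
      obtain ⟨M, -, hM⟩ := ih _ (hφ.lt hα hl n) (hlt.trans h)
      exact ⟨k, l, M, hM, hl1⟩
    choose k l M hM hkl using key
    -- A set `E` in the limit family is witnessed by some `n ≤ E`. The index `n` is unknown when the
    -- threshold is chosen, so the threshold at `i` serves all `n ≤ i`.
    refine ⟨fun i => max i ((Finset.Icc 1 i).sup fun n => max (M n i) (max (k n) (l n))),
      fun i => le_max_left _ _, ?_⟩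
    rw [schreier_limit φ α hl, schreier_limit φ _ hl']
    rintro E ⟨n, h1, h2, h3⟩ B hB hlt
    have hle : ∀ i ∈ E, ∀ b ∈ B i, max (M n i) (max (k n) (l n)) ≤ b := fun i hi b hb =>
      (Finset.le_sup (f := fun n => max (M n i) (max (k n) (l n)))
        (Finset.mem_Icc.2 ⟨one_le, h2 i hi⟩)).trans
        ((le_max_right _ _).trans ((hB i hi).2 b hb))
    have hU := hM n E h3 B (fun i hi => ⟨(hB i hi).1, fun b hb =>
      (le_max_left _ _).trans (hle i hi b hb)⟩) hlt
    refine ⟨k n, hφ.lt h hl' _, fun m hm => ?_, hkl n _ hU fun m hm => ?_⟩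
    all_goals
      obtain ⟨i, hi, hm⟩ := Finset.mem_biUnion.1 hm
      have := hle i hi m hm
      simp only [max_le_iff] at this
      tauto

end Schreier

end

section

/-! ## Convex combinations that are small on the members of a family -/

/-- The restriction of `c` to `F` is a convex combination. -/
structure IsConvexOn (F : Finset ℕ+) (c : ℕ+ → ℝ) : Prop where
  nonneg : ∀ i ∈ F, 0 ≤ c i
  sum_eq : ∑ i ∈ F, c i = 1

theorem IsConvexOn.sum_le {F : Finset ℕ+} {c : ℕ+ → ℝ} (h : IsConvexOn F c) {G : Finset ℕ+}
    (hG : G ⊆ F) : ∑ i ∈ G, c i ≤ 1 :=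
  h.sum_eq ▸ Finset.sum_le_sum_of_subset_of_nonneg hG fun i hi _ => h.nonneg i hi

/-- The mass that `c` gives to the sets `G ⊆ F` with `t '' G ∈ A` is at most `ε`. -/
def SmallOn (t : ℕ+ → ℕ+) (F : Finset ℕ+) (c : ℕ+ → ℝ) (A : Set (Finset ℕ+)) (ε : ℝ) : Prop :=
  ∀ G ⊆ F, G.image t ∈ A → ∑ i ∈ G, c i ≤ ε

theorem exists_pnat_gt (r : ℝ) : ∃ n : ℕ+, r < (n : ℕ) := by
  obtain ⟨n, hn⟩ := exists_nat_gt r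
  refine ⟨n.succPNat, hn.trans ?_⟩
  rw [Nat.succPNat_coe]
  exact_mod_cast Nat.lt_succ_self n

theorem exists_convex_small_card (t : ℕ+ → ℕ+) (ht : StrictMono t) (m : ℕ) (ε : ℝ) (hε : 0 < ε)
    (N : ℕ+) : ∃ F ∈ schreierOne, (∀ i ∈ F, N ≤ i) ∧ ∃ c, IsConvexOn F c ∧
      SmallOn t F c {E | E.card ≤ m} ε := by
  obtain ⟨n, hn⟩ := exists_pnat_gt (m / ε)
  have hn0 : (0 : ℝ) < (n : ℕ) := by exact_mod_cast n.pos
  set M : ℕ+ := N + n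
  have hc : (Finset.Ico M (M + n)).card = n := by
    rw [PNat.card_Ico]; simp
  have hMn : n ≤ (M : ℕ) := by simp [M]
  refine ⟨Finset.Ico M (M + n), fun i hi => ?_, fun i hi => ?_, fun _ => ((n : ℕ) : ℝ)⁻¹,
    ⟨fun _ _ => by positivity, ?_⟩, fun G _ hG => ?_⟩
  · rw [hc]
    exact hMn.trans (by exact_mod_cast (Finset.mem_Ico.1 hi).1)
  · exact (PNat.lt_add_right _ _).le.trans (Finset.mem_Ico.1 hi).1
  · rw [Finset.sum_const, hc, nsmul_eq_mul, mul_inv_cancel₀ hn0.ne']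
  · have hGm : (G.card : ℝ) ≤ m := by
      have : (G.image t).card ≤ m := hG
      rw [Finset.card_image_of_injective _ ht.injective] at this
      exact_mod_cast this
    rw [Finset.sum_const, nsmul_eq_mul, ← div_eq_mul_inv, div_le_iff₀ hn0]
    rw [div_lt_iff₀ hε] at hn
    linarith

/-- This is one step of the repeated averages. Take the mean of `n` convex combinations, each small
on the families `A p` with `p` up to the end of the previous ones. A member of `H` may take the full
mass of the first block that it meets; an element there places it in some `A p`, on which every
later block is small. -/
theorem exists_convex_small_familyComp {H : Set (Finset ℕ+)} {A : ℕ+ → Set (Finset ℕ+)}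
    {t : ℕ+ → ℕ+} (hA : ∀ p, ∀ E ∈ A p, ∀ E' ⊆ E, E' ∈ A p) (hmono : Monotone A)
    (hHA : ∀ E ∈ H, ∀ n ∈ E, E ∈ A n)
    (step : ∀ p, ∀ ε : ℝ, 0 < ε → ∀ N : ℕ+, ∃ F ∈ H, (∀ i ∈ F, N ≤ i) ∧
      ∃ c, IsConvexOn F c ∧ SmallOn t F c (A p) ε) (ε : ℝ) (hε : 0 < ε) (N : ℕ+) :
    ∃ F ∈ familyComp schreierOne H, (∀ i ∈ F, N ≤ i) ∧
      ∃ c, IsConvexOn F c ∧ SmallOn t F c H ε := by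
  classical
  -- The first block met costs at most `1`, the others at most `1 / n` each, which is at most `2`
  -- before division by `n`.
  obtain ⟨n', hn⟩ := exists_pnat_gt (2 / ε)
  obtain ⟨n, hnn⟩ : ∃ n : ℕ, n = n' := ⟨_, rfl⟩
  rw [← hnn] at hn
  have hn0 : (0 : ℝ) < n := by rw [hnn]; exact_mod_cast n'.pos
  obtain ⟨τ, hτ, hlt⟩ := exists_seq (T := Finset ℕ+ × (ℕ+ → ℝ))
    (fun _ τ => τ.1 ∈ H ∧ (∀ i ∈ τ.1, N ≤ i) ∧ (∀ i ∈ τ.1, n ≤ (i : ℕ)) ∧ IsConvexOn τ.1 τ.2)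
    (fun m τ => (∀ i ∈ τ.1, m < i) ∧ SmallOn t τ.1 τ.2 (A m) (n : ℝ)⁻¹)
    (fun τ => max (τ.1.sup id) (τ.1.sup t))
    (fun m n τ hmn h => ⟨fun i hi => hmn.trans_lt (h.1 i hi),
      fun G hG hGA => h.2 G hG (hmono hmn hGA)⟩) (by
      intro _ m
      obtain ⟨F, hF, hN, c, hc, hs⟩ := step m (n : ℝ)⁻¹ (by positivity) (max N (max n' (m + 1)))
      simp only [max_le_iff] at hN
      exact ⟨(F, c), ⟨hF, fun i hi => (hN i hi).1, fun i hi => by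
        rw [hnn]; exact_mod_cast (hN i hi).2.1, hc⟩,
        fun i hi => PNat.add_one_le_iff.1 (hN i hi).2.2, hs⟩)
  set F : Fin n → Finset ℕ+ := fun l => (τ l.1.succPNat).1
  set c : Fin n → ℕ+ → ℝ := fun l => (τ l.1.succPNat).2
  have hlt' : ∀ l l' : Fin n, l < l' → (∀ j ∈ F l', ∀ i ∈ F l, i < j ∧ t i < j) ∧
      ∀ i ∈ F l, SmallOn t (F l') (c l') (A (t i)) (n : ℝ)⁻¹ := by
    intro l l' hll
    obtain ⟨h1, h2⟩ := hlt _ _ (Nat.succPNat_lt_succPNat.2 hll)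
    refine ⟨fun j hj i hi => ?_, fun i hi G hG hGA => h2 G hG (hmono ?_ hGA)⟩
    · have := h1 j hj
      rw [max_lt_iff] at this
      exact ⟨(Finset.le_sup (f := id) hi).trans_lt this.1, (Finset.le_sup (f := t) hi).trans_lt this.2⟩
    · exact (Finset.le_sup (f := t) hi).trans (le_max_right _ _)
  have hsum : ∀ G : Finset ℕ+, ∑ i ∈ G, (n : ℝ)⁻¹ * ∑ l, (if i ∈ F l then c l i else 0) =
      (n : ℝ)⁻¹ * ∑ l, ∑ i ∈ G ∩ F l, c l i := by
    intro G
    rw [← Finset.mul_sum, Finset.sum_comm]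
    simp_rw [Finset.sum_ite_mem]
  have hconv : ∀ l, IsConvexOn (F l) (c l) := fun l => (hτ _).2.2.2
  refine ⟨Finset.univ.biUnion F, familyComp_schreierOne_mk F (fun l => (hτ _).1)
    (fun l l' hll i hi j hj => ((hlt' l l' hll).1 j hj i hi).1) fun l i hi => (hτ _).2.2.1 i hi,
    fun i hi => ?_, fun i => (n : ℝ)⁻¹ * ∑ l, (if i ∈ F l then c l i else 0), ⟨fun i _ => ?_, ?_⟩,
    fun G _ hGH => ?_⟩
  · obtain ⟨l, -, hi⟩ := Finset.mem_biUnion.1 hi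
    exact (hτ _).2.1 i hi
  · refine mul_nonneg (by positivity) (Finset.sum_nonneg fun l _ => ?_)
    split_ifs with h
    · exact (hconv l).nonneg i h
    · exact le_rfl
  · rw [hsum, inv_mul_eq_one₀ hn0.ne']
    have : ∀ l, ∑ i ∈ Finset.univ.biUnion F ∩ F l, c l i = 1 := fun l => by
      rw [Finset.inter_eq_right.2 (Finset.subset_biUnion_of_mem F (Finset.mem_univ l)),
        (hconv l).sum_eq]
    simp [this]
  · rw [hsum]
    suffices h : ∑ l, ∑ i ∈ G ∩ F l, c l i ≤ 2 by
      rw [inv_mul_le_iff₀ hn0]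
      rw [div_lt_iff₀ hε] at hn
      linarith
    by_cases hne : ∃ l, (G ∩ F l).Nonempty
    · set I := Finset.univ.filter fun l => (G ∩ F l).Nonempty
      have hI : I.Nonempty := by obtain ⟨l, hl⟩ := hne; exact ⟨l, by simp [I, hl]⟩
      set l0 := I.min' hI
      have hl0 : (G ∩ F l0).Nonempty := by
        have := Finset.min'_mem I hI
        exact (Finset.mem_filter.1 this).2
      obtain ⟨g, hg⟩ := hl0
      rw [Finset.mem_inter] at hg
      calc ∑ l, ∑ i ∈ G ∩ F l, c l i ≤ ∑ l : Fin n, ((n : ℝ)⁻¹ + if l = l0 then 1 else 0) := by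
            refine Finset.sum_le_sum fun l _ => ?_
            rcases lt_trichotomy l l0 with h | h | h
            · have : G ∩ F l = ∅ := by
                by_contra h'
                exact absurd (Finset.min'_le I l (by
                  simpa [I] using Finset.nonempty_iff_ne_empty.2 h')) (not_le.2 h)
              rw [this, if_neg h.ne]
              simp
            · rw [if_pos h]
              have := (hconv l).sum_le (Finset.inter_subset_right (s₁ := G))
              have h0 : 0 ≤ (n : ℝ)⁻¹ := by positivity
              linarith
            · rw [if_neg h.ne', add_zero]
              refine (hlt' l0 l h).2 g hg.2 _ Finset.inter_subset_right ?_
              exact hA _ _ (hHA _ hGH (t g) (Finset.mem_image_of_mem t hg.1)) _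
                (Finset.image_subset_image Finset.inter_subset_left)
        _ = 2 := by
            rw [Finset.sum_add_distrib]
            simp [hn0.ne']
            norm_num
    · push Not at hne
      have : ∑ l, ∑ i ∈ G ∩ F l, c l i = 0 := Finset.sum_eq_zero fun l _ => by
        rw [hne l]; simp
      rw [this]; norm_num

/-- This serves the successor step: a member of `𝓢₁[G]` that contains `n` is a union of at most `n`
members of `G`. -/
theorem SmallOn.unions {t : ℕ+ → ℕ+} {F : Finset ℕ+} {c : ℕ+ → ℝ} {G : Set (Finset ℕ+)}
    (hG : ∀ E ∈ G, ∀ E' ⊆ E, E' ∈ G) {ε : ℝ} {p : ℕ} (hε : 0 < ε)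
    (hc : IsConvexOn F c) (h : SmallOn t F c G (ε / p)) :
    SmallOn t F c {A | ∃ (d : ℕ) (E : Fin d → Finset ℕ+), d ≤ p ∧ (∀ i, E i ∈ G) ∧
      A ⊆ Finset.univ.biUnion E} ε := by
  classical
  rintro B hB ⟨d, E, hd, hE, hsub⟩
  rcases Nat.eq_zero_or_pos d with rfl | hd0
  · have : B = ∅ := by simpa using hsub
    simp [this, hε.le]
  have hp : (0 : ℝ) < p := by exact_mod_cast hd0.trans_le hd
  calc ∑ i ∈ B, c i ≤ ∑ i ∈ Finset.univ.biUnion fun q => B.filter fun i => t i ∈ E q, c i := by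
        refine Finset.sum_le_sum_of_subset_of_nonneg (fun i hi => ?_) fun i hi _ => ?_
        · obtain ⟨q, hq⟩ : ∃ q, t i ∈ E q := by
            simpa using hsub (Finset.mem_image_of_mem t hi)
          simpa using ⟨hi, q, hq⟩
        · simp only [Finset.mem_biUnion, Finset.mem_filter] at hi
          obtain ⟨q, -, hi, -⟩ := hi
          exact hc.nonneg i (hB hi)
    _ ≤ ∑ q, ∑ i ∈ B.filter fun i => t i ∈ E q, c i := by
        rw [Finset.sum_comm' (t' := B) (s' := fun i => Finset.univ.filter fun q => t i ∈ E q)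
          (by simp [and_comm])]
        calc _ ≤ ∑ i ∈ B, c i := Finset.sum_le_sum_of_subset_of_nonneg
              (fun i hi => by
                simp only [Finset.mem_biUnion, Finset.mem_filter] at hi
                obtain ⟨q, -, hi, -⟩ := hi
                exact hi) fun i hi _ => hc.nonneg i (hB hi)
          _ ≤ _ := by
            refine Finset.sum_le_sum fun i hi => ?_
            obtain ⟨q, hq⟩ : ∃ q, t i ∈ E q := by
              simpa using hsub (Finset.mem_image_of_mem t hi)
            rw [Finset.sum_const, nsmul_eq_mul]
            refine le_mul_of_one_le_left (hc.nonneg i (hB hi)) ?_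
            exact_mod_cast Finset.card_pos.2 ⟨q, by simpa using hq⟩
    _ ≤ ∑ _q : Fin d, ε / p := Finset.sum_le_sum fun q _ =>
        h _ ((Finset.filter_subset _ _).trans hB) (hG _ (hE q) _ fun n hn => by
          obtain ⟨i, hi, rfl⟩ := Finset.mem_image.1 hn
          exact (Finset.mem_filter.1 hi).2)
    _ = d / p * ε := by simp; ring
    _ ≤ ε := mul_le_of_le_one_left hε.le ((div_le_one hp).2 (by exact_mod_cast hd))

theorem exists_convex_small_schreier {φ : Ordinal.{0} → ℕ+ → Ordinal.{0}}
    (hφ : IsSchreierChoice φ) {t : ℕ+ → ℕ+} (ht : StrictMono t) (β : Ordinal.{0}) :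
    β < ω₁ → ∀ ε : ℝ, 0 < ε → ∀ N : ℕ+, ∃ F ∈ schreier φ (β + 1), (∀ i ∈ F, N ≤ i) ∧
      ∃ c, IsConvexOn F c ∧ SmallOn t F c (schreier φ β) ε := by
  induction β using Ordinal.limitRecOn with
  | zero =>
    intro _ ε hε N
    rw [zero_add, schreier_one, schreier_zero]
    obtain ⟨F, hF, hN, c, hc, hs⟩ := exists_convex_small_card t ht 1 ε hε N
    refine ⟨F, hF, hN, c, hc, fun G hG hG' => hs G hG ?_⟩
    rcases hG' with h | ⟨n, h⟩ <;> simp [h]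
  | add_one β ih =>
    intro h ε hε N
    have hβ : β < ω₁ := (lt_add_one β).trans h
    have hreg := isRegularFamily_schreier hφ β hβ
    rw [schreier_add_one φ (β + 1)]
    refine exists_convex_small_familyComp (A := fun p => {A | ∃ (d : ℕ) (E : Fin d → Finset ℕ+),
      d ≤ p ∧ (∀ i, E i ∈ schreier φ β) ∧ A ⊆ Finset.univ.biUnion E}) ?_ ?_ ?_ ?_ ε hε N
    · rintro p E ⟨d, B, h1, h2, h3⟩ E' hE'
      exact ⟨d, B, h1, h2, hE'.trans h3⟩
    · rintro p q hpq E ⟨d, B, h1, h2, h3⟩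
      exact ⟨d, B, h1.trans (by exact_mod_cast hpq), h2, h3⟩
    · intro E hE n hn
      rw [schreier_add_one] at hE
      obtain ⟨d, B, h1, h2, h3, rfl⟩ := familyComp_schreierOne_dest hE
      obtain ⟨i, -, hi⟩ := Finset.mem_biUnion.1 hn
      exact ⟨d, B, h3 i n hi, h1, subset_rfl⟩
    · intro p ε hε N
      obtain ⟨F, hF, hN, c, hc, hs⟩ := ih hβ (ε / p) (by positivity) N
      exact ⟨F, hF, hN, c, hc, hs.unions hreg.hereditary hε hc⟩
  | limit β hl ih =>
    intro h ε hε N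
    rw [schreier_add_one φ β]
    refine exists_convex_small_familyComp (A := fun p => schreier φ (φ β p))
      (fun p => (isRegularFamily_schreier hφ _ ((hφ.lt h hl p).trans h)).hereditary)
      (fun p q hpq => hφ.mono h hl hpq) ?_ ?_ ε hε N
    · intro E hE n hn
      rw [schreier_limit φ β hl] at hE
      obtain ⟨m, -, h2, h3⟩ := hE
      exact hφ.mono h hl (h2 n hn) h3
    · intro p ε hε N
      have hlt : φ β p + 1 ≤ β := Order.add_one_le_of_lt (hφ.lt h hl p)
      obtain ⟨l, hl1⟩ := exists_schreier_subset hφ _ _ hlt h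
      obtain ⟨F, hF, hN, c, hc, hs⟩ := ih _ (hφ.lt h hl p) ((hφ.lt h hl p).trans h) ε hε (max N l)
      simp only [max_le_iff] at hN
      exact ⟨F, hl1 F hF fun i hi => (hN i hi).2, fun i hi => (hN i hi).1, c, hc, hs⟩

/-! ## The families `𝓢_{ω^ξ}` -/

/-- `S` is approximated by the families `A n`, in the way in which `𝓢_{ω^ξ}` is approximated by
families of lower complexity. -/
structure IsIndecomposableFamily (S : Set (Finset ℕ+)) (A : ℕ+ → Set (Finset ℕ+)) : Prop where
  mem_iff : ∀ E, E ∈ S ↔ ∃ n, (∀ i ∈ E, n ≤ i) ∧ E ∈ A n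
  regular : ∀ n, IsRegularFamily (A n)
  mono : Monotone A
  conv : ∀ m n, ∃ k M, (∀ i, i ≤ M i) ∧ ConvolvesInto (A n) (A m) (A k) M
  schreierOne_subset : ∃ l : ℕ+, ∀ E ∈ schreierOne, (∀ i ∈ E, l ≤ i) → E ∈ S
  exists_convex : ∀ t : ℕ+ → ℕ+, StrictMono t → ∀ (m : ℕ+) (ε : ℝ), 0 < ε → ∀ N : ℕ+,
    ∃ F ∈ S, (∀ i ∈ F, N ≤ i) ∧ ∃ c, IsConvexOn F c ∧ SmallOn t F c (A m) ε

theorem isIndecomposableFamily_one (φ : Ordinal.{0} → ℕ+ → Ordinal.{0}) :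
    IsIndecomposableFamily (schreier φ 1) (fun n => {E | E.card ≤ n}) where
  mem_iff E := by
    rw [schreier_one]
    constructor
    · intro h
      rcases E.eq_empty_or_nonempty with rfl | hE
      · exact ⟨1, by simp, by simp⟩
      · exact ⟨E.min' hE, fun i hi => E.min'_le i hi, h _ (E.min'_mem hE)⟩
    · rintro ⟨n, h1, h2⟩ i hi
      exact le_trans h2 (by exact_mod_cast h1 i hi)
  regular n := isRegularFamily_card_le n n.pos
  mono m n h E (hE : E.card ≤ m) := show E.card ≤ n from hE.trans (by exact_mod_cast h)
  conv m n := by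
    refine ⟨n * m, id, fun i => le_rfl, fun E hE B hB _ => ?_⟩
    calc (E.biUnion B).card ≤ E.card * m := Finset.card_biUnion_le_card_mul _ _ _ fun i hi =>
          (hB i hi).1
      _ ≤ n * m := Nat.mul_le_mul_right _ hE
      _ = _ := by simp
  schreierOne_subset := ⟨1, fun E hE _ => by rwa [schreier_one]⟩
  exists_convex t ht m ε hε N := by
    rw [schreier_one]
    exact exists_convex_small_card t ht m ε hε N

/-- Additive indecomposability enters through `conv` alone: the sum of two terms of the sequence
lies below `ζ`, hence below a further term. -/
theorem isIndecomposableFamily_limit {φ : Ordinal.{0} → ℕ+ → Ordinal.{0}}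
    (hφ : IsSchreierChoice φ) {ζ : Ordinal.{0}} (hζ : ζ < ω₁) (hl : Order.IsSuccLimit ζ)
    (hp : ∀ α < ζ, ∀ β < ζ, α + β < ζ) :
    IsIndecomposableFamily (schreier φ ζ) (fun n => schreier φ (φ ζ n)) where
  mem_iff E := by
    rw [schreier_limit φ ζ hl]
    exact ⟨fun ⟨n, _, h2, h3⟩ => ⟨n, h2, h3⟩, fun ⟨n, h2, h3⟩ => ⟨n, hφ.lt hζ hl n, h2, h3⟩⟩
  regular n := isRegularFamily_schreier hφ _ ((hφ.lt hζ hl n).trans hζ)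
  mono _ _ h := hφ.mono hζ hl h
  conv m n := by
    have hlt := hp _ (hφ.lt hζ hl m) _ (hφ.lt hζ hl n)
    obtain ⟨k, hk⟩ := hφ.exists_lt hζ hl hlt
    obtain ⟨l, hl1⟩ := exists_schreier_subset hφ _ _ hk.le ((hφ.lt hζ hl k).trans hζ)
    obtain ⟨M, hM, hM'⟩ := exists_schreier_convolvesInto hφ _ _ (hlt.trans hζ)
    refine ⟨k, fun i => max (M i) l, fun i => (hM i).trans (le_max_left _ _),
      fun E hE B hB hlt => hl1 _ (hM' E hE B (fun i hi => ⟨(hB i hi).1, fun b hb =>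
        (le_max_left _ _).trans ((hB i hi).2 b hb)⟩) hlt) fun b hb => ?_⟩
    obtain ⟨i, hi, hb⟩ := Finset.mem_biUnion.1 hb
    exact (le_max_right _ _).trans ((hB i hi).2 b hb)
  schreierOne_subset := by
    obtain ⟨l, hl1⟩ := exists_schreier_subset hφ 1 ζ
      (Order.one_le_iff_pos.2 hl.bot_lt) hζ
    exact ⟨l, fun E hE => hl1 E (by rwa [schreier_one])⟩
  exists_convex t ht m ε hε N := by
    have hlt : φ ζ m + 1 ≤ ζ := Order.add_one_le_of_lt (hφ.lt hζ hl m)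
    obtain ⟨l, hl1⟩ := exists_schreier_subset hφ _ _ hlt hζ
    obtain ⟨F, hF, hN, c, hc, hs⟩ := exists_convex_small_schreier hφ ht _
      ((hφ.lt hζ hl m).trans hζ) ε hε (max N l)
    simp only [max_le_iff] at hN
    exact ⟨F, hl1 F hF fun i hi => (hN i hi).2, fun i hi => (hN i hi).1, c, hc, hs⟩

theorem omega0_opow_lt_omega_one {ξ : Ordinal.{0}} (hξ : ξ < ω₁) : ω ^ ξ < ω₁ := by
  rw [← Cardinal.ord_aleph, Cardinal.lt_ord, ← Cardinal.succ_aleph0, Order.lt_succ_iff] at hξ ⊢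
  refine (Ordinal.card_opow_le _ _).trans ?_
  simpa using hξ

theorem exists_isIndecomposableFamily {φ : Ordinal.{0} → ℕ+ → Ordinal.{0}}
    (hφ : IsSchreierChoice φ) {ξ : Ordinal.{0}} (hξ : ξ < ω₁) :
    ∃ A, IsIndecomposableFamily (schreier φ (ω ^ ξ)) A := by
  rcases eq_or_ne ξ 0 with rfl | h0
  · rw [Ordinal.opow_zero]
    exact ⟨_, isIndecomposableFamily_one φ⟩
  · have hp := Ordinal.isPrincipal_add_omega0_opow ξ
    refine ⟨_, isIndecomposableFamily_limit hφ (omega0_opow_lt_omega_one hξ)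
      (Ordinal.isSuccLimit_of_isPrincipal_add ?_ hp) fun α hα β hβ => hp hα hβ⟩
    exact Ordinal.one_lt_opow.2 ⟨Ordinal.one_lt_omega0, h0⟩

namespace IsIndecomposableFamily

variable {S : Set (Finset ℕ+)} {A : ℕ+ → Set (Finset ℕ+)}

theorem regular_self (h : IsIndecomposableFamily S A) : IsRegularFamily S where
  hereditary E hE E' hE' := by
    rw [h.mem_iff] at hE ⊢
    obtain ⟨n, h1, h2⟩ := hE
    exact ⟨n, fun i hi => h1 i (hE' hi), (h.regular n).hereditary _ h2 _ hE'⟩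
  spreading E hE g hg hle := by
    rw [h.mem_iff] at hE ⊢
    obtain ⟨n, h1, h2⟩ := hE
    refine ⟨n, fun i hi => ?_, (h.regular n).spreading _ h2 g hg hle⟩
    obtain ⟨j, hj, rfl⟩ := Finset.mem_image.1 hi
    exact (h1 j hj).trans (hle j hj)
  singleton k := (h.mem_iff _).2 ⟨1, fun _ _ => one_le, (h.regular 1).singleton k⟩

theorem mem_of_mem (h : IsIndecomposableFamily S A) {E : Finset ℕ+} {n : ℕ+} (hE : E ∈ A n)
    (hn : ∀ i ∈ E, n ≤ i) : E ∈ S :=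
  (h.mem_iff E).2 ⟨n, hn, hE⟩

/-- This diagonalizes `conv` over the unknown index of a member of `S`. The extra bound `N k` allows
a requirement that depends on the family `A k` in which the union lands. -/
theorem exists_conv (h : IsIndecomposableFamily S A) (m : ℕ+) (N : ℕ+ → ℕ+) :
    ∃ M : ℕ+ → ℕ+, (∀ i, i ≤ M i) ∧ ∀ E ∈ S, ∀ B : ℕ+ → Finset ℕ+,
      (∀ i ∈ E, B i ∈ A m ∧ ∀ b ∈ B i, M i ≤ b) →
      (∀ i ∈ E, ∀ j ∈ E, i < j → FinsetBefore (B i) (B j)) →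
      ∃ k, E.biUnion B ∈ A k ∧ ∀ b ∈ E.biUnion B, k ≤ b ∧ N k ≤ b := by
  choose k M hM hkM using fun n => h.conv m n
  refine ⟨fun i => max i ((Finset.Icc 1 i).sup fun n => max (M n i) (max (k n) (N (k n)))),
    fun i => le_max_left _ _, fun E hE B hB hlt => ?_⟩
  obtain ⟨n, hn, hE⟩ := (h.mem_iff E).1 hE
  have hle : ∀ i ∈ E, ∀ b ∈ B i, max (M n i) (max (k n) (N (k n))) ≤ b := fun i hi b hb =>
    (Finset.le_sup (f := fun n => max (M n i) (max (k n) (N (k n))))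
      (Finset.mem_Icc.2 ⟨one_le, hn i hi⟩)).trans ((le_max_right _ _).trans ((hB i hi).2 b hb))
  simp only [max_le_iff] at hle
  refine ⟨k n, hkM n E hE B (fun i hi => ⟨(hB i hi).1, fun b hb => (hle i hi b hb).1⟩) hlt,
    fun b hb => ?_⟩
  obtain ⟨i, hi, hb⟩ := Finset.mem_biUnion.1 hb
  exact (hle i hi b hb).2

end IsIndecomposableFamily

end

section

/-! ## Finitely supported vectors -/

/-- The least element of the support of a non-zero vector. -/
def minSupp (f : ℕ+ →₀ ℝ) : ℕ+ := if h : f.support.Nonempty then f.support.min' h else 1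

/-- The largest element of the support of a non-zero vector. -/
def maxSupp (f : ℕ+ →₀ ℝ) : ℕ+ := f.support.sup id

theorem isLeast_minSupp {f : ℕ+ →₀ ℝ} (hf : f ≠ 0) :
    IsLeast (f.support : Set ℕ+) (minSupp f) := by
  have h : f.support.Nonempty := Finsupp.support_nonempty_iff.2 hf
  rw [minSupp, dif_pos h]
  exact f.support.isLeast_min' h

theorem minSupp_mem {f : ℕ+ →₀ ℝ} (hf : f ≠ 0) : minSupp f ∈ f.support := (isLeast_minSupp hf).1

theorem minSupp_le {f : ℕ+ →₀ ℝ} {i : ℕ+} (hi : i ∈ f.support) : minSupp f ≤ i :=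
  (isLeast_minSupp (by rintro rfl; simp at hi)).2 hi

theorem le_maxSupp {f : ℕ+ →₀ ℝ} {i : ℕ+} (hi : i ∈ f.support) : i ≤ maxSupp f :=
  Finset.le_sup (f := id) hi

theorem maxSupp_mem {f : ℕ+ →₀ ℝ} (hf : f ≠ 0) : maxSupp f ∈ f.support := by
  obtain ⟨i, hi, h⟩ := Finset.exists_mem_eq_sup f.support (Finsupp.support_nonempty_iff.2 hf) id
  rw [maxSupp, h]
  exact hi

theorem minSupp_le_maxSupp {f : ℕ+ →₀ ℝ} (hf : f ≠ 0) : minSupp f ≤ maxSupp f :=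
  minSupp_le (maxSupp_mem hf)

theorem SuppBefore.minSupp_lt {f g : ℕ+ →₀ ℝ} (h : SuppBefore f g) (hf : f ≠ 0) (hg : g ≠ 0) :
    minSupp f < minSupp g :=
  h _ (minSupp_mem hf) _ (minSupp_mem hg)

theorem SuppBefore.mono {f g f' g' : ℕ+ →₀ ℝ} (h : SuppBefore f g) (hf : f'.support ⊆ f.support)
    (hg : g'.support ⊆ g.support) : SuppBefore f' g' :=
  FinsetBefore.mono h hf hg

theorem pairing_smul_left (c : ℝ) (f x : ℕ+ →₀ ℝ) : pairing (c • f) x = c * pairing f x := by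
  simp [pairing_apply, Finset.mul_sum, mul_assoc]

theorem pairing_neg_left (f x : ℕ+ →₀ ℝ) : pairing (-f) x = -pairing f x := by
  simp [pairing_apply]

theorem pairing_zero_left (x : ℕ+ →₀ ℝ) : pairing 0 x = 0 := by
  simp [pairing_apply]

theorem pairing_sum_left {κ : Type*} (Q : Finset κ) (f : κ → ℕ+ →₀ ℝ) (x : ℕ+ →₀ ℝ) :
    pairing (∑ q ∈ Q, f q) x = ∑ q ∈ Q, pairing (f q) x := by
  simp only [pairing_apply, Finsupp.finsetSum_apply, Finset.sum_mul]
  exact Finset.sum_comm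

theorem pairing_eq_zero {f x : ℕ+ →₀ ℝ} (h : Disjoint f.support x.support) : pairing f x = 0 := by
  rw [pairing_apply]
  refine Finset.sum_eq_zero fun i hi => ?_
  have : f i = 0 := by
    by_contra h'
    exact (Finset.disjoint_left.1 h) (Finsupp.mem_support_iff.2 h') hi
  rw [this, zero_mul]

theorem SuppBefore.disjoint {f g : ℕ+ →₀ ℝ} (h : SuppBefore f g) :
    Disjoint f.support g.support :=
  Finset.disjoint_left.2 fun i hi hi' => lt_irrefl i (h i hi i hi')

open Classical in
theorem pairing_filter_left (p : ℕ+ → Prop) (f x : ℕ+ →₀ ℝ) :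
    pairing (f.filter p) x = pairing f (x.filter p) := by
  rw [pairing_apply, pairing_apply, Finsupp.support_filter, Finset.sum_filter]
  refine Finset.sum_congr rfl fun i _ => ?_
  by_cases h : p i <;> simp [h]

open Classical in
theorem filter_eq_self {p : ℕ+ → Prop} {x : ℕ+ →₀ ℝ} (h : ∀ i ∈ x.support, p i) :
    x.filter p = x :=
  Finsupp.filter_eq_self_iff _ _ |>.2 fun i hi => h i (Finsupp.mem_support_iff.2 hi)

/-! ## The norming set -/

theorem IsAverage.mono {G G' : Set (ℕ+ →₀ ℝ)} (hG : G ⊆ G') {l : ℕ} {α : ℕ+ →₀ ℝ}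
    (h : IsAverage G l α) : IsAverage G' l α := by
  obtain ⟨hl, d, f, h1, h2, h3, h4⟩ := h
  exact ⟨hl, d, f, h1, h2, fun q => hG (h3 q), h4⟩

theorem IsSchreierFunctional.mono {S : Set (Finset ℕ+)} {G G' : Set (ℕ+ →₀ ℝ)} (hG : G ⊆ G')
    {g : ℕ+ →₀ ℝ} (h : IsSchreierFunctional S G g) : IsSchreierFunctional S G' g := by
  obtain ⟨d, α, s, k, h1, h2, h3⟩ := h
  exact ⟨d, α, s, k, h1, fun q => ⟨hG (h2 q).1, (h2 q).2.mono hG⟩, h3⟩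

theorem normingLevel_mono (S : Set (Finset ℕ+)) : Monotone (normingLevel S) :=
  monotone_nat_of_le_succ fun _ _ h => Or.inr h

theorem exists_normingLevel {S : Set (Finset ℕ+)} {d : ℕ} {f : Fin d → ℕ+ →₀ ℝ}
    (h : ∀ q, f q ∈ normingSet S) : ∃ m, ∀ q, f q ∈ normingLevel S m := by
  choose m hm using fun q => Set.mem_iUnion.1 (h q)
  exact ⟨Finset.univ.sup m, fun q => normingLevel_mono S (Finset.le_sup (Finset.mem_univ q)) (hm q)⟩

theorem IsAverage.exists_normingLevel {S : Set (Finset ℕ+)} {l : ℕ} {α : ℕ+ →₀ ℝ}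
    (h : IsAverage (normingSet S) l α) : ∃ m, IsAverage (normingLevel S m) l α := by
  obtain ⟨hl, d, f, h1, h2, h3, h4⟩ := h
  obtain ⟨m, hm⟩ := _root_.exists_normingLevel h3
  exact ⟨m, hl, d, f, h1, h2, hm, h4⟩

theorem IsAverage.mem_normingSet {S : Set (Finset ℕ+)} {l : ℕ} {α : ℕ+ →₀ ℝ}
    (h : IsAverage (normingSet S) l α) : α ∈ normingSet S := by
  obtain ⟨m, hm⟩ := h.exists_normingLevel
  exact Set.mem_iUnion.2 ⟨m + 1, Or.inl (Or.inl ⟨l, hm⟩)⟩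

theorem IsSchreierFunctional.mem_normingSet {S : Set (Finset ℕ+)} {g : ℕ+ →₀ ℝ}
    (h : IsSchreierFunctional S (normingSet S) g) : g ∈ normingSet S := by
  obtain ⟨d, α, s, k, h1, h2, h3⟩ := h
  obtain ⟨m, hm⟩ := exists_normingLevel fun q => (h2 q).1
  choose m' hm' using fun q => (h2 q).2.exists_normingLevel
  set M := max m (Finset.univ.sup m')
  have hm'M : ∀ q, m' q ≤ M := fun q => (Finset.le_sup (Finset.mem_univ q)).trans (le_max_right _ _)
  exact Set.mem_iUnion.2 ⟨M + 1, Or.inl (Or.inr ⟨d, α, s, k, h1,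
    fun q => ⟨normingLevel_mono S (le_max_left _ _) (hm q),
      (hm' q).mono (normingLevel_mono S (hm'M q))⟩, h3⟩)⟩

/-- In the last case `P` is available both for the averages that are summed and for the functionals
that are averaged, because both come from the previous level. -/
theorem normingSet_induction {S : Set (Finset ℕ+)} {P : (ℕ+ →₀ ℝ) → Prop}
    (single : ∀ n, P (Finsupp.single n 1)) (neg_single : ∀ n, P (-Finsupp.single n 1))
    (average : ∀ l α, IsAverage {f | f ∈ normingSet S ∧ P f} l α → P α)
    (sum : ∀ g, IsSchreierFunctional S {f | f ∈ normingSet S ∧ P f} g → P g)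
    {f : ℕ+ →₀ ℝ} (hf : f ∈ normingSet S) : P f := by
  obtain ⟨m, hm⟩ := Set.mem_iUnion.1 hf
  clear hf
  induction m generalizing f with
  | zero =>
    obtain ⟨n, rfl | rfl⟩ := hm
    exacts [single n, neg_single n]
  | succ m ih =>
    have hsub : normingLevel S m ⊆ {f | f ∈ normingSet S ∧ P f} := fun f hf =>
      ⟨Set.mem_iUnion.2 ⟨m, hf⟩, ih hf⟩
    rcases hm with (⟨l, h⟩ | h) | h
    exacts [average l f (h.mono hsub), sum f (h.mono hsub), ih h]

theorem IsAverage.of_finset {G : Set (ℕ+ →₀ ℝ)} {l : ℕ} (hl : 2 ≤ l) {κ : Type*} [LinearOrder κ]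
    {Q : Finset κ} {f : κ → ℕ+ →₀ ℝ} (hQ : Q.Nonempty) (hc : Q.card ≤ l) (hf : ∀ q ∈ Q, f q ∈ G)
    (hlt : ∀ q ∈ Q, ∀ r ∈ Q, q < r → SuppBefore (f q) (f r)) :
    IsAverage G l ((l : ℝ)⁻¹ • ∑ q ∈ Q, f q) := by
  refine ⟨hl, Q.card, fun q => f (Q.orderEmbOfFin rfl q), hQ.card_pos, hc,
    fun q => hf _ (Q.orderEmbOfFin_mem rfl q), fun q r hqr => hlt _ (Q.orderEmbOfFin_mem rfl q) _
      (Q.orderEmbOfFin_mem rfl r) ((Q.orderEmbOfFin rfl).strictMono hqr), ?_⟩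
  congr 1
  rw [← Finset.sum_image (s := Finset.univ) (g := Q.orderEmbOfFin rfl) (f := f)
    (fun _ _ _ _ h => (Q.orderEmbOfFin rfl).injective h)]
  congr 1
  simp

theorem sum_support_ne_zero {d : ℕ} (hd : 1 ≤ d) {f : Fin d → ℕ+ →₀ ℝ} (h : ∀ q, f q ≠ 0)
    (hlt : ∀ q r, q < r → SuppBefore (f q) (f r)) : ∑ q, f q ≠ 0 := by
  intro h0
  have h1 := minSupp_mem (h ⟨0, hd⟩)
  have h2 : (∑ q, f q) (minSupp (f ⟨0, hd⟩)) = f ⟨0, hd⟩ (minSupp (f ⟨0, hd⟩)) := by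
    rw [Finsupp.finsetSum_apply, Finset.sum_eq_single ⟨0, hd⟩]
    · intro q _ hq
      by_contra hne
      exact lt_irrefl _ (hlt ⟨0, hd⟩ q (Nat.pos_of_ne_zero fun h => hq (Fin.ext h)) _ h1 _
        (Finsupp.mem_support_iff.2 hne))
    · simp
  rw [h0] at h2
  exact Finsupp.mem_support_iff.1 h1 h2.symm

theorem IsAverage.ne_zero {G : Set (ℕ+ →₀ ℝ)} (hG : ∀ f ∈ G, f ≠ 0) {l : ℕ} {α : ℕ+ →₀ ℝ}
    (h : IsAverage G l α) : α ≠ 0 := by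
  obtain ⟨hl, d, f, h1, h2, h3, h4, rfl⟩ := h
  refine smul_ne_zero (inv_ne_zero (by exact_mod_cast (by omega : l ≠ 0)))
    (sum_support_ne_zero h1 (fun q => hG _ (h3 q)) h4)

theorem ne_zero_of_mem_normingSet {S : Set (Finset ℕ+)} {f : ℕ+ →₀ ℝ} (hf : f ∈ normingSet S) :
    f ≠ 0 := by
  refine normingSet_induction (P := fun f => f ≠ 0) (fun n => by simp) (fun n => by simp)
    (fun l α h => h.ne_zero fun f hf => hf.2) ?_ hf
  rintro g ⟨d, α, s, k, h1, h2, h3, -, -, -, rfl⟩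
  exact sum_support_ne_zero h1 (fun q => (h2 q).1.2) h3

/-! ## Very fast growing families of averages -/

/-- The averages `α k` of `s k` members of `G`, where `k = min supp (α k)` runs through `D`, form
a very fast growing sequence. -/
structure IsFastFamily (G : Set (ℕ+ →₀ ℝ)) (D : Finset ℕ+) (α : ℕ+ → ℕ+ →₀ ℝ) (s : ℕ+ → ℕ) :
    Prop where
  avg : ∀ k ∈ D, IsAverage G (s k) (α k)
  isLeast : ∀ k ∈ D, IsLeast ((α k).support : Set ℕ+) k
  lt : ∀ k ∈ D, ∀ l ∈ D, k < l → s k < s l ∧ ∀ i ∈ (α k).support, i < l ∧ (i : ℕ) < s l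

namespace IsFastFamily

variable {G : Set (ℕ+ →₀ ℝ)} {D : Finset ℕ+} {α : ℕ+ → ℕ+ →₀ ℝ} {s : ℕ+ → ℕ}

theorem suppBefore (h : IsFastFamily G D α s) {k l : ℕ+} (hk : k ∈ D) (hl : l ∈ D) (hkl : k < l) :
    SuppBefore (α k) (α l) :=
  fun _ hi _ hj => ((h.lt k hk l hl hkl).2 _ hi).1.trans_le ((h.isLeast l hl).2 hj)

theorem subset (h : IsFastFamily G D α s) {D' : Finset ℕ+} (hD : D' ⊆ D) :
    IsFastFamily G D' α s :=
  ⟨fun k hk => h.avg k (hD hk), fun k hk => h.isLeast k (hD hk),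
    fun k hk l hl => h.lt k (hD hk) l (hD hl)⟩

theorem mono_set (h : IsFastFamily G D α s) {G' : Set (ℕ+ →₀ ℝ)} (hG : G ⊆ G') :
    IsFastFamily G' D α s :=
  ⟨fun k hk => (h.avg k hk).mono hG, h.isLeast, h.lt⟩

theorem sum_mem {S : Set (Finset ℕ+)} (h : IsFastFamily (normingSet S) D α s) (hD : D ∈ S)
    (hne : D.Nonempty) : ∑ k ∈ D, α k ∈ normingSet S := by
  refine IsSchreierFunctional.mem_normingSet ⟨D.card, fun q => α (D.orderEmbOfFin rfl q),
    fun q => s (D.orderEmbOfFin rfl q), D.orderEmbOfFin rfl, hne.card_pos, fun q => ?_,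
    fun q r hqr => h.suppBefore (D.orderEmbOfFin_mem rfl q) (D.orderEmbOfFin_mem rfl r)
      ((D.orderEmbOfFin rfl).strictMono hqr), fun q => h.isLeast _ (D.orderEmbOfFin_mem rfl q), ?_,
    fun q r hqr => ?_, ?_⟩
  · have := h.avg _ (D.orderEmbOfFin_mem rfl q)
    exact ⟨this.mem_normingSet, this⟩
  · convert hD
    simp
  · have := h.lt _ (D.orderEmbOfFin_mem rfl q) _ (D.orderEmbOfFin_mem rfl r)
      ((D.orderEmbOfFin rfl).strictMono hqr)
    exact ⟨this.1, fun i hi => (this.2 i hi).2⟩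
  · rw [← Finset.sum_image (s := Finset.univ) (g := D.orderEmbOfFin rfl) (f := α)
      (fun _ _ _ _ h => (D.orderEmbOfFin rfl).injective h)]
    congr 1
    simp

/-- Reindexing by the minima of the supports turns admissibility into membership of the index set
itself. -/
theorem of_index {κ : Type*} [LinearOrder κ] (Q : Finset κ) (β : κ → ℕ+ →₀ ℝ) (r : κ → ℕ)
    (hG : ∀ q ∈ Q, IsAverage G (r q) (β q)) (h0 : ∀ q ∈ Q, β q ≠ 0)
    (hlt : ∀ q ∈ Q, ∀ q' ∈ Q, q < q' → SuppBefore (β q) (β q') ∧ r q < r q' ∧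
      ∀ i ∈ (β q).support, (i : ℕ) < r q') :
    StrictMonoOn (fun q => minSupp (β q)) Q ∧
    ∃ α s, IsFastFamily G (Q.image fun q => minSupp (β q)) α s ∧
      (∀ q ∈ Q, α (minSupp (β q)) = β q ∧ s (minSupp (β q)) = r q) ∧
      ∑ k ∈ Q.image fun q => minSupp (β q), α k = ∑ q ∈ Q, β q := by
  have hmono : StrictMonoOn (fun q => minSupp (β q)) Q := fun q hq q' hq' hqq =>
    (hlt q hq q' hq' hqq).1.minSupp_lt (h0 q hq) (h0 q' hq')
  refine ⟨hmono, ?_⟩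
  rcases Q.eq_empty_or_nonempty with rfl | ⟨q0, -⟩
  · exact ⟨0, 0, ⟨by simp, by simp, by simp⟩, by simp, by simp⟩
  have : Nonempty κ := ⟨q0⟩
  have hinv : ∀ q ∈ Q, Function.invFunOn (fun q => minSupp (β q)) Q (minSupp (β q)) = q :=
    fun q hq => hmono.injOn.leftInvOn_invFunOn hq
  refine ⟨fun k => β (Function.invFunOn (fun q => minSupp (β q)) Q k),
    fun k => r (Function.invFunOn (fun q => minSupp (β q)) Q k), ⟨?_, ?_, ?_⟩,
    fun q hq => by simp only [hinv q hq, and_self], ?_⟩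
  · intro k hk
    obtain ⟨q, hq, rfl⟩ := Finset.mem_image.1 hk
    simp only [hinv q hq]
    exact hG q hq
  · intro k hk
    obtain ⟨q, hq, rfl⟩ := Finset.mem_image.1 hk
    simp only [hinv q hq]
    exact isLeast_minSupp (h0 q hq)
  · intro k hk l hl hkl
    obtain ⟨q, hq, rfl⟩ := Finset.mem_image.1 hk
    obtain ⟨q', hq', rfl⟩ := Finset.mem_image.1 hl
    simp only [hinv q hq, hinv q' hq']
    have := hlt q hq q' hq' ((hmono.lt_iff_lt hq hq').1 hkl)
    exact ⟨this.2.1, fun i hi => ⟨this.1 i hi _ (minSupp_mem (h0 q' hq')), this.2.2 i hi⟩⟩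
  · rw [Finset.sum_image hmono.injOn]
    exact Finset.sum_congr rfl fun q hq => by simp only [hinv q hq]

end IsFastFamily

theorem IsSchreierFunctional.exists_isFastFamily {S : Set (Finset ℕ+)} {G : Set (ℕ+ →₀ ℝ)}
    {g : ℕ+ →₀ ℝ} (h : IsSchreierFunctional S G g) : ∃ D α s, D ∈ S ∧ D.Nonempty ∧
      IsFastFamily G D α s ∧ (∀ k ∈ D, α k ∈ G) ∧ g = ∑ k ∈ D, α k := by
  obtain ⟨d, α, s, k, h1, h2, h3, h4, h5, h6, rfl⟩ := h
  have h0 : ∀ q, α q ≠ 0 := fun q h => by simpa [h] using (h4 q).1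
  have hk : ∀ q, minSupp (α q) = k q := fun q => (isLeast_minSupp (h0 q)).unique (h4 q)
  obtain ⟨-, β, r, hβ, hα, hs⟩ := IsFastFamily.of_index Finset.univ α s (fun q _ => (h2 q).2)
    (fun q _ => h0 q) fun q _ r _ hqr => ⟨h3 q r hqr, h6 q r hqr⟩
  have himg : (Finset.univ.image fun q => minSupp (α q)) = Finset.univ.image k :=
    Finset.image_congr fun q _ => hk q
  refine ⟨_, β, r, himg ▸ h5, ⟨minSupp (α ⟨0, h1⟩), by simp⟩, hβ, fun l hl => ?_, hs.symm⟩
  obtain ⟨q, hq, rfl⟩ := Finset.mem_image.1 hl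
  rw [(hα q hq).1]
  exact (h2 q).1

/-! ### Restriction of functionals to sets of coordinates -/

section Filter

open Classical

theorem IsAverage.filter {G : Set (ℕ+ →₀ ℝ)} {p : ℕ+ → Prop}
    (hG : ∀ f ∈ G, f.filter p ≠ 0 → f.filter p ∈ G) {l : ℕ} {α : ℕ+ →₀ ℝ} (h : IsAverage G l α)
    (h0 : α.filter p ≠ 0) : IsAverage G l (α.filter p) := by
  obtain ⟨hl, d, f, h1, h2, h3, h4, rfl⟩ := h
  have heq : Finsupp.filter p ((l : ℝ)⁻¹ • ∑ q, f q) =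
      (l : ℝ)⁻¹ • ∑ q ∈ Finset.univ.filter fun q => (f q).filter p ≠ 0, (f q).filter p := by
    rw [Finsupp.filter_smul, Finset.sum_filter_ne_zero, Finsupp.filter_sum]
  rw [heq] at h0 ⊢
  refine IsAverage.of_finset hl ?_ ?_ (fun q hq => hG _ (h3 q) (Finset.mem_filter.1 hq).2)
    fun q _ r _ hqr => (h4 q r hqr).mono ?_ ?_
  · by_contra hne
    rw [Finset.not_nonempty_iff_eq_empty.1 hne] at h0
    simp at h0
  · exact (Finset.card_le_univ _).trans (by simpa using h2)
  all_goals exact Finset.filter_subset _ _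

/-- Restriction moves the minima of the surviving averages to the right and may remove some
averages, so admissibility persists for a hereditary and spreading family. The sizes do not change,
since an average may have fewer terms than its size. -/
theorem IsFastFamily.filter {G : Set (ℕ+ →₀ ℝ)} {D : Finset ℕ+} {α : ℕ+ → ℕ+ →₀ ℝ} {s : ℕ+ → ℕ}
    (h : IsFastFamily G D α s) {p : ℕ+ → Prop}
    (hG : ∀ k ∈ D, (α k).filter p ≠ 0 → IsAverage G (s k) ((α k).filter p))
    {F : Set (Finset ℕ+)} (hF : IsRegularFamily F) (hD : D ∈ F) :
    ∃ D' α' s', IsFastFamily G D' α' s' ∧ D' ∈ F ∧ (∀ j, (∀ k ∈ D, j ≤ s k) → ∀ k ∈ D', j ≤ s' k) ∧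
      (∀ k ∈ D', ∀ i ∈ (α' k).support, p i) ∧
      ∑ k ∈ D', α' k = (∑ k ∈ D, α k).filter p := by
  set Q := D.filter fun k => (α k).filter p ≠ 0 with hQ
  have hQD : Q ⊆ D := Finset.filter_subset _ _
  have hQ0 : ∀ k ∈ Q, (α k).filter p ≠ 0 := fun k hk => (Finset.mem_filter.1 hk).2
  obtain ⟨hmono, α', s', h', hα', hsum⟩ := IsFastFamily.of_index Q (fun k => (α k).filter p) s
    (fun k hk => hG k (hQD hk) (hQ0 k hk)) hQ0 fun k hk l hl hkl =>
      ⟨(h.suppBefore (hQD hk) (hQD hl) hkl).mono (Finset.filter_subset _ _)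
        (Finset.filter_subset _ _), (h.lt k (hQD hk) l (hQD hl) hkl).1,
        fun i hi => ((h.lt k (hQD hk) l (hQD hl) hkl).2 i (Finset.filter_subset _ _ hi)).2⟩
  refine ⟨_, α', s', h', ?_, ?_, ?_, ?_⟩
  · refine hF.image_mem (k := id) (by simpa using hF.hereditary _ hD _ hQD) strictMonoOn_id hmono ?_
    exact fun k hk => (h.isLeast k (hQD hk)).2
      (Finset.filter_subset _ _ (minSupp_mem (hQ0 k hk)))
  · intro j hj k hk
    obtain ⟨q, hq, rfl⟩ := Finset.mem_image.1 hk
    rw [(hα' q hq).2]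
    exact hj q (hQD hq)
  · intro k hk i hi
    obtain ⟨q, hq, rfl⟩ := Finset.mem_image.1 hk
    rw [(hα' q hq).1] at hi
    exact (Finset.mem_filter.1 hi).2
  · rw [hsum, Finset.sum_filter_ne_zero, Finsupp.filter_sum]

/-- Restriction to an arbitrary set of coordinates, not just an interval, is allowed; this makes the
basis unconditional with constant one. -/
theorem filter_mem_normingSet {S : Set (Finset ℕ+)} (hS : IsRegularFamily S) (p : ℕ+ → Prop)
    {f : ℕ+ →₀ ℝ} (hf : f ∈ normingSet S) (h0 : f.filter p ≠ 0) : f.filter p ∈ normingSet S := by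
  revert h0
  have hsingle : ∀ n : ℕ+, (Finsupp.single n (1 : ℝ)).filter p ≠ 0 →
      (Finsupp.single n (1 : ℝ)).filter p = Finsupp.single n 1 := fun n h => by
    by_cases hn : p n
    · exact Finsupp.filter_single_of_pos _ hn
    · exact absurd (Finsupp.filter_single_of_neg _ hn) h
  have hsub : ∀ f ∈ {f | f ∈ normingSet S ∧ (f.filter p ≠ 0 → f.filter p ∈ normingSet S)},
      f.filter p ≠ 0 → f.filter p ∈ {f | f ∈ normingSet S ∧
        (f.filter p ≠ 0 → f.filter p ∈ normingSet S)} := fun f hf h0 =>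
    ⟨hf.2 h0, fun _ => by rw [filter_eq_self (x := f.filter p) fun i hi =>
      (Finset.mem_filter.1 hi).2]; exact hf.2 h0⟩
  refine normingSet_induction (P := fun f => f.filter p ≠ 0 → f.filter p ∈ normingSet S)
    (fun n h => ?_) (fun n h => ?_) (fun l α h h0 => ?_) (fun g h h0 => ?_) hf
  · rw [hsingle n h]
    exact single_mem_normingSet S n
  · rw [Finsupp.filter_neg] at h ⊢
    rw [hsingle n (neg_ne_zero.1 h)]
    exact normingSet_neg (single_mem_normingSet S n)
  · exact ((h.filter hsub h0).mono fun f hf => hf.1).mem_normingSet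
  · obtain ⟨D, α, s, hD, hne, hfam, -, rfl⟩ := h.exists_isFastFamily
    obtain ⟨D', α', s', h', hD', -, -, hsum⟩ := hfam.filter
      (fun k hk h0 => (hfam.avg k hk).filter hsub h0) hS hD
    rw [← hsum] at h0 ⊢
    refine (h'.mono_set fun f hf => hf.1).sum_mem hD' ?_
    by_contra hne
    rw [Finset.not_nonempty_iff_eq_empty.1 hne] at h0
    simp at h0

theorem IsAverage.filter_normingSet {S : Set (Finset ℕ+)} (hS : IsRegularFamily S) {p : ℕ+ → Prop}
    {l : ℕ} {α : ℕ+ →₀ ℝ} (h : IsAverage (normingSet S) l α) (h0 : α.filter p ≠ 0) :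
    IsAverage (normingSet S) l (α.filter p) :=
  h.filter (fun _ hf h0 => filter_mem_normingSet hS p hf h0) h0

theorem exists_supported_mem_normingSet {S : Set (Finset ℕ+)} (hS : IsRegularFamily S)
    {p : ℕ+ → Prop} {f x : ℕ+ →₀ ℝ} (hf : f ∈ normingSet S) (hx : ∀ i ∈ x.support, p i)
    (h : pairing f x ≠ 0) :
    ∃ f' ∈ normingSet S, pairing f' x = pairing f x ∧ ∀ i ∈ f'.support, p i := by
  have heq : pairing (f.filter p) x = pairing f x := by
    rw [pairing_filter_left, filter_eq_self hx]
  refine ⟨f.filter p, filter_mem_normingSet hS p hf fun h0 => ?_, heq, fun i hi =>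
    (Finset.mem_filter.1 hi).2⟩
  rw [h0, pairing_zero_left] at heq
  exact h heq.symm

end Filter

/-! ## Finitely supported vectors of the space -/

/-- The embedding of `c₀₀(ℕ)` into its completion. -/
def X01.ofFinsupp (S : Set (Finset ℕ+)) : (ℕ+ →₀ ℝ) →ₗ[ℝ] X01 S :=
  (UniformSpace.Completion.toComplL (𝕜 := ℝ) (E := PreX01 S)).toLinearMap ∘ₗ
    (PreX01.vec S).symm.toLinearMap

namespace X01

variable {S : Set (Finset ℕ+)}

theorem ofFinsupp_apply (x : ℕ+ →₀ ℝ) :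
    ofFinsupp S x = (((PreX01.vec S).symm x : PreX01 S) : X01 S) := rfl

theorem norm_ofFinsupp (x : ℕ+ →₀ ℝ) : ‖ofFinsupp S x‖ = ‖(PreX01.vec S).symm x‖ := by
  rw [ofFinsupp_apply, UniformSpace.Completion.norm_coe]

theorem norm_ofFinsupp_le {x : ℕ+ →₀ ℝ} {r : ℝ} (h : ∀ f ∈ normingSet S, pairing f x ≤ r) :
    ‖ofFinsupp S x‖ ≤ r := by
  rw [norm_ofFinsupp]
  exact PreX01.norm_le _ (by simpa using h)

theorem abs_pairing_le {f : ℕ+ →₀ ℝ} (hf : f ∈ normingSet S) (x : ℕ+ →₀ ℝ) :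
    |pairing f x| ≤ ‖ofFinsupp S x‖ := by
  rw [norm_ofFinsupp]
  simpa using PreX01.abs_pairing_le ((PreX01.vec S).symm x) hf

theorem pairing_le {f : ℕ+ →₀ ℝ} (hf : f ∈ normingSet S) (x : ℕ+ →₀ ℝ) :
    pairing f x ≤ ‖ofFinsupp S x‖ :=
  (le_abs_self _).trans (abs_pairing_le hf x)

theorem exists_lt_pairing {x : ℕ+ →₀ ℝ} {r : ℝ} (h : r < ‖ofFinsupp S x‖) :
    ∃ f ∈ normingSet S, r < pairing f x := by
  by_contra! h'
  exact absurd (norm_ofFinsupp_le h') (not_le.2 h)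

theorem e_eq (i : ℕ+) : X01.e S i = ofFinsupp S (Finsupp.single i 1) := rfl

theorem coord_ofFinsupp (i : ℕ+) (x : ℕ+ →₀ ℝ) : X01.coord S i (ofFinsupp S x) = x i := by
  rw [ofFinsupp_apply, X01.coord_coe, LinearEquiv.apply_symm_apply]

theorem ofFinsupp_injective : Function.Injective (ofFinsupp S) := fun x y h => by
  ext i
  rw [← coord_ofFinsupp (S := S), h, coord_ofFinsupp]

theorem norm_filter_le (hS : IsRegularFamily S) (p : ℕ+ → Prop) [hp : DecidablePred p]
    (x : ℕ+ →₀ ℝ) : ‖ofFinsupp S (x.filter p)‖ ≤ ‖ofFinsupp S x‖ := by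
  obtain rfl : hp = fun i => Classical.propDecidable (p i) := Subsingleton.elim _ _
  refine norm_ofFinsupp_le fun f hf => ?_
  rw [← pairing_filter_left]
  by_cases h0 : f.filter p = 0
  · rw [h0, pairing_zero_left]
    exact norm_nonneg _
  · exact pairing_le (filter_mem_normingSet hS p hf h0) x

end X01

end

section

/-! ## Block sequences of index zero -/

/-- `x` is a sequence of non-zero successive vectors. -/
structure IsBlocks (x : ℕ+ → ℕ+ →₀ ℝ) : Prop where
  ne_zero : ∀ i, x i ≠ 0
  lt : ∀ i j, i < j → SuppBefore (x i) (x j)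

namespace IsBlocks

variable {x : ℕ+ → ℕ+ →₀ ℝ}

theorem strictMono_minSupp (hx : IsBlocks x) : StrictMono fun i => minSupp (x i) :=
  fun i j hij => (hx.lt i j hij).minSupp_lt (hx.ne_zero i) (hx.ne_zero j)

theorem strictMono_maxSupp (hx : IsBlocks x) : StrictMono fun i => maxSupp (x i) :=
  fun i j hij => hx.lt i j hij _ (maxSupp_mem (hx.ne_zero i)) _ (maxSupp_mem (hx.ne_zero j))

theorem le_minSupp (hx : IsBlocks x) (i : ℕ+) : i ≤ minSupp (x i) :=
  hx.strictMono_minSupp.le_apply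

theorem le_of_mem (hx : IsBlocks x) {i p : ℕ+} (hp : p ∈ (x i).support) : i ≤ p :=
  (hx.le_minSupp i).trans (minSupp_le hp)

theorem comp (hx : IsBlocks x) {g : ℕ+ → ℕ+} (hg : StrictMono g) : IsBlocks fun i => x (g i) :=
  ⟨fun _ => hx.ne_zero _, fun _ _ hij => hx.lt _ _ (hg hij)⟩

theorem disjoint (hx : IsBlocks x) {i j : ℕ+} (hij : i ≠ j) :
    Disjoint (x i).support (x j).support := by
  rcases lt_or_gt_of_ne hij with h | h
  · exact (hx.lt i j h).disjoint
  · exact (hx.lt j i h).disjoint.symm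

end IsBlocks

theorem IsFastFamily.neg {S : Set (Finset ℕ+)} {D : Finset ℕ+} {α : ℕ+ → ℕ+ →₀ ℝ} {s : ℕ+ → ℕ}
    (h : IsFastFamily (normingSet S) D α s) :
    IsFastFamily (normingSet S) D (fun k => -α k) s :=
  ⟨fun k hk => (h.avg k hk).neg fun _ => normingSet_neg, fun k hk => by simpa using h.isLeast k hk,
    fun k hk l hl hkl => by simpa using h.lt k hk l hl hkl⟩

theorem IsFastFamily.disjoint_or {G : Set (ℕ+ →₀ ℝ)} {D : Finset ℕ+} {α : ℕ+ → ℕ+ →₀ ℝ}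
    {s : ℕ+ → ℕ} (_ : IsFastFamily G D α s) (x : ℕ+ →₀ ℝ) :
    (∀ k ∈ D, Disjoint (α k).support x.support) ∨
    ∃ k ∈ D, (∃ p ∈ (α k).support, p ∈ x.support) ∧
      ∀ l ∈ D, l < k → Disjoint (α l).support x.support := by
  classical
  by_cases h : ∀ k ∈ D, Disjoint (α k).support x.support
  · exact Or.inl h
  · right
    push Not at h
    set D' := D.filter fun k => ¬Disjoint (α k).support x.support with hD'
    have hne : D'.Nonempty := by
      obtain ⟨k, hk, h⟩ := h
      exact ⟨k, Finset.mem_filter.2 ⟨hk, h⟩⟩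
    have hm := Finset.mem_filter.1 (D'.min'_mem hne)
    refine ⟨D'.min' hne, hm.1, Finset.not_disjoint_iff.1 hm.2, fun l hl hlk => ?_⟩
    by_contra h'
    exact absurd (D'.min'_le l (Finset.mem_filter.2 ⟨hl, h'⟩)) (not_le.2 hlk)

/-- Families of averages of low complexity and large sizes act as small functionals on the
vectors `x k`. -/
def IsIndexZero (S : Set (Finset ℕ+)) (A : ℕ+ → Set (Finset ℕ+)) (x : ℕ+ → ℕ+ →₀ ℝ) : Prop :=
  ∀ m, ∀ ε : ℝ, 0 < ε → ∃ (j : ℕ) (K : ℕ+), ∀ k, K ≤ k → ∀ D α s,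
    IsFastFamily (normingSet S) D α s → D ∈ A m → (∀ l ∈ D, j ≤ s l) →
    pairing (∑ l ∈ D, α l) (x k) ≤ ε

variable {S : Set (Finset ℕ+)} {A : ℕ+ → Set (Finset ℕ+)} {x : ℕ+ → ℕ+ →₀ ℝ}

/-- The size bound can be chosen independently of `m`. Beyond the first average that meets `x k`,
all sizes exceed a point of its support and so exceed `k`; the given bound is needed only for that
one average, a singleton family in `A 1`. -/
theorem IsIndexZero.uniform (hA : ∀ m, IsRegularFamily (A m)) (hx : IsBlocks x)
    (h : IsIndexZero S A x) {ε : ℝ} (hε : 0 < ε) :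
    ∃ j : ℕ, ∀ m, ∃ K : ℕ+, ∀ k, K ≤ k → ∀ D α s, IsFastFamily (normingSet S) D α s → D ∈ A m →
      (∀ l ∈ D, j ≤ s l) → |pairing (∑ l ∈ D, α l) (x k)| ≤ ε := by
  obtain ⟨j, K, hK⟩ := h 1 (ε / 2) (by positivity)
  refine ⟨j, fun m => ?_⟩
  obtain ⟨j', K', hK'⟩ := h m (ε / 2) (by positivity)
  have key : ∀ k, max (max K K') j'.succPNat ≤ k → ∀ D α s,
      IsFastFamily (normingSet S) D α s → D ∈ A m → (∀ l ∈ D, j ≤ s l) →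
      pairing (∑ l ∈ D, α l) (x k) ≤ ε := by
    intro k hk D α s hD hDm hj
    simp only [max_le_iff] at hk
    have hj' : j' < k := Nat.lt_of_succ_le (by exact_mod_cast hk.2)
    rcases hD.disjoint_or (x k) with h0 | ⟨l0, hl0, ⟨p, hp1, hp2⟩, hlt⟩
    · rw [pairing_sum_left, Finset.sum_eq_zero fun l hl => pairing_eq_zero (h0 l hl)]
      exact hε.le
    · have hsum : pairing (∑ l ∈ D, α l) (x k) = pairing (∑ l ∈ {l0}, α l) (x k) +
          pairing (∑ l ∈ D.filter (l0 < ·), α l) (x k) := by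
        simp only [pairing_sum_left]
        rw [← Finset.sum_filter_add_sum_filter_not D (l0 < ·), add_comm, Finset.sum_singleton]
        congr 1
        refine Finset.sum_eq_single_of_mem l0 (by simp [hl0]) fun l hl hne => ?_
        rw [Finset.mem_filter, not_lt] at hl
        exact pairing_eq_zero (hlt l hl.1 (lt_of_le_of_ne hl.2 hne))
      have h1 := hK k hk.1.1 {l0} α s (hD.subset (by simpa using hl0)) ((hA 1).singleton l0)
        (by simpa using hj l0 hl0)
      have h2 := hK' k hk.1.2 (D.filter (l0 < ·)) α s (hD.subset (Finset.filter_subset _ _))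
        ((hA m).hereditary _ hDm _ (Finset.filter_subset _ _)) fun l hl => by
          rw [Finset.mem_filter] at hl
          have h3 := ((hD.lt l0 hl0 l hl.1 hl.2).2 p hp1).2
          have h4 : (k : ℕ) ≤ p := by exact_mod_cast hx.le_of_mem hp2
          omega
      rw [hsum]
      linarith
  refine ⟨_, fun k hk D α s hD hDm hj => abs_le'.2 ⟨key k hk D α s hD hDm hj, ?_⟩⟩
  have := key k hk D _ s hD.neg hDm hj
  rwa [Finset.sum_neg_distrib, pairing_neg_left] at this

theorem pairing_sum_smul (f : ℕ+ →₀ ℝ) (F : Finset ℕ+) (a : ℕ+ → ℝ) (x : ℕ+ → ℕ+ →₀ ℝ) :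
    pairing f (∑ i ∈ F, a i • x i) = ∑ i ∈ F, a i * pairing f (x i) := by
  simp

/-! ### Upper `c₀`-estimates for sequences of index zero -/

section CZero

variable (S) in
/-- The upper `c₀`-estimate for the action of `f` on combinations of the `x i`. -/
def ActsSmall (x : ℕ+ → ℕ+ →₀ ℝ) (ε : ℝ) (f : ℕ+ →₀ ℝ) : Prop :=
  ∀ F ∈ schreierOne, ∀ a : ℕ+ → ℝ, (∀ i ∈ F, |a i| ≤ 1) → ∀ i₀ : ℕ+, (∀ i ∈ F, i₀ ≤ i) →
    pairing f (∑ i ∈ F, a i • x i) ≤ 1 + ε / 4 ^ (i₀ : ℕ)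

theorem mul_pairing_le_one (hnorm : ∀ i, ‖X01.ofFinsupp S (x i)‖ ≤ 1) {f : ℕ+ →₀ ℝ}
    (hf : f ∈ normingSet S) {c : ℝ} (hc : |c| ≤ 1) (i : ℕ+) : c * pairing f (x i) ≤ 1 := by
  have h1 := (X01.abs_pairing_le hf (x i)).trans (hnorm i)
  calc _ ≤ |c * pairing f (x i)| := le_abs_self _
    _ = |c| * |pairing f (x i)| := abs_mul _ _
    _ ≤ 1 := mul_le_one₀ hc (abs_nonneg _) h1

theorem isRegularFamily_schreierOne : IsRegularFamily schreierOne := by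
  have := isRegularFamily_schreierZero.familyComp
  rwa [← schreier_zero fun _ _ => 0, ← schreier_add_one, zero_add, schreier_one] at this

/-- With `δ = ε / 4 ^ i₀`, averaging replaces the error `δ` by `3δ/4`: functionals that miss `x i₀`
have error `δ/4` by the estimate for larger indices, and a single exceptional functional is divided
by a size of at least `2`. The gain of `δ/4` pays for the remaining averages in `actsSmall_of_mem`.
-/
theorem IsAverage.pairing_le_of_actsSmall (hx : IsBlocks x)
    (hnorm : ∀ i, ‖X01.ofFinsupp S (x i)‖ ≤ 1) {ε : ℝ} (hε : 0 < ε) {l : ℕ} {α : ℕ+ →₀ ℝ}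
    (h : IsAverage {f | f ∈ normingSet S ∧ ActsSmall x ε f} l α)
    {F : Finset ℕ+} (hF : F ∈ schreierOne) {a : ℕ+ → ℝ} (ha : ∀ i ∈ F, |a i| ≤ 1) {i₀ : ℕ+}
    (hi₀ : ∀ i ∈ F, i₀ ≤ i) :
    pairing α (∑ i ∈ F, a i • x i) ≤ 1 + 3 / 4 * (ε / 4 ^ (i₀ : ℕ)) := by
  classical
  obtain ⟨hl, d, f, h1, h2, h3, h4, rfl⟩ := h
  set δ := ε / 4 ^ (i₀ : ℕ) with hδ
  have hδ0 : 0 < δ := by positivity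
  have hδ' : ε / 4 ^ ((i₀ + 1 : ℕ+) : ℕ) = δ / 4 := by
    rw [hδ, PNat.add_coe, PNat.one_coe, pow_succ]
    field_simp
  have herase : ∀ r, Disjoint (f r).support (x i₀).support →
      pairing (f r) (∑ i ∈ F, a i • x i) ≤ 1 + δ / 4 := by
    intro r hr
    have heq : pairing (f r) (∑ i ∈ F, a i • x i) =
        pairing (f r) (∑ i ∈ F.erase i₀, a i • x i) := by
      rw [pairing_sum_smul, pairing_sum_smul, Finset.sum_erase]
      rw [pairing_eq_zero hr, mul_zero]
    rw [heq, ← hδ']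
    refine (h3 r).2 _ (isRegularFamily_schreierOne.hereditary _ hF _ (Finset.erase_subset _ _)) a
      (fun i hi => ha i (Finset.mem_of_mem_erase hi)) _ fun i hi => ?_
    exact PNat.add_one_le_iff.2 (lt_of_le_of_ne (hi₀ i (Finset.mem_of_mem_erase hi))
      (Finset.ne_of_mem_erase hi).symm)
  -- The exceptional `R` is the last functional that meets `x i₀`: it alone can act both there and
  -- on later vectors.
  have key : ∃ R : Fin d, ∀ r, pairing (f r) (∑ i ∈ F, a i • x i) ≤
      1 + δ / 4 + if r = R then δ else 0 := by
    set I := Finset.univ.filter fun r => ¬Disjoint (f r).support (x i₀).support with hI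
    rcases I.eq_empty_or_nonempty with hemp | hne
    · refine ⟨⟨0, h1⟩, fun r => ?_⟩
      have hr : r ∉ I := by simp [hemp]
      have h0 : Disjoint (f r).support (x i₀).support := by simpa [hI] using hr
      have := herase r h0
      split_ifs <;> linarith
    · refine ⟨I.max' hne, fun r => ?_⟩
      by_cases hr : Disjoint (f r).support (x i₀).support
      · have := herase r hr
        split_ifs <;> linarith
      · have hrI : r ∈ I := by simpa [hI] using hr
        split_ifs with hrR
        · have := (h3 r).2 F hF a ha i₀ hi₀
          rw [← hδ] at this
          linarith
        · have hlt : r < I.max' hne := lt_of_le_of_ne (I.le_max' r hrI) hrR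
          obtain ⟨p, hp1, hp2⟩ := Finset.not_disjoint_iff.1
            (Finset.mem_filter.1 (I.max'_mem hne)).2
          have hzero : ∀ i ∈ F, i ≠ i₀ → a i * pairing (f r) (x i) = 0 := fun i hi hne => by
            rw [pairing_eq_zero, mul_zero]
            refine Finset.disjoint_left.2 fun n hn hn' => ?_
            exact absurd (h4 r _ hlt n hn p hp1)
              (not_lt.2 (hx.lt i₀ i (lt_of_le_of_ne (hi₀ i hi) hne.symm) p hp2 n hn').le)
          rw [pairing_sum_smul]
          by_cases hiF : i₀ ∈ F
          · rw [Finset.sum_eq_single_of_mem i₀ hiF hzero]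
            have := mul_pairing_le_one hnorm (h3 r).1 (ha i₀ hiF) i₀
            linarith
          · rw [Finset.sum_eq_zero fun i hi => hzero i hi (ne_of_mem_of_not_mem hi hiF)]
            linarith
  obtain ⟨R, hR⟩ := key
  have hl0 : (2 : ℝ) ≤ l := by exact_mod_cast hl
  have hd : (d : ℝ) ≤ l := by exact_mod_cast h2
  rw [pairing_smul_left, pairing_sum_left, inv_mul_le_iff₀ (by linarith)]
  calc _ ≤ ∑ r : Fin d, (1 + δ / 4 + if r = R then δ else 0) := Finset.sum_le_sum fun r _ => hR r
    _ = d * (1 + δ / 4) + δ := by rw [Finset.sum_add_distrib]; simp; ring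
    _ ≤ l * (1 + δ / 4) + δ := by gcongr
    _ ≤ _ := by nlinarith

/-- For a sum of averages, let `i₁` be the first index acted upon and `k₁` the first average that
meets `x i₁`. The averages after `k₁` have minima in a family of complexity known at `i₁` and sizes
beyond the start of `x i₁`, so they nearly vanish on the later vectors; this leaves essentially one
average, or one vector. -/
theorem actsSmall_of_mem (hS : IsIndecomposableFamily S A) (hx : IsBlocks x)
    (hnorm : ∀ i, ‖X01.ofFinsupp S (x i)‖ ≤ 1) {ε : ℝ} (hε : 0 < ε)
    (hsmall : ∀ i i', i < i' → ∀ D α s, IsFastFamily (normingSet S) D α s →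
      D ∈ A (maxSupp (x i)) → (∀ k ∈ D, (minSupp (x i) : ℕ) ≤ s k) →
      |pairing (∑ k ∈ D, α k) (x i')| ≤ ε / 4 ^ (i : ℕ) / 4 / i)
    {f : ℕ+ →₀ ℝ} (hf : f ∈ normingSet S) : ActsSmall x ε f := by
  classical
  have hsingle : ∀ f ∈ normingSet S, (∃ n, f.support ⊆ {n}) → ActsSmall x ε f := by
    rintro f hf ⟨n, hn⟩ F hF a ha i₀ hi₀
    have h0 : 0 < ε / 4 ^ (i₀ : ℕ) := by positivity
    rw [pairing_sum_smul]
    by_cases h : ∃ i ∈ F, n ∈ (x i).support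
    · obtain ⟨i, hi, hni⟩ := h
      rw [Finset.sum_eq_single_of_mem i hi]
      · have := mul_pairing_le_one hnorm hf (ha i hi) i
        linarith
      · intro j _ hji
        rw [pairing_eq_zero, mul_zero]
        refine Finset.disjoint_left.2 fun m hm hm' => ?_
        rw [Finset.mem_singleton.1 (hn hm)] at hm'
        exact (Finset.disjoint_left.1 (hx.disjoint hji)) hm' hni
    · push Not at h
      rw [Finset.sum_eq_zero]
      · linarith
      · intro i hi
        rw [pairing_eq_zero, mul_zero]
        refine Finset.disjoint_left.2 fun m hm hm' => ?_
        rw [Finset.mem_singleton.1 (hn hm)] at hm'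
        exact h i hi hm'
  refine normingSet_induction (P := ActsSmall x ε) (fun n => ?_) (fun n => ?_) (fun l α h => ?_)
    (fun g h => ?_) hf
  · exact hsingle _ (single_mem_normingSet S n) ⟨n, Finsupp.support_single_subset⟩
  · exact hsingle _ (normingSet_neg (single_mem_normingSet S n))
      ⟨n, by rw [Finsupp.support_neg]; exact Finsupp.support_single_subset⟩
  · intro F hF a ha i₀ hi₀
    have h1 := h.pairing_le_of_actsSmall hx hnorm hε hF ha hi₀
    have h0 : 0 < ε / 4 ^ (i₀ : ℕ) := by positivity
    linarith
  · intro F hF a ha i₀ hi₀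
    have hgW : g ∈ normingSet S := (h.mono fun f hf => hf.1).mem_normingSet
    obtain ⟨D, α, s, hD, hne, hfam, hαG, rfl⟩ := h.exists_isFastFamily
    have h0 : 0 < ε / 4 ^ (i₀ : ℕ) := by positivity
    set F' := F.filter fun i => ∃ k ∈ D, ¬Disjoint (α k).support (x i).support with hF'
    have hF'F : F' ⊆ F := Finset.filter_subset _ _
    have hF'S : F' ∈ schreierOne := isRegularFamily_schreierOne.hereditary _ hF _ hF'F
    have heq : pairing (∑ k ∈ D, α k) (∑ i ∈ F, a i • x i) =
        pairing (∑ k ∈ D, α k) (∑ i ∈ F', a i • x i) := by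
      rw [pairing_sum_smul, pairing_sum_smul]
      refine (Finset.sum_subset hF'F fun i hi hi' => ?_).symm
      rw [pairing_sum_left, Finset.sum_eq_zero, mul_zero]
      intro k hk
      apply pairing_eq_zero
      by_contra hd
      exact hi' (Finset.mem_filter.2 ⟨hi, k, hk, hd⟩)
    rw [heq]
    rcases F'.eq_empty_or_nonempty with hemp | hne'
    · rw [hemp]
      simp
      linarith
    set i₁ := F'.min' hne'
    have hi₁ : i₁ ∈ F' := F'.min'_mem hne'
    have hle : ∀ i ∈ F', i ≠ i₁ → i₁ < i := fun i hi hne =>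
      lt_of_le_of_ne (F'.min'_le i hi) hne.symm
    rcases hfam.disjoint_or (x i₁) with hd | ⟨k₁, hk₁, ⟨p, hp1, hp2⟩, hlt⟩
    · obtain ⟨k, hk, hk'⟩ := (Finset.mem_filter.1 hi₁).2
      exact absurd (hd k hk) hk'
    -- a functional that ends before a point of `x i₁` does not act on the later vectors
    have hbefore : ∀ k ∈ D, ∀ l ∈ D, k < l → (∃ q ∈ (α l).support, q ∈ (x i₁).support) →
        ∀ i ∈ F', i ≠ i₁ → Disjoint (α k).support (x i).support := by
      rintro k hk l hl hkl ⟨q, hq1, hq2⟩ i hi hii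
      refine Finset.disjoint_left.2 fun n hn hn' => ?_
      exact absurd (hfam.suppBefore hk hl hkl n hn q hq1)
        (not_lt.2 (hx.lt i₁ i (hle i hi hii) q hq2 n hn').le)
    set D' := D.filter (k₁ < ·) with hD'
    have hD'D : D' ⊆ D := Finset.filter_subset _ _
    have hsplit : ∀ i ∈ F', pairing (∑ k ∈ D, α k) (x i) =
        pairing (α k₁) (x i) + pairing (∑ k ∈ D', α k) (x i) := by
      intro i hi
      simp only [pairing_sum_left]
      rw [← Finset.sum_filter_add_sum_filter_not D (k₁ < ·), add_comm]
      congr 1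
      refine Finset.sum_eq_single_of_mem k₁ (by simp [hk₁]) fun l hl hne => ?_
      rw [Finset.mem_filter, not_lt] at hl
      have hl' := lt_of_le_of_ne hl.2 hne
      apply pairing_eq_zero
      rcases eq_or_ne i i₁ with rfl | hii
      · exact hlt l hl.1 hl'
      · exact hbefore l hl.1 k₁ hk₁ hl' ⟨p, hp1, hp2⟩ i hi hii
    -- The tail of `D` from `k₁` on lies in `S` with a witness `n ≤ k₁`, and `k₁` is at most the end
    -- of `x i₁`.
    have hD'A : D' ∈ A (maxSupp (x i₁)) := by
      have h1 : D.filter (k₁ ≤ ·) ∈ S :=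
        hS.regular_self.hereditary _ hD _ (Finset.filter_subset _ _)
      obtain ⟨n, hn1, hn2⟩ := (hS.mem_iff _).1 h1
      have hnk : n ≤ k₁ := hn1 k₁ (by simp [hk₁])
      refine hS.mono (hnk.trans (((hfam.isLeast k₁ hk₁).2 hp1).trans (le_maxSupp hp2))) ?_
      exact (hS.regular n).hereditary _ hn2 _ fun k hk => by
        rw [hD', Finset.mem_filter] at hk
        exact Finset.mem_filter.2 ⟨hk.1, hk.2.le⟩
    have hD'fam : IsFastFamily (normingSet S) D' α s :=
      (hfam.subset hD'D).mono_set fun f hf => hf.1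
    have hsz : ∀ k ∈ D', (minSupp (x i₁) : ℕ) ≤ s k := fun k hk => by
      rw [hD', Finset.mem_filter] at hk
      have h1 := ((hfam.lt k₁ hk₁ k hk.1 hk.2).2 p hp1).2
      have h2 : (minSupp (x i₁) : ℕ) ≤ p := by exact_mod_cast minSupp_le hp2
      omega
    set δ := ε / 4 ^ (i₁ : ℕ) with hδ
    have hδ0 : 0 < δ := by positivity
    have hi₁0 : (0 : ℝ) < (i₁ : ℕ) := by exact_mod_cast i₁.pos
    -- The Schreier condition bounds the number of terms by `i₁`, which explains the division by `i`
    -- in `hsmall`.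
    have htail : ∑ i ∈ F'.erase i₁, a i * pairing (∑ k ∈ D', α k) (x i) ≤ δ / 4 := by
      calc _ ≤ ∑ _i ∈ F'.erase i₁, δ / 4 / i₁ := by
            refine Finset.sum_le_sum fun i hi => ?_
            have h1 := hsmall i₁ i (hle i (Finset.mem_of_mem_erase hi) (Finset.ne_of_mem_erase hi))
              D' α s hD'fam hD'A hsz
            calc _ ≤ |a i * pairing (∑ k ∈ D', α k) (x i)| := le_abs_self _
              _ = |a i| * |pairing (∑ k ∈ D', α k) (x i)| := abs_mul _ _
              _ ≤ 1 * (δ / 4 / i₁) := mul_le_mul (ha i (hF'F (Finset.mem_of_mem_erase hi))) h1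
                  (abs_nonneg _) zero_le_one
              _ = _ := one_mul _
        _ = ((F'.erase i₁).card : ℝ) * (δ / 4 / i₁) := by rw [Finset.sum_const, nsmul_eq_mul]
        _ ≤ (i₁ : ℕ) * (δ / 4 / i₁) := by
            have h1 : ((F'.erase i₁).card : ℝ) ≤ (i₁ : ℕ) := by
              exact_mod_cast (Finset.card_le_card (Finset.erase_subset _ _)).trans (hF'S i₁ hi₁)
            gcongr
        _ = δ / 4 := by field_simp
    have hδle : δ ≤ ε / 4 ^ (i₀ : ℕ) := by
      rw [hδ]
      have : (i₀ : ℕ) ≤ i₁ := by exact_mod_cast hi₀ i₁ (hF'F hi₁)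
      gcongr
      norm_num
    have htotal : pairing (∑ k ∈ D, α k) (∑ i ∈ F', a i • x i) =
        pairing (α k₁) (∑ i ∈ F', a i • x i) + a i₁ * pairing (∑ k ∈ D', α k) (x i₁) +
        ∑ i ∈ F'.erase i₁, a i * pairing (∑ k ∈ D', α k) (x i) := by
      rw [add_assoc, Finset.add_sum_erase F' (fun i => a i * pairing (∑ k ∈ D', α k) (x i)) hi₁,
        pairing_sum_smul, pairing_sum_smul, ← Finset.sum_add_distrib]
      exact Finset.sum_congr rfl fun i hi => by rw [hsplit i hi]; ring
    rw [htotal]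
    -- If no later average meets `x i₁`, the average at `k₁` contributes `1 + 3δ/4` and the tail
    -- `δ/4`. Otherwise that average ends before `x i₁` does, so outside the tail the whole
    -- functional acts on `x i₁` only.
    by_cases hact : ∀ k ∈ D', Disjoint (α k).support (x i₁).support
    · have h1 := (hfam.avg k₁ hk₁).pairing_le_of_actsSmall hx hnorm hε hF'S
        (fun i hi => ha i (hF'F hi)) (i₀ := i₁) fun i hi => F'.min'_le i hi
      have h2 : pairing (∑ k ∈ D', α k) (x i₁) = 0 := by
        rw [pairing_sum_left, Finset.sum_eq_zero fun k hk => pairing_eq_zero (hact k hk)]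
      rw [h2, mul_zero, add_zero]
      rw [← hδ] at h1
      linarith
    · push Not at hact
      obtain ⟨k, hk, hk'⟩ := hact
      have hk'' := Finset.mem_filter.1 hk
      have h1 : pairing (α k₁) (∑ i ∈ F', a i • x i) = a i₁ * pairing (α k₁) (x i₁) := by
        rw [pairing_sum_smul]
        refine Finset.sum_eq_single_of_mem i₁ hi₁ fun i hi hii => ?_
        rw [pairing_eq_zero (hbefore k₁ hk₁ k hk''.1 hk''.2 (Finset.not_disjoint_iff.1 hk') i hi hii),
          mul_zero]
      rw [h1, ← mul_add, ← hsplit i₁ hi₁]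
      have h2 := mul_pairing_le_one hnorm hgW (ha i₁ (hF'F hi₁)) i₁
      linarith

theorem IsIndexZero.exists_czero_subsequence (hS : IsIndecomposableFamily S A) (hx : IsBlocks x)
    (hnorm : ∀ i, ‖X01.ofFinsupp S (x i)‖ ≤ 1) (h : IsIndexZero S A x) {ε : ℝ} (hε : 0 < ε) :
    ∃ g : ℕ+ → ℕ+, StrictMono g ∧ ∀ E ∈ schreierOne, ∀ (a : ℕ+ → ℝ) (M : ℝ), 0 ≤ M →
      (∀ i ∈ E, |a i| ≤ M) → ‖X01.ofFinsupp S (∑ i ∈ E, a i • x (g i))‖ ≤ (1 + ε) * M := by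
  have hη : ∀ i : ℕ+, 0 < ε / 4 ^ (i : ℕ) / 4 / (i : ℕ) := fun i => by
    have : (0 : ℝ) < (i : ℕ) := by exact_mod_cast i.pos
    positivity
  choose j hj using fun i => h.uniform hS.regular hx (hη i)
  choose K hK using hj
  -- The label `i` is stored because the threshold for later choices depends on both `i` and the end
  -- of the chosen vector. Since a block starts at or after its index, `j i ≤ τ.2` gives sizes at
  -- least `j i`.
  obtain ⟨τ, hτ, hlt⟩ := exists_seq (T := ℕ+ × ℕ+) (fun i τ => τ.1 = i ∧ j i ≤ τ.2)
    (fun n τ => n < τ.2) (fun τ => max τ.2 (K τ.1 (maxSupp (x τ.2))))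
    (fun m n τ hmn h => hmn.trans_lt h) fun i n => ⟨(i, max (j i).succPNat (n + 1)), ⟨rfl, by
      have h1 : (j i).succPNat ≤ max (j i).succPNat (n + 1) := le_max_left _ _
      have h2 : ((j i).succPNat : ℕ) ≤ (max (j i).succPNat (n + 1) : ℕ+) := by exact_mod_cast h1
      rw [Nat.succPNat_coe] at h2
      exact (Nat.le_succ _).trans h2⟩,
      lt_of_lt_of_le (PNat.lt_add_right n 1) (le_max_right _ _)⟩
  have hmono : StrictMono fun i => (τ i).2 := fun i i' hii =>
    (le_max_left _ _).trans_lt (hlt i i' hii)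
  refine ⟨fun i => (τ i).2, hmono, ?_⟩
  have hmain : ∀ f ∈ normingSet S, ActsSmall (fun i => x (τ i).2) ε f := fun f hf => by
    refine actsSmall_of_mem hS (hx.comp hmono) (fun i => hnorm _) hε ?_ hf
    intro i i' hii D α s hD hDA hs
    refine hK i (maxSupp (x (τ i).2)) _ ?_ D α s hD hDA fun l hl => ?_
    · have := (le_max_right _ _).trans (hlt i i' hii).le
      rwa [(hτ i).1] at this
    · refine le_trans ?_ (hs l hl)
      exact (hτ i).2.trans (by exact_mod_cast hx.le_minSupp _)
  intro E hE a M hM ha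
  refine X01.norm_ofFinsupp_le fun f hf => ?_
  rcases hM.eq_or_lt with rfl | hM0
  · rw [pairing_sum_smul, Finset.sum_eq_zero]
    · simp
    · intro i hi
      rw [abs_nonpos_iff.1 (ha i hi), zero_mul]
  · have h1 := hmain f hf E hE (fun i => a i / M) (fun i hi => by
      rw [abs_div, abs_of_pos hM0]
      exact div_le_one_of_le₀ (ha i hi) hM) 1 fun i _ => one_le
    have h2 : pairing f (∑ i ∈ E, a i • x (τ i).2) =
        M * pairing f (∑ i ∈ E, (a i / M) • x (τ i).2) := by
      rw [pairing_sum_smul, pairing_sum_smul, Finset.mul_sum]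
      exact Finset.sum_congr rfl fun i _ => by field_simp
    rw [h2, mul_comm]
    refine mul_le_mul_of_nonneg_right (h1.trans ?_) hM
    have : ε / 4 ^ ((1 : ℕ+) : ℕ) ≤ ε := by
      rw [PNat.one_coe, pow_one]; linarith
    linarith

end CZero

end

section

/-! ## `ℓ₁`-estimates -/

theorem exists_glue {β : Type*} [Nonempty β] {E : Set ℕ+} {F : ℕ+ → Finset ℕ+}
    (hF : ∀ i ∈ E, ∀ j ∈ E, i < j → FinsetBefore (F i) (F j)) (w : ℕ+ → ℕ+ → β) :
    E.PairwiseDisjoint F ∧ ∃ w' : ℕ+ → β, ∀ j ∈ E, ∀ i ∈ F j, w' i = w j i := by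
  classical
  have huniq : ∀ j ∈ E, ∀ j' ∈ E, ∀ i, i ∈ F j → i ∈ F j' → j = j' := by
    intro j hj j' hj' i hi hi'
    rcases lt_trichotomy j j' with h | h | h
    · exact absurd (hF j hj j' hj' h i hi i hi') (lt_irrefl i)
    · exact h
    · exact absurd (hF j' hj' j hj h i hi' i hi) (lt_irrefl i)
  refine ⟨fun j hj j' hj' hne => Finset.disjoint_left.2 fun i hi hi' =>
    hne (huniq j hj j' hj' i hi hi'),
    fun i => if h : ∃ j ∈ E, i ∈ F j then w h.choose i else Classical.arbitrary β, fun j hj i hi => ?_⟩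
  have h : ∃ j ∈ E, i ∈ F j := ⟨j, hj, hi⟩
  simp only [dif_pos h]
  rw [huniq _ h.choose_spec.1 j hj i h.choose_spec.2 hi]

theorem exists_glue_smul {V : Type*} [AddCommGroup V] [Module ℝ V] {E : Finset ℕ+}
    {F : ℕ+ → Finset ℕ+} (hF : ∀ i ∈ E, ∀ j ∈ E, i < j → FinsetBefore (F i) (F j)) (a : ℕ+ → ℝ)
    (b : ℕ+ → ℕ+ → ℝ) (v : ℕ+ → V) : ∃ w : ℕ+ → ℝ,
      ∑ i ∈ E.biUnion F, |w i| = ∑ j ∈ E, |a j| * ∑ i ∈ F j, |b j i| ∧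
      ∑ i ∈ E.biUnion F, w i • v i = ∑ j ∈ E, a j • ∑ i ∈ F j, b j i • v i := by
  obtain ⟨hdisj, w, hw⟩ := exists_glue (E := (E : Set ℕ+)) hF fun j i => a j * b j i
  refine ⟨w, ?_, ?_⟩
  · rw [Finset.sum_biUnion hdisj]
    refine Finset.sum_congr rfl fun j hj => ?_
    rw [Finset.mul_sum]
    exact Finset.sum_congr rfl fun i hi => by rw [hw j hj i hi, abs_mul]
  · rw [Finset.sum_biUnion hdisj]
    refine Finset.sum_congr rfl fun j hj => ?_
    rw [Finset.smul_sum]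
    exact Finset.sum_congr rfl fun i hi => by rw [hw j hj i hi, smul_smul]

theorem IsFastFamily.biUnion {G : Set (ℕ+ →₀ ℝ)} {E : Finset ℕ+} {D : ℕ+ → Finset ℕ+}
    {α : ℕ+ → ℕ+ → ℕ+ →₀ ℝ} {s : ℕ+ → ℕ+ → ℕ} (h : ∀ i ∈ E, IsFastFamily G (D i) (α i) (s i))
    (hlt : ∀ i ∈ E, ∀ j ∈ E, i < j → ∀ k ∈ D i, ∀ l ∈ D j, s i k < s j l ∧
      ∀ p ∈ (α i k).support, p < l ∧ (p : ℕ) < s j l) :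
    ∃ α' s', IsFastFamily G (E.biUnion D) α' s' ∧
      ∑ k ∈ E.biUnion D, α' k = ∑ i ∈ E, ∑ k ∈ D i, α i k := by
  have hD : ∀ i ∈ E, ∀ j ∈ E, i < j → FinsetBefore (D i) (D j) := fun i hi j hj hij k hk l hl =>
    ((hlt i hi j hj hij k hk l hl).2 k (((h i hi).isLeast k hk).1)).1
  obtain ⟨hdisj, α', hα'⟩ := exists_glue (E := (E : Set ℕ+)) hD α
  obtain ⟨-, s', hs'⟩ := exists_glue (E := (E : Set ℕ+)) hD s
  refine ⟨α', s', ⟨fun k hk => ?_, fun k hk => ?_, fun k hk l hl hkl => ?_⟩, ?_⟩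
  · obtain ⟨i, hi, hk⟩ := Finset.mem_biUnion.1 hk
    rw [hα' i hi k hk, hs' i hi k hk]
    exact (h i hi).avg k hk
  · obtain ⟨i, hi, hk⟩ := Finset.mem_biUnion.1 hk
    rw [hα' i hi k hk]
    exact (h i hi).isLeast k hk
  · obtain ⟨i, hi, hk⟩ := Finset.mem_biUnion.1 hk
    obtain ⟨j, hj, hl⟩ := Finset.mem_biUnion.1 hl
    rw [hα' i hi k hk, hs' i hi k hk, hs' j hj l hl]
    rcases lt_trichotomy i j with hij | rfl | hij
    · exact hlt i hi j hj hij k hk l hl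
    · exact (h i hi).lt k hk l hl hkl
    · exact absurd (hD j hj i hi hij l hl k hk) (not_lt.2 hkl.le)
  · rw [Finset.sum_biUnion hdisj]
    exact Finset.sum_congr rfl fun i hi => Finset.sum_congr rfl fun k hk => hα' i hi k hk

variable {S : Set (Finset ℕ+)} {A : ℕ+ → Set (Finset ℕ+)} {x : ℕ+ → ℕ+ →₀ ℝ}

/-- Along a sufficiently sparse subsequence, the families witnessing the lower bound `c` concatenate
to a very fast growing family. By `exists_conv` its minima lie in `S` when the vectors are indexed
by a member of `S`, so the sum is a norming functional that acts on each vector by at least `c`. -/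
theorem exists_ellOne_subsequence (hS : IsIndecomposableFamily S A) (hx : IsBlocks x) (m : ℕ+)
    {c : ℝ} (hc : 0 < c)
    (h : ∀ (j : ℕ) (K : ℕ+), ∃ k, K ≤ k ∧ ∃ D α s, IsFastFamily (normingSet S) D α s ∧ D ∈ A m ∧
      (∀ l ∈ D, j ≤ s l) ∧ c ≤ pairing (∑ l ∈ D, α l) (x k)) :
    ∃ g : ℕ+ → ℕ+, StrictMono g ∧ ∀ E ∈ S, ∀ a : ℕ+ → ℝ,
      c * ∑ i ∈ E, |a i| ≤ ‖X01.ofFinsupp S (∑ i ∈ E, a i • x (g i))‖ := by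
  classical
  obtain ⟨M, hM, hconv⟩ := hS.exists_conv m fun _ => 1
  obtain ⟨τ, hτ, hlt⟩ := exists_seq
    (T := ℕ+ × Finset ℕ+ × (ℕ+ → ℕ+ →₀ ℝ) × (ℕ+ → ℕ))
    (fun i τ => M i ≤ τ.1 ∧ τ.2.1 ∈ A m ∧ IsFastFamily (normingSet S) τ.2.1 τ.2.2.1 τ.2.2.2 ∧
      (∀ k ∈ τ.2.1, ∀ p ∈ (τ.2.2.1 k).support, minSupp (x τ.1) ≤ p ∧ p ≤ maxSupp (x τ.1)) ∧
      c ≤ pairing (∑ l ∈ τ.2.1, τ.2.2.1 l) (x τ.1))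
    (fun n τ => n < τ.1 ∧ ∀ k ∈ τ.2.1, (n : ℕ) ≤ τ.2.2.2 k)
    (fun τ => max (max τ.1 (maxSupp (x τ.1) + 1)) (τ.2.1.sup τ.2.2.2).succPNat)
    (fun m n τ hmn h => ⟨hmn.trans_lt h.1, fun k hk => le_trans (by exact_mod_cast hmn) (h.2 k hk)⟩)
    (by
      intro i n
      obtain ⟨k, hk, D, α, s, hD, hDm, hs, hp⟩ := h n (max (M i) (n + 1))
      simp only [max_le_iff] at hk
      -- Restriction to the range of `x k` makes families belonging to different vectors successive
      -- and keeps each from acting on the other vectors.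
      obtain ⟨D', α', s', hD', hDm', hs', hsupp, hsum⟩ := hD.filter
        (p := fun p => minSupp (x k) ≤ p ∧ p ≤ maxSupp (x k))
        (fun k hk h0 => (hD.avg k hk).filter_normingSet hS.regular_self h0) (hS.regular m) hDm
      refine ⟨(k, D', α', s'), ⟨hk.1, hDm', hD', hsupp, ?_⟩, PNat.add_one_le_iff.1 hk.2,
        hs' n hs⟩
      simp only
      rw [hsum, pairing_filter_left, filter_eq_self fun i hi => ⟨minSupp_le hi, le_maxSupp hi⟩]
      exact hp)
  set g : ℕ+ → ℕ+ := fun i => (τ i).1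
  have hg : StrictMono g := fun i j hij =>
    ((le_max_left _ _).trans (le_max_left _ _)).trans_lt (hlt i j hij).1
  refine ⟨g, hg, fun E hE a => ?_⟩
  rcases E.eq_empty_or_nonempty with rfl | ⟨i0, hi0⟩
  · simp
  set D : ℕ+ → Finset ℕ+ := fun i => (τ i).2.1
  -- The norming set is symmetric, so the signs of the coefficients are absorbed into the averages.
  set α : ℕ+ → ℕ+ → ℕ+ →₀ ℝ := fun i k => if 0 ≤ a i then (τ i).2.2.1 k else -(τ i).2.2.1 k with hα
  set s : ℕ+ → ℕ+ → ℕ := fun i => (τ i).2.2.2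
  have hfam : ∀ i ∈ E, IsFastFamily (normingSet S) (D i) (α i) (s i) := fun i _ => by
    by_cases h0 : 0 ≤ a i
    · simp only [hα, h0, if_true]
      exact (hτ i).2.2.1
    · simp only [hα, h0, if_false]
      exact (hτ i).2.2.1.neg
  have hsuppα : ∀ i, ∀ k ∈ D i, ∀ p ∈ (α i k).support,
      minSupp (x (g i)) ≤ p ∧ p ≤ maxSupp (x (g i)) := fun i k hk p hp => by
    refine (hτ i).2.2.2.1 k hk p ?_
    simp only [hα] at hp
    split_ifs at hp
    · exact hp
    · simpa using hp
  have hD : ∀ i ∈ E, ∀ j ∈ E, i < j → ∀ k ∈ D i, ∀ l ∈ D j, s i k < s j l ∧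
      ∀ p ∈ (α i k).support, p < l ∧ (p : ℕ) < s j l := by
    intro i hi j hj hij k hk l hl
    have h1 := (hlt i j hij).2 l hl
    have h2 : ((τ i).2.1.sup (τ i).2.2.2).succPNat ≤ _ := le_max_right (max (τ i).1 (maxSupp (x (τ i).1) + 1)) _
    have h3 : (((τ i).2.1.sup (τ i).2.2.2).succPNat : ℕ) ≤ s j l := le_trans (by exact_mod_cast h2) h1
    rw [Nat.succPNat_coe] at h3
    have h4 : s i k ≤ (τ i).2.1.sup (τ i).2.2.2 := Finset.le_sup (f := (τ i).2.2.2) hk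
    refine ⟨by omega, fun p hp => ?_⟩
    have h5 := (hsuppα i k hk p hp).2
    refine ⟨h5.trans_lt ((hx.lt _ _ (hg hij) _ (maxSupp_mem (hx.ne_zero _)) _
      (minSupp_mem (hx.ne_zero _))).trans_le (hsuppα j l hl l ((hfam j hj).isLeast l hl).1).1), ?_⟩
    have h6 : maxSupp (x (τ i).1) + 1 ≤ _ := (le_max_right (τ i).1 _).trans
      (le_max_left _ ((τ i).2.1.sup (τ i).2.2.2).succPNat)
    have h7 : ((maxSupp (x (τ i).1) + 1 : ℕ+) : ℕ) ≤ s j l := le_trans (by exact_mod_cast h6) h1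
    have h8 : (p : ℕ) ≤ maxSupp (x (τ i).1) := by exact_mod_cast h5
    rw [PNat.add_coe, PNat.one_coe] at h7
    omega
  obtain ⟨α', s', hfam', hsum⟩ := IsFastFamily.biUnion hfam hD
  have hDne : (D i0).Nonempty := by
    by_contra hne
    have := (hτ i0).2.2.2.2
    rw [show (τ i0).2.1 = ∅ from Finset.not_nonempty_iff_eq_empty.1 hne, Finset.sum_empty,
      pairing_zero_left] at this
    linarith
  obtain ⟨k0, hk0⟩ := hDne
  have hU : E.biUnion D ∈ S := by
    obtain ⟨k, hk, hk'⟩ := hconv E hE D (fun i hi => ⟨(hτ i).2.1, fun b hb =>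
      (hτ i).1.trans ((hx.le_minSupp _).trans
        (hsuppα i b hb b ((hfam i hi).isLeast b hb).1).1)⟩)
      fun i hi j hj hij k hk l hl => ((hD i hi j hj hij k hk l hl).2 k ((hfam i hi).isLeast k hk).1).1
    exact hS.mem_of_mem hk fun b hb => (hk' b hb).1
  have hW := hfam'.sum_mem hU ⟨k0, Finset.mem_biUnion.2 ⟨i0, hi0, hk0⟩⟩
  rw [hsum] at hW
  refine le_trans ?_ (X01.pairing_le hW _)
  rw [pairing_sum_left, Finset.mul_sum]
  refine Finset.sum_le_sum fun i hi => ?_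
  have hact : pairing (∑ k ∈ D i, α i k) (∑ j ∈ E, a j • x (g j)) =
      a i * pairing (∑ k ∈ D i, α i k) (x (g i)) := by
    rw [pairing_sum_smul]
    refine Finset.sum_eq_single_of_mem i hi fun j hj hji => ?_
    rw [pairing_sum_left, Finset.sum_eq_zero, mul_zero]
    intro k hk
    refine pairing_eq_zero (Finset.disjoint_left.2 fun p hp hp' => ?_)
    have h1 := hsuppα i k hk p hp
    rcases lt_or_gt_of_ne hji with h | h
    · exact absurd (hx.lt _ _ (hg h) p hp' _ (minSupp_mem (hx.ne_zero _))) (not_lt.2 h1.1)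
    · exact absurd (hx.lt _ _ (hg h) _ (maxSupp_mem (hx.ne_zero _)) p hp') (not_lt.2 h1.2)
  rw [hact]
  have hp := (hτ i).2.2.2.2
  by_cases h0 : 0 ≤ a i
  · simp only [hα, h0, if_true, abs_of_nonneg]
    rw [mul_comm]
    exact mul_le_mul_of_nonneg_left hp h0
  · simp only [hα, h0, if_false, Finset.sum_neg_distrib, pairing_neg_left]
    push Not at h0
    rw [abs_of_neg h0]
    nlinarith

/-! ## Special convex combinations have index zero -/

/-- Restricted to coordinates from `m` on, a family with minima in `A m` becomes `S`-admissible. -/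
theorem IsFastFamily.pairing_sum_le (hS : IsIndecomposableFamily S A) {D : Finset ℕ+}
    {α : ℕ+ → ℕ+ →₀ ℝ} {s : ℕ+ → ℕ} (hD : IsFastFamily (normingSet S) D α s) {m : ℕ+}
    (hDm : D ∈ A m) {y : ℕ+ →₀ ℝ} (hy : ∀ i ∈ y.support, m ≤ i) :
    pairing (∑ k ∈ D, α k) y ≤ ‖X01.ofFinsupp S y‖ := by
  classical
  obtain ⟨D', α', s', hD', hDm', -, hsupp, hsum⟩ := hD.filter (p := fun p => m ≤ p)
    (fun k hk h0 => (hD.avg k hk).filter_normingSet hS.regular_self h0) (hS.regular m) hDm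
  have h1 : pairing (∑ k ∈ D, α k) y = pairing (∑ k ∈ D', α' k) y := by
    rw [hsum, pairing_filter_left, filter_eq_self hy]
  rw [h1]
  rcases D'.eq_empty_or_nonempty with rfl | hne
  · simp [pairing_zero_left]
  · exact X01.pairing_le (hD'.sum_mem (hS.mem_of_mem hDm' fun i hi =>
      hsupp i hi i (hD'.isLeast i hi).1) hne) _

/-- Among the averaged functionals that meet a vector, at most one starts at or before that vector;
over all vectors this gives `1 / l` times the total mass. The functionals that start inside a vector
are different for different vectors, so there are at most `l` of them in all, and they cost at most
the largest coefficient. -/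
theorem IsAverage.sum_pairing_le (hx : IsBlocks x) (hnorm : ∀ i, ‖X01.ofFinsupp S (x i)‖ ≤ 1)
    {l : ℕ} {α : ℕ+ →₀ ℝ} (h : IsAverage (normingSet S) l α) {I : Finset ℕ+} {c : ℕ+ → ℝ}
    (hc : ∀ i ∈ I, 0 ≤ c i) {C : ℝ} (hC : 0 ≤ C) (hcC : ∀ i ∈ I, c i ≤ C) :
    ∑ i ∈ I, c i * pairing α (x i) ≤ (l : ℝ)⁻¹ * ∑ i ∈ I, c i + C := by
  classical
  obtain ⟨hl, d, f, h1, h2, h3, h4, rfl⟩ := h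
  have hl0 : (0 : ℝ) < l := by exact_mod_cast (by omega : 0 < l)
  have hf0 : ∀ r, f r ≠ 0 := fun r => ne_zero_of_mem_normingSet (h3 r)
  set R : ℕ+ → Finset (Fin d) := fun i =>
    Finset.univ.filter fun r => ¬Disjoint (f r).support (x i).support with hR
  set R' : ℕ+ → Finset (Fin d) := fun i =>
    (R i).filter fun r => minSupp (x i) < minSupp (f r) with hR'
  have hcard : ∀ i, (R i).card ≤ 1 + (R' i).card := by
    intro i
    rw [← Finset.card_filter_add_card_filter_not (s := R i) (fun r => minSupp (x i) < minSupp (f r)),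
      add_comm]
    refine Nat.add_le_add_right (Finset.card_le_one.2 ?_) _
    have hlt : ∀ r r', r < r' → minSupp (f r') ≤ minSupp (x i) →
        Disjoint (f r).support (x i).support := fun r r' hr h' =>
      Finset.disjoint_left.2 fun p hp hp' => absurd (h4 r r' hr p hp _ (minSupp_mem (hf0 r')))
        (not_lt.2 (h'.trans (minSupp_le hp')))
    intro r hr r' hr'
    simp only [hR, Finset.mem_filter, Finset.mem_univ, true_and, not_lt] at hr hr'
    rcases lt_trichotomy r r' with h | h | h
    · exact absurd (hlt r r' h hr'.2) hr.1
    · exact h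
    · exact absurd (hlt r' r h hr.2) hr'.1
  have hdisj : (I : Set ℕ+).PairwiseDisjoint R' := by
    have hlt : ∀ i j, i < j → ∀ r ∈ R' i, r ∉ R' j := by
      intro i j hij r hr hr'
      simp only [hR', hR, Finset.mem_filter, Finset.mem_univ, true_and] at hr hr'
      obtain ⟨p, hp, hp'⟩ := Finset.not_disjoint_iff.1 hr.1
      exact absurd (hx.lt i j hij p hp' _ (minSupp_mem (hx.ne_zero j)))
        (not_lt.2 (hr'.2.le.trans (minSupp_le hp)))
    intro i _ j _ hij
    refine Finset.disjoint_left.2 fun r hr hr' => ?_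
    rcases lt_or_gt_of_ne hij with h | h
    · exact hlt i j h r hr hr'
    · exact hlt j i h r hr' hr
  have hsumcard : ∑ i ∈ I, (R' i).card ≤ d := by
    rw [← Finset.card_biUnion hdisj]
    exact (Finset.card_le_univ _).trans (by simp)
  have hpair : ∀ i, pairing ((l : ℝ)⁻¹ • ∑ q, f q) (x i) ≤ (l : ℝ)⁻¹ * (R i).card := by
    intro i
    rw [pairing_smul_left, pairing_sum_left]
    refine mul_le_mul_of_nonneg_left ?_ (by positivity)
    calc ∑ q, pairing (f q) (x i) = ∑ q ∈ R i, pairing (f q) (x i) := by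
          refine (Finset.sum_subset (Finset.subset_univ _) fun q _ hq => pairing_eq_zero ?_).symm
          simpa [hR] using hq
      _ ≤ ∑ _q ∈ R i, (1 : ℝ) := Finset.sum_le_sum fun q _ =>
          (X01.pairing_le (h3 q) _).trans (hnorm i)
      _ = _ := by simp
  calc ∑ i ∈ I, c i * pairing ((l : ℝ)⁻¹ • ∑ q, f q) (x i)
      ≤ ∑ i ∈ I, ((l : ℝ)⁻¹ * c i + (l : ℝ)⁻¹ * C * (R' i).card) := by
        refine Finset.sum_le_sum fun i hi => ?_
        have h5 : ((R i).card : ℝ) ≤ 1 + (R' i).card := by exact_mod_cast hcard i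
        calc _ ≤ c i * ((l : ℝ)⁻¹ * (1 + (R' i).card)) := by
              refine mul_le_mul_of_nonneg_left ((hpair i).trans ?_) (hc i hi)
              gcongr
          _ = (l : ℝ)⁻¹ * c i + (l : ℝ)⁻¹ * c i * (R' i).card := by ring
          _ ≤ _ := by
            have := hcC i hi
            gcongr
    _ = (l : ℝ)⁻¹ * ∑ i ∈ I, c i + (l : ℝ)⁻¹ * C * ((∑ i ∈ I, (R' i).card : ℕ) : ℝ) := by
        rw [Finset.sum_add_distrib, ← Finset.mul_sum, ← Finset.mul_sum]
        push_cast
        rfl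
    _ ≤ (l : ℝ)⁻¹ * ∑ i ∈ I, c i + (l : ℝ)⁻¹ * C * l := by
        have : ((∑ i ∈ I, (R' i).card : ℕ) : ℝ) ≤ l := by exact_mod_cast hsumcard.trans h2
        gcongr
    _ = _ := by field_simp

/-- A vector met by two averages contains an element of `D` in its range, so such vectors have mass
at most `ε`. Each remaining vector is met by at most one average. For these the estimate for a
single average applies; the largest coefficients, one per average, are again indexed by a spread of
a subset of `D` and contribute at most another `ε`. -/
theorem IsFastFamily.pairing_convex_le (hS : IsIndecomposableFamily S A) (hx : IsBlocks x)
    (hnorm : ∀ i, ‖X01.ofFinsupp S (x i)‖ ≤ 1) {m : ℕ+} {F : Finset ℕ+} (hF : ∀ i ∈ F, m ≤ i)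
    {c : ℕ+ → ℝ} (hc : IsConvexOn F c) {ε : ℝ}
    (hsmall : SmallOn (fun i => maxSupp (x i)) F c (A m) ε) {D : Finset ℕ+}
    {α : ℕ+ → ℕ+ →₀ ℝ} {s : ℕ+ → ℕ} (hD : IsFastFamily (normingSet S) D α s) (hDm : D ∈ A m)
    {j : ℕ} (hj0 : 0 < j) (hj : ∀ k ∈ D, j ≤ s k) :
    pairing (∑ k ∈ D, α k) (∑ i ∈ F, c i • x i) ≤ 2 * ε + (j : ℝ)⁻¹ := by
  classical
  set T : ℕ+ → ℕ+ → Prop := fun k i => ¬Disjoint (α k).support (x i).support with hT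
  have hk_le : ∀ k ∈ D, ∀ i, T k i → k ≤ maxSupp (x i) := fun k hk i h => by
    obtain ⟨p, hp, hp'⟩ := Finset.not_disjoint_iff.1 h
    exact ((hD.isLeast k hk).2 hp).trans (le_maxSupp hp')
  have hT_mono : ∀ k ∈ D, ∀ l ∈ D, k < l → ∀ i i', T k i → T l i' → i ≤ i' := by
    intro k hk l hl hkl i i' hi hi'
    by_contra! hlt
    obtain ⟨p, hp, hp'⟩ := Finset.not_disjoint_iff.1 hi
    obtain ⟨q, hq, hq'⟩ := Finset.not_disjoint_iff.1 hi'
    exact absurd (hD.suppBefore hk hl hkl p hp q hq) (not_lt.2 (hx.lt i' i hlt q hq' p hp').le)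
  set F₁ := F.filter fun i => ∃ k ∈ D, ∃ l ∈ D, k < l ∧ T k i ∧ T l i with hF₁
  -- the vectors on which at least two averages act
  have hbig : ∑ i ∈ F₁, c i ≤ ε := by
    refine hsmall _ (Finset.filter_subset _ _) ?_
    have hex : ∀ i ∈ F₁, ∃ l ∈ D, minSupp (x i) < l ∧ l ≤ maxSupp (x i) := by
      intro i hi
      obtain ⟨k, hk, l, hl, hkl, hki, hli⟩ := (Finset.mem_filter.1 hi).2
      obtain ⟨p, hp, hp'⟩ := Finset.not_disjoint_iff.1 hki
      exact ⟨l, hl, (minSupp_le hp').trans_lt ((hD.lt k hk l hl hkl).2 p hp).1, hk_le l hl i hli⟩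
    choose! κ hκD hκ1 hκ2 using hex
    have hκ : StrictMonoOn κ F₁ := fun i hi i' hi' hii =>
      (hκ2 i hi).trans_lt ((hx.lt i i' hii _ (maxSupp_mem (hx.ne_zero i)) _
        (minSupp_mem (hx.ne_zero i'))).trans (hκ1 i' hi'))
    refine (hS.regular m).image_mem (k := κ) ((hS.regular m).hereditary _ hDm _ fun n hn => ?_) hκ
      (hx.strictMono_maxSupp.strictMonoOn _) hκ2
    obtain ⟨i, hi, rfl⟩ := Finset.mem_image.1 hn
    exact hκD i hi
  set F₀ := F.filter fun i => ¬∃ k ∈ D, ∃ l ∈ D, k < l ∧ T k i ∧ T l i with hF₀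
  have hF₀F : F₀ ⊆ F := Finset.filter_subset _ _
  have huniq : ∀ i ∈ F₀, ∀ k ∈ D, ∀ l ∈ D, T k i → T l i → k = l := by
    intro i hi k hk l hl hki hli
    have := (Finset.mem_filter.1 hi).2
    push Not at this
    rcases lt_trichotomy k l with h | h | h
    · exact absurd hli (this k hk l hl h hki)
    · exact h
    · exact absurd hki (this l hl k hk h hli)
  set I : ℕ+ → Finset ℕ+ := fun k => F₀.filter (T k) with hI
  have hIF : ∀ k, I k ⊆ F := fun k => (Finset.filter_subset _ _).trans hF₀F
  have hIdisj : (D : Set ℕ+).PairwiseDisjoint I := fun k hk l hl hkl =>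
    Finset.disjoint_left.2 fun i hi hi' => hkl (huniq i (Finset.mem_filter.1 hi).1 k hk l hl
      (Finset.mem_filter.1 hi).2 (Finset.mem_filter.1 hi').2)
  set D₀ := D.filter fun k => (I k).Nonempty with hD₀
  have hD₀D : D₀ ⊆ D := Finset.filter_subset _ _
  have hmax : ∀ k ∈ D₀, ∃ i ∈ I k, ∀ i' ∈ I k, c i' ≤ c i := fun k hk =>
    Finset.exists_max_image _ _ (Finset.mem_filter.1 hk).2
  choose! ι hι hιmax using hmax
  have hιmono : StrictMonoOn ι D₀ := by
    intro k hk l hl hkl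
    have h1 := Finset.mem_filter.1 (hι k hk)
    have h2 := Finset.mem_filter.1 (hι l hl)
    refine lt_of_le_of_ne (hT_mono k (hD₀D hk) l (hD₀D hl) hkl _ _ h1.2 h2.2) fun h => hkl.ne ?_
    exact huniq _ h1.1 k (hD₀D hk) l (hD₀D hl) h1.2 (by rw [h]; exact h2.2)
  have hιsum : ∑ k ∈ D₀, c (ι k) ≤ ε := by
    rw [← Finset.sum_image (f := c) hιmono.injOn]
    refine hsmall _ (fun i hi => ?_) ?_
    · obtain ⟨k, hk, rfl⟩ := Finset.mem_image.1 hi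
      exact hIF k (hι k hk)
    · rw [Finset.image_image]
      exact (hS.regular m).image_mem (k := id)
        (by simpa using (hS.regular m).hereditary _ hDm _ hD₀D) strictMonoOn_id
        (fun k hk l hl hkl => hx.strictMono_maxSupp (hιmono hk hl hkl))
        fun k hk => hk_le k (hD₀D hk) _ (Finset.mem_filter.1 (hι k hk)).2
  have hsum₀ : ∑ i ∈ F₀, c i * pairing (∑ k ∈ D, α k) (x i) ≤ ε + (j : ℝ)⁻¹ := by
    calc ∑ i ∈ F₀, c i * pairing (∑ k ∈ D, α k) (x i)
        = ∑ k ∈ D, ∑ i ∈ F₀, c i * pairing (α k) (x i) := by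
          rw [Finset.sum_comm]
          exact Finset.sum_congr rfl fun i _ => by rw [pairing_sum_left, Finset.mul_sum]
      _ = ∑ k ∈ D, ∑ i ∈ I k, c i * pairing (α k) (x i) := by
          refine Finset.sum_congr rfl fun k _ =>
            (Finset.sum_subset (Finset.filter_subset _ _) fun i hi hi' => ?_).symm
          rw [pairing_eq_zero, mul_zero]
          by_contra h
          exact hi' (Finset.mem_filter.2 ⟨hi, h⟩)
      _ = ∑ k ∈ D₀, ∑ i ∈ I k, c i * pairing (α k) (x i) := by
          refine (Finset.sum_subset hD₀D fun k hk hk' => ?_).symm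
          have : I k = ∅ := by
            by_contra h
            exact hk' (Finset.mem_filter.2 ⟨hk, Finset.nonempty_iff_ne_empty.2 h⟩)
          rw [this, Finset.sum_empty]
      _ ≤ ∑ k ∈ D₀, ((j : ℝ)⁻¹ * ∑ i ∈ I k, c i + c (ι k)) := by
          refine Finset.sum_le_sum fun k hk => ?_
          refine ((hD.avg k (hD₀D hk)).sum_pairing_le hx hnorm
            (fun i hi => hc.nonneg i (hIF k hi)) (hc.nonneg _ (hIF k (hι k hk))) (hιmax k hk)).trans ?_
          have h1 : (j : ℝ) ≤ s k := by exact_mod_cast hj k (hD₀D hk)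
          have h2 : (0 : ℝ) < j := by exact_mod_cast hj0
          have h3 : 0 ≤ ∑ i ∈ I k, c i := Finset.sum_nonneg fun i hi => hc.nonneg i (hIF k hi)
          gcongr
      _ = (j : ℝ)⁻¹ * ∑ i ∈ D₀.biUnion I, c i + ∑ k ∈ D₀, c (ι k) := by
          rw [Finset.sum_add_distrib, ← Finset.mul_sum,
            Finset.sum_biUnion (hIdisj.subset (by exact_mod_cast hD₀D))]
      _ ≤ (j : ℝ)⁻¹ * 1 + ε := by
          have h1 := hc.sum_le (G := D₀.biUnion I) (Finset.biUnion_subset.2 fun k _ => hIF k)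
          gcongr
      _ = _ := by ring
  have hsum₁ : ∑ i ∈ F₁, c i * pairing (∑ k ∈ D, α k) (x i) ≤ ε := by
    refine le_trans (Finset.sum_le_sum fun i hi => ?_) hbig
    have hiF : i ∈ F := (Finset.mem_filter.1 hi).1
    refine mul_le_of_le_one_right (hc.nonneg i hiF) ((hD.pairing_sum_le hS hDm fun p hp => ?_).trans
      (hnorm i))
    exact (hF i hiF).trans (hx.le_of_mem hp)
  rw [pairing_sum_smul, ← Finset.sum_filter_add_sum_filter_not F
    fun i => ∃ k ∈ D, ∃ l ∈ D, k < l ∧ T k i ∧ T l i]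
  linarith

/-- For `k` beyond both `m` and `n`, families in `A m` are also in `A k`, and the estimate gives `2
/ k + 1 / n ≤ 3 / n`. -/
theorem isIndexZero_of_smallOn (hS : IsIndecomposableFamily S A) (hx : IsBlocks x)
    (hnorm : ∀ i, ‖X01.ofFinsupp S (x i)‖ ≤ 1) {F : ℕ+ → Finset ℕ+} {c : ℕ+ → ℕ+ → ℝ}
    (hF : ∀ j, ∀ i ∈ F j, j ≤ i) (hc : ∀ j, IsConvexOn (F j) (c j))
    (hsmall : ∀ j : ℕ+, SmallOn (fun i => maxSupp (x i)) (F j) (c j) (A j) ((j : ℕ) : ℝ)⁻¹) :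
    IsIndexZero S A fun j => ∑ i ∈ F j, c j i • x i := by
  intro m ε hε
  obtain ⟨n, hn⟩ := exists_pnat_gt (3 / ε)
  refine ⟨n, max m n, fun k hk D α s hD hDm hs => ?_⟩
  rw [max_le_iff] at hk
  have h1 := hD.pairing_convex_le hS hx hnorm (m := k) (hF k) (hc k) (hsmall k)
    (hS.mono hk.1 hDm) n.pos hs
  have hn0 : (0 : ℝ) < (n : ℕ) := by exact_mod_cast n.pos
  have hnk : ((n : ℕ) : ℝ) ≤ (k : ℕ) := by exact_mod_cast hk.2
  have h2 : ((k : ℕ) : ℝ)⁻¹ ≤ ((n : ℕ) : ℝ)⁻¹ := by gcongr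
  have h3 : 3 * ((n : ℕ) : ℝ)⁻¹ ≤ ε := by
    rw [div_lt_iff₀ hε] at hn
    rw [← div_eq_mul_inv, div_le_iff₀ hn0]
    linarith
  linarith

/-! ## Blocks that are almost isometrically `ℓ₁` -/

/-- This is James's non-distortion argument for `ℓ₁`, relative to `S`. It is stated for a seminorm
because it is applied to the norm itself and to an arbitrary equivalent norm. -/
theorem exists_almost_isometric_ellOne_blocks (hS : IsIndecomposableFamily S A) {V : Type*}
    [AddCommGroup V] [Module ℝ V] (p : Seminorm ℝ V) {v : ℕ+ → V} {C : ℝ} (hC : ∀ i, p (v i) ≤ C)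
    {c : ℝ} (hc : 0 < c) (hlow : ∀ E ∈ S, ∀ a : ℕ+ → ℝ,
      c * ∑ i ∈ E, |a i| ≤ p (∑ i ∈ E, a i • v i)) {ε : ℝ} (hε : 0 < ε) :
    ∃ θ > 0, ∃ (F : ℕ+ → Finset ℕ+) (b : ℕ+ → ℕ+ → ℝ),
      (∀ i j, i < j → FinsetBefore (F i) (F j)) ∧ (∀ j, F j ∈ S) ∧
      (∀ j, ∑ i ∈ F j, |b j i| = 1) ∧
      (∀ j, p (∑ i ∈ F j, b j i • v i) ≤ (1 + ε) * θ) ∧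
      ∀ E ∈ S, E.biUnion F ∈ S ∧ ∀ a : ℕ+ → ℝ,
        θ * ∑ j ∈ E, |a j| ≤ p (∑ j ∈ E, a j • ∑ i ∈ F j, b j i • v i) := by
  classical
  -- These are the lower `ℓ₁`-constants valid far out on each `A m`. Taking `θ` near the supremum,
  -- the constant `(1 + ε) * θ` fails on some `A m` arbitrarily far out, and the failures, scaled to
  -- coefficient sum one, are the blocks.
  set Θ : Set ℝ := {θ | ∀ m, ∃ N : ℕ+, ∀ B ∈ A m, (∀ i ∈ B, N ≤ i) → ∀ a : ℕ+ → ℝ,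
    θ * ∑ i ∈ B, |a i| ≤ p (∑ i ∈ B, a i • v i)} with hΘ
  have hcΘ : c ∈ Θ := fun m => ⟨m, fun B hB hm a => hlow B (hS.mem_of_mem hB hm) a⟩
  have hbdd : BddAbove Θ := by
    refine ⟨C, fun θ hθ => ?_⟩
    obtain ⟨N, hN⟩ := hθ 1
    have := hN {N} ((hS.regular 1).singleton N) (by simp) fun _ => 1
    simp only [Finset.sum_singleton, abs_one, mul_one, one_smul] at this
    exact this.trans (hC N)
  have hsup : 0 < sSup Θ := hc.trans_le (le_csSup hbdd hcΘ)
  obtain ⟨θ, hθ, hθlt⟩ := exists_lt_of_lt_csSup ⟨c, hcΘ⟩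
    (div_lt_self hsup (by linarith : 1 < 1 + ε))
  have hθ0 : 0 < θ := (by positivity : 0 < sSup Θ / (1 + ε)).trans hθlt
  have hnot : (1 + ε) * θ ∉ Θ := fun h => by
    have := le_csSup hbdd h
    rw [div_lt_iff₀ (by linarith)] at hθlt
    linarith
  simp only [hΘ, Set.mem_ofPred_eq, not_forall, not_exists, not_le] at hnot
  obtain ⟨m, hm⟩ := hnot
  choose N hN using hθ
  obtain ⟨M, hM, hconv⟩ := hS.exists_conv m N
  obtain ⟨τ, hτ, hlt⟩ := exists_seq (T := Finset ℕ+ × (ℕ+ → ℝ))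
    (fun j τ => τ.1 ∈ A m ∧ (∀ i ∈ τ.1, m ≤ i ∧ M j ≤ i) ∧ ∑ i ∈ τ.1, |τ.2 i| = 1 ∧
      p (∑ i ∈ τ.1, τ.2 i • v i) ≤ (1 + ε) * θ)
    (fun n τ => ∀ i ∈ τ.1, n < i) (fun τ => τ.1.sup id)
    (fun m n τ hmn h i hi => hmn.trans_lt (h i hi)) (by
      intro j n
      obtain ⟨B, hB, hBN, a, ha⟩ := hm (max (max m (M j)) (n + 1))
      have hσ : 0 < ∑ i ∈ B, |a i| := by
        by_contra! h
        have h0 : ∑ i ∈ B, |a i| = 0 := le_antisymm h (Finset.sum_nonneg fun i _ => abs_nonneg _)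
        rw [h0, mul_zero] at ha
        exact absurd ha (not_lt.2 (apply_nonneg p _))
      simp only [max_le_iff] at hBN
      refine ⟨(B, fun i => (∑ i ∈ B, |a i|)⁻¹ * a i), ⟨hB, fun i hi => (hBN i hi).1, ?_, ?_⟩,
        fun i hi => PNat.add_one_le_iff.1 (hBN i hi).2⟩
      · simp only [abs_mul, abs_inv, abs_of_pos hσ]
        rw [← Finset.mul_sum, inv_mul_cancel₀ hσ.ne']
      · simp only [mul_smul]
        rw [← Finset.smul_sum, map_smul_eq_mul, Real.norm_eq_abs, abs_inv, abs_of_pos hσ,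
          inv_mul_le_iff₀ hσ]
        linarith)
  set F : ℕ+ → Finset ℕ+ := fun j => (τ j).1
  set b : ℕ+ → ℕ+ → ℝ := fun j => (τ j).2
  have hF : ∀ i j, i < j → FinsetBefore (F i) (F j) := fun i j hij k hk l hl =>
    (Finset.le_sup (f := id) hk).trans_lt (hlt i j hij l hl)
  refine ⟨θ, hθ0, F, b, hF, fun j => hS.mem_of_mem (hτ j).1 fun i hi => ((hτ j).2.1 i hi).1,
    fun j => (hτ j).2.2.1, fun j => (hτ j).2.2.2, fun E hE => ?_⟩
  -- The union of the supports lies in one `A k`, beyond the threshold `N k`, so the constant `θ`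
  -- survives for combinations of blocks.
  obtain ⟨k, hk, hk'⟩ := hconv E hE F (fun j _ => ⟨(hτ j).1, fun i hi => ((hτ j).2.1 i hi).2⟩)
    fun i _ j _ => hF i j
  refine ⟨hS.mem_of_mem hk fun i hi => (hk' i hi).1, fun a => ?_⟩
  obtain ⟨w, hw1, hw2⟩ := exists_glue_smul (E := E) (fun i _ j _ => hF i j) a b v
  have h1 := hN k _ hk (fun i hi => (hk' i hi).2) w
  rw [hw1, hw2] at h1
  refine le_of_eq_of_le ?_ h1
  congr 1
  exact Finset.sum_congr rfl fun j _ => by rw [(hτ j).2.2.1, mul_one]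

end

section

/-! ## Blocks with prescribed behaviour -/

/-- The vectors `u j` are successive linear combinations of the `x i` over members of `F`. -/
def IsBlocksOver (F : Set (Finset ℕ+)) (x u : ℕ+ → ℕ+ →₀ ℝ) : Prop :=
  ∃ (B : ℕ+ → Finset ℕ+) (a : ℕ+ → ℕ+ → ℝ), (∀ j, B j ∈ F) ∧
    (∀ i j, i < j → FinsetBefore (B i) (B j)) ∧ ∀ j, u j = ∑ i ∈ B j, a j i • x i

namespace IsBlocksOver

variable {F : Set (Finset ℕ+)} {x u : ℕ+ → ℕ+ →₀ ℝ}

theorem smul (h : IsBlocksOver F x u) (c : ℕ+ → ℝ) : IsBlocksOver F x fun j => c j • u j := by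
  obtain ⟨B, a, h1, h2, h3⟩ := h
  refine ⟨B, fun j i => c j * a j i, h1, h2, fun j => ?_⟩
  simp only [h3, Finset.smul_sum, smul_smul]

theorem comp (h : IsBlocksOver F x u) {g : ℕ+ → ℕ+} (hg : StrictMono g) :
    IsBlocksOver F x fun j => u (g j) := by
  obtain ⟨B, a, h1, h2, h3⟩ := h
  exact ⟨fun j => B (g j), fun j => a (g j), fun j => h1 _, fun i j hij => h2 _ _ (hg hij),
    fun j => h3 _⟩

theorem of_comp (hF : IsRegularFamily F) {g : ℕ+ → ℕ+} (hg : StrictMono g)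
    (h : IsBlocksOver F (fun i => x (g i)) u) : IsBlocksOver F x u := by
  obtain ⟨B, a, h1, h2, h3⟩ := h
  refine ⟨fun j => (B j).image g, fun j i => a j (Function.invFun g i), fun j => ?_, ?_, fun j => ?_⟩
  · exact hF.spreading _ (h1 j) g (hg.strictMonoOn _) fun i _ => hg.le_apply
  · intro i j hij m hm n hn
    obtain ⟨m, hm', rfl⟩ := Finset.mem_image.1 hm
    obtain ⟨n, hn', rfl⟩ := Finset.mem_image.1 hn
    exact hg (h2 i j hij m hm' n hn')
  · rw [h3, Finset.sum_image hg.injective.injOn]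
    exact Finset.sum_congr rfl fun i _ => by
      simp only [Function.leftInverse_invFun hg.injective i]

theorem of_smul {c : ℕ+ → ℝ} (h : IsBlocksOver F (fun i => c i • x i) u) :
    IsBlocksOver F x u := by
  obtain ⟨B, a, h1, h2, h3⟩ := h
  refine ⟨B, fun j i => a j i * c i, h1, h2, fun j => ?_⟩
  simp only [h3, smul_smul]

end IsBlocksOver

theorem support_sum_smul_subset (B : Finset ℕ+) (a : ℕ+ → ℝ) (x : ℕ+ → ℕ+ →₀ ℝ) {p : ℕ+}
    (hp : p ∈ (∑ i ∈ B, a i • x i).support) : ∃ i ∈ B, p ∈ (x i).support := by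
  classical
  obtain ⟨i, hi, hpi⟩ := Finset.mem_biUnion.1 (Finsupp.support_finsetSum hp)
  exact ⟨i, hi, Finsupp.support_smul hpi⟩

theorem IsBlocksOver.isBlocks {F : Set (Finset ℕ+)} {x u : ℕ+ → ℕ+ →₀ ℝ} (hx : IsBlocks x)
    (h : IsBlocksOver F x u) (hu : ∀ j, u j ≠ 0) : IsBlocks u := by
  obtain ⟨B, a, h1, h2, h3⟩ := h
  refine ⟨hu, fun i j hij p hp q hq => ?_⟩
  rw [h3] at hp hq
  obtain ⟨k, hk, hp⟩ := support_sum_smul_subset _ _ _ hp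
  obtain ⟨l, hl, hq⟩ := support_sum_smul_subset _ _ _ hq
  exact hx.lt k l (h2 i j hij k hk l hl) p hp q hq

theorem IsBlocks.smul {x : ℕ+ → ℕ+ →₀ ℝ} (hx : IsBlocks x) {c : ℕ+ → ℝ} (hc : ∀ i, c i ≠ 0) :
    IsBlocks fun i => c i • x i :=
  ⟨fun i => smul_ne_zero (hc i) (hx.ne_zero i), fun i j hij =>
    (hx.lt i j hij).mono Finsupp.support_smul Finsupp.support_smul⟩

theorem norm_ofFinsupp_pos {S : Set (Finset ℕ+)} {x : ℕ+ →₀ ℝ} (hx : x ≠ 0) :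
    0 < ‖X01.ofFinsupp S x‖ :=
  norm_pos_iff.2 fun h => hx (X01.ofFinsupp_injective (by rw [h, map_zero]))

variable {S : Set (Finset ℕ+)} {A : ℕ+ → Set (Finset ℕ+)} {x : ℕ+ → ℕ+ →₀ ℝ}

/-- The negation of index zero is exactly the supply of functionals that `exists_ellOne_subsequence`
needs. -/
theorem isIndexZero_or_exists_ellOne (hS : IsIndecomposableFamily S A) (hx : IsBlocks x) :
    IsIndexZero S A x ∨ ∃ c > 0, ∃ g : ℕ+ → ℕ+, StrictMono g ∧ ∀ E ∈ S, ∀ a : ℕ+ → ℝ,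
      c * ∑ i ∈ E, |a i| ≤ ‖X01.ofFinsupp S (∑ i ∈ E, a i • x (g i))‖ := by
  by_cases h : IsIndexZero S A x
  · exact Or.inl h
  · right
    simp only [IsIndexZero] at h
    push Not at h
    obtain ⟨m, ε, hε, h⟩ := h
    refine ⟨ε, hε, exists_ellOne_subsequence hS hx m hε fun j K => ?_⟩
    obtain ⟨k, hk, D, α, s, h1, h2, h3, h4⟩ := h j K
    exact ⟨k, hk, D, α, s, h1, h2, h3, h4.le⟩

theorem IsIndexZero.smul {c : ℕ+ → ℝ} {C : ℝ} (hA : ∀ m, IsRegularFamily (A m)) (hx : IsBlocks x)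
    (hC : ∀ i, |c i| ≤ C) (h : IsIndexZero S A x) : IsIndexZero S A fun i => c i • x i := by
  intro m ε hε
  have hC0 : 0 ≤ C := (abs_nonneg _).trans (hC 1)
  obtain ⟨j, hj⟩ := h.uniform hA hx (ε := ε / (C + 1)) (by positivity)
  obtain ⟨K, hK⟩ := hj m
  refine ⟨j, K, fun k hk D α s h1 h2 h3 => ?_⟩
  have h4 := hK k hk D α s h1 h2 h3
  rw [map_smul, smul_eq_mul]
  calc _ ≤ |c k * pairing (∑ l ∈ D, α l) (x k)| := le_abs_self _
    _ = |c k| * |pairing (∑ l ∈ D, α l) (x k)| := abs_mul _ _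
    _ ≤ (C + 1) * (ε / (C + 1)) := mul_le_mul ((hC k).trans (by linarith)) h4 (abs_nonneg _)
        (by linarith)
    _ = ε := by field_simp

theorem norm_sum_smul_le (F : Finset ℕ+) (a : ℕ+ → ℝ) {C : ℝ} (hx : ∀ i, ‖X01.ofFinsupp S (x i)‖ ≤ C) :
    ‖X01.ofFinsupp S (∑ i ∈ F, a i • x i)‖ ≤ C * ∑ i ∈ F, |a i| := by
  rw [map_sum, Finset.mul_sum]
  refine (norm_sum_le _ _).trans (Finset.sum_le_sum fun i _ => ?_)
  rw [map_smul, norm_smul, Real.norm_eq_abs, mul_comm]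
  exact mul_le_mul_of_nonneg_right (hx i) (abs_nonneg _)

/-- Convex combinations are used so that a lower bound for a linear functional on the `x i` is
inherited; that clause serves the shrinking property. In the `ℓ₁`-alternative the lower estimate
keeps the norms of the combinations away from zero. -/
theorem exists_isIndexZero_convex_blocks (hS : IsIndecomposableFamily S A) (hx : IsBlocks x)
    (hnorm : ∀ i, ‖X01.ofFinsupp S (x i)‖ = 1) :
    ∃ y, IsBlocksOver S x y ∧ (∃ κ > 0, ∀ j, κ ≤ ‖X01.ofFinsupp S (y j)‖) ∧
      (∀ j, ‖X01.ofFinsupp S (y j)‖ ≤ 1) ∧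
      (∀ (L : (ℕ+ →₀ ℝ) →ₗ[ℝ] ℝ) (δ : ℝ), (∀ i, δ ≤ L (x i)) → ∀ j, δ ≤ L (y j)) ∧
      IsIndexZero S A y := by
  rcases isIndexZero_or_exists_ellOne hS hx with h | ⟨κ, hκ, g, hg, hlow⟩
  · exact ⟨x, ⟨fun j => {j}, fun _ _ => 1, fun j => hS.regular_self.singleton j,
      fun i j hij => by simpa [FinsetBefore] using hij, fun j => by simp⟩, ⟨1, one_pos, fun j =>
      (hnorm j).ge⟩, fun j => (hnorm j).le, fun L δ h => h, h⟩
  · have hxg := hx.comp hg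
    obtain ⟨τ, hτ, hlt⟩ := exists_seq (T := Finset ℕ+ × (ℕ+ → ℝ))
      (fun j τ => τ.1 ∈ S ∧ (∀ i ∈ τ.1, j ≤ i) ∧ IsConvexOn τ.1 τ.2 ∧
        SmallOn (fun i => maxSupp (x (g i))) τ.1 τ.2 (A j) ((j : ℕ) : ℝ)⁻¹)
      (fun n τ => ∀ i ∈ τ.1, n < i) (fun τ => τ.1.sup id)
      (fun m n τ hmn h i hi => hmn.trans_lt (h i hi)) (by
        intro j n
        have hj : (0 : ℝ) < (j : ℕ) := by exact_mod_cast j.pos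
        obtain ⟨F, hF, hN, c, hc, hs⟩ := hS.exists_convex _ hxg.strictMono_maxSupp j
          ((j : ℕ) : ℝ)⁻¹ (by positivity) (max j (n + 1))
        simp only [max_le_iff] at hN
        exact ⟨(F, c), ⟨hF, fun i hi => (hN i hi).1, hc, hs⟩,
          fun i hi => PNat.add_one_le_iff.1 (hN i hi).2⟩)
    have habs : ∀ j, ∑ i ∈ (τ j).1, |(τ j).2 i| = 1 := fun j => by
      rw [← (hτ j).2.2.1.sum_eq]
      exact Finset.sum_congr rfl fun i hi => abs_of_nonneg ((hτ j).2.2.1.nonneg i hi)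
    refine ⟨fun j => ∑ i ∈ (τ j).1, (τ j).2 i • x (g i),
      IsBlocksOver.of_comp hS.regular_self hg ⟨fun j => (τ j).1, fun j => (τ j).2,
        fun j => (hτ j).1, fun i j hij k hk l hl =>
          (Finset.le_sup (f := id) hk).trans_lt (hlt i j hij l hl), fun j => rfl⟩,
      ⟨κ, hκ, fun j => ?_⟩, fun j => ?_, fun L δ h j => ?_, ?_⟩
    · have := hlow _ (hτ j).1 (τ j).2
      rwa [habs j, mul_one] at this
    · have := norm_sum_smul_le (S := S) (x := fun i => x (g i)) (τ j).1 (τ j).2 fun i => (hnorm _).le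
      rwa [habs j, mul_one] at this
    · rw [map_sum]
      calc δ = ∑ i ∈ (τ j).1, (τ j).2 i * δ := by
            rw [← Finset.sum_mul, (hτ j).2.2.1.sum_eq, one_mul]
        _ ≤ _ := Finset.sum_le_sum fun i hi => by
          rw [map_smul, smul_eq_mul]
          exact mul_le_mul_of_nonneg_left (h _) ((hτ j).2.2.1.nonneg i hi)
    · exact isIndexZero_of_smallOn hS hxg (fun i => (hnorm _).le) (fun j => (hτ j).2.1)
        (fun j => (hτ j).2.2.1) fun j => (hτ j).2.2.2

theorem exists_czero_blocks (hS : IsIndecomposableFamily S A) (hx : IsBlocks x)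
    (hnorm : ∀ i, ‖X01.ofFinsupp S (x i)‖ = 1) {ε : ℝ} (hε : 0 < ε) :
    ∃ u, IsBlocksOver S x u ∧ (∀ j, ‖X01.ofFinsupp S (u j)‖ = 1) ∧
      ∀ E ∈ schreierOne, ∀ (a : ℕ+ → ℝ) (M : ℝ), 0 ≤ M → (∀ i ∈ E, |a i| ≤ M) →
        ‖X01.ofFinsupp S (∑ i ∈ E, a i • u i)‖ ≤ (1 + ε) * M := by
  obtain ⟨y, hy, ⟨κ, hκ, hyκ⟩, -, -, hy0⟩ := exists_isIndexZero_convex_blocks hS hx hnorm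
  have hypos : ∀ j, 0 < ‖X01.ofFinsupp S (y j)‖ := fun j => hκ.trans_le (hyκ j)
  have hyb : IsBlocks y := hy.isBlocks hx fun j h => by simpa [h] using hypos j
  set w : ℕ+ → ℕ+ →₀ ℝ := fun j => ‖X01.ofFinsupp S (y j)‖⁻¹ • y j with hw
  have hw1 : ∀ j, ‖X01.ofFinsupp S (w j)‖ = 1 := fun j => by
    rw [hw, map_smul, norm_smul, norm_inv, norm_norm, inv_mul_cancel₀ (hypos j).ne']
  have hwb : IsBlocks w := hyb.smul fun j => inv_ne_zero (hypos j).ne'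
  have hw0 : IsIndexZero S A w := hy0.smul (C := κ⁻¹) hS.regular hyb fun j => by
    rw [abs_inv, abs_norm]
    exact inv_anti₀ hκ (hyκ j)
  obtain ⟨g, hg, hup⟩ := hw0.exists_czero_subsequence hS hwb (fun j => (hw1 j).le) hε
  exact ⟨fun j => w (g j), (hy.smul fun j => ‖X01.ofFinsupp S (y j)‖⁻¹).comp hg, fun j => hw1 _, hup⟩

theorem card_Ico_pnat (M N : ℕ+) : (Finset.Ico M (M + N)).card = N := by
  rw [PNat.card_Ico]
  simp

theorem Ico_mem_schreierOne {M N : ℕ+} (h : N ≤ M) : Finset.Ico M (M + N) ∈ schreierOne :=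
  fun n hn => by
    rw [card_Ico_pnat]
    exact_mod_cast h.trans (Finset.mem_Ico.1 hn).1

/-- A functional cannot be bounded below on a normalized block sequence. -/
theorem not_forall_le_functional (hS : IsIndecomposableFamily S A) (hx : IsBlocks x)
    (hnorm : ∀ i, ‖X01.ofFinsupp S (x i)‖ = 1) (f : StrongDual ℝ (X01 S)) {δ : ℝ} (hδ : 0 < δ) :
    ¬∀ i, δ ≤ f (X01.ofFinsupp S (x i)) := by
  intro hf
  obtain ⟨y, hy, ⟨κ, hκ, hyκ⟩, hy1, hyL, hy0⟩ := exists_isIndexZero_convex_blocks hS hx hnorm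
  have hyb : IsBlocks y := hy.isBlocks hx fun j h => by
    have := hyκ j
    rw [h, map_zero, norm_zero] at this
    linarith
  obtain ⟨g, -, hup⟩ := hy0.exists_czero_subsequence hS hyb hy1 one_pos
  have hfy : ∀ j, δ ≤ f (X01.ofFinsupp S (y j)) :=
    hyL (f.toLinearMap ∘ₗ X01.ofFinsupp S) δ hf
  -- A sum of `N` vectors has norm at most `2` by the `c₀`-estimate, yet `f` is at least `N * δ` on
  -- it.
  obtain ⟨N, hN⟩ := exists_pnat_gt (2 * ‖f‖ / δ)
  have h1 := hup _ (Ico_mem_schreierOne (le_refl N)) (fun _ => 1) 1 zero_le_one (by simp)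
  simp only [one_smul] at h1
  have h2 : (N : ℕ) * δ ≤ f (X01.ofFinsupp S (∑ i ∈ Finset.Ico N (N + N), y (g i))) := by
    rw [map_sum, map_sum]
    calc ((N : ℕ) : ℝ) * δ = ∑ _i ∈ Finset.Ico N (N + N), δ := by
          rw [Finset.sum_const, card_Ico_pnat, nsmul_eq_mul]
      _ ≤ _ := Finset.sum_le_sum fun i _ => hfy _
  have h3 := (le_abs_self _).trans (f.le_opNorm (X01.ofFinsupp S (∑ i ∈ Finset.Ico N (N + N), y (g i))))
  have h4 := mul_le_mul_of_nonneg_left h1 (norm_nonneg f)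
  rw [div_lt_iff₀ hδ] at hN
  linarith

/-- The average of functionals norming the single `x i`, `i ∈ B k`, takes a value at least `c` on
their sum, and its size is the cardinality of `B k`. One average is a singleton family in `A 1`, so
the sums fail index zero. -/
theorem exists_ellOne_of_averages (hS : IsIndecomposableFamily S A) (hx : IsBlocks x) {c : ℝ}
    (hc : 0 < c) (hnorm : ∀ i, c < ‖X01.ofFinsupp S (x i)‖) {B : ℕ+ → Finset ℕ+}
    (hB : ∀ i j, i < j → FinsetBefore (B i) (B j)) (hcard : ∀ k : ℕ+, (k : ℕ) ≤ (B k).card) :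
    ∃ g : ℕ+ → ℕ+, StrictMono g ∧ ∀ E ∈ S, ∀ a : ℕ+ → ℝ,
      c * ∑ i ∈ E, |a i| ≤ ‖X01.ofFinsupp S (∑ i ∈ E, a i • ∑ j ∈ B (g i), x j)‖ := by
  classical
  have hexf : ∀ i, ∃ f ∈ normingSet S, c < pairing f (x i) ∧ f.support ⊆ (x i).support := by
    intro i
    obtain ⟨f, hf, hcf⟩ := X01.exists_lt_pairing (hnorm i)
    obtain ⟨f', hf', heq, hsupp⟩ := exists_supported_mem_normingSet hS.regular_self
      (p := (· ∈ (x i).support)) hf (fun _ h => h) (hc.trans hcf).ne'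
    exact ⟨f', hf', heq ▸ hcf, hsupp⟩
  choose f hfW hfc hfsupp using hexf
  have hover : IsBlocksOver Set.univ x fun k => ∑ i ∈ B k, x i :=
    ⟨B, fun _ _ => 1, fun _ => trivial, hB, fun j => by simp⟩
  have hfx : ∀ k, ∀ i ∈ B k, pairing (f i) (∑ j ∈ B k, x j) = pairing (f i) (x i) := by
    intro k i hi
    rw [map_sum]
    refine Finset.sum_eq_single_of_mem i hi fun j _ hji => pairing_eq_zero ?_
    exact (hx.disjoint hji.symm).mono_left (by exact_mod_cast hfsupp i)
  have hne : ∀ k, (∑ i ∈ B k, x i) ≠ 0 := by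
    intro k h0
    obtain ⟨i, hi⟩ : (B k).Nonempty := Finset.card_pos.1 (k.pos.trans_le (hcard k))
    have := hfx k i hi
    rw [h0, map_zero] at this
    have := hfc i
    linarith
  refine exists_ellOne_subsequence hS (hover.isBlocks hx hne) 1 hc fun j K => ?_
  -- The summand `2` guarantees the least admissible size of an average.
  refine ⟨max K (j + 2 : ℕ).toPNat', le_max_left _ _, ?_⟩
  set k := max K (j + 2 : ℕ).toPNat'
  have hk : j + 2 ≤ (k : ℕ) := by
    have h1 : (j + 2 : ℕ).toPNat' ≤ k := le_max_right _ _
    have h2 : (((j + 2 : ℕ).toPNat' : ℕ+) : ℕ) ≤ k := by exact_mod_cast h1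
    rwa [Nat.toPNat'_coe, if_pos (by omega)] at h2
  have hBk := hcard k
  have havg : IsAverage (normingSet S) (B k).card (((B k).card : ℝ)⁻¹ • ∑ i ∈ B k, f i) :=
    IsAverage.of_finset (by omega) (Finset.card_pos.1 (by omega)) le_rfl (fun i _ => hfW i)
      fun i _ l _ hil => (hx.lt i l hil).mono (hfsupp i) (hfsupp l)
  set α := ((B k).card : ℝ)⁻¹ • ∑ i ∈ B k, f i with hα
  have hα0 : α ≠ 0 := ne_zero_of_mem_normingSet havg.mem_normingSet
  refine ⟨{minSupp α}, fun _ => α, fun _ => (B k).card, ⟨fun _ _ => havg, fun l hl => ?_,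
    fun l hl l' hl' hll => ?_⟩, (hS.regular 1).singleton _, fun _ _ => (by omega : j ≤ (B k).card), ?_⟩
  · rw [Finset.mem_singleton.1 hl]
    exact isLeast_minSupp hα0
  · rw [Finset.mem_singleton.1 hl, Finset.mem_singleton.1 hl'] at hll
    exact absurd hll (lt_irrefl _)
  · have hpos : (0 : ℝ) < (B k).card := by exact_mod_cast (by omega : 0 < (B k).card)
    rw [Finset.sum_singleton, hα, pairing_smul_left, pairing_sum_left, le_inv_mul_iff₀ hpos]
    calc ((B k).card : ℝ) * c = ∑ _i ∈ B k, c := by rw [Finset.sum_const, nsmul_eq_mul]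
      _ ≤ _ := Finset.sum_le_sum fun i hi => by
        rw [hfx k i hi]
        exact (hfc i).le

theorem exists_successive_schreierOne (l : ℕ+) : ∃ B : ℕ+ → Finset ℕ+,
    (∀ k, B k ∈ schreierOne) ∧ (∀ k, ∀ i ∈ B k, l ≤ i) ∧
    (∀ i j, i < j → FinsetBefore (B i) (B j)) ∧ ∀ k : ℕ+, (B k).card = k := by
  -- The intervals are successive because `k ^ 2 + k ≤ (k + 1) ^ 2`.
  refine ⟨fun k => Finset.Ico (l + k * k) (l + k * k + k), fun k => Ico_mem_schreierOne ?_,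
    fun k i hi => ?_, fun i j hij m hm n hn => ?_, fun k => card_Ico_pnat _ _⟩
  · rw [← PNat.coe_le_coe, PNat.add_coe, PNat.mul_coe]
    have := k.pos
    nlinarith
  · exact (PNat.lt_add_right _ _).le.trans (Finset.mem_Ico.1 hi).1
  · have h1 := (Finset.mem_Ico.1 hm).2
    have h2 := (Finset.mem_Ico.1 hn).1
    rw [← PNat.coe_lt_coe] at h1 hij ⊢
    rw [← PNat.coe_le_coe] at h2
    simp only [PNat.add_coe, PNat.mul_coe] at h1 h2
    nlinarith

/-- Every normalized block sequence has blocks over members of `S` that are almost isometrically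
an `ℓ₁`-spreading model. -/
theorem exists_ellOne_blocks (hS : IsIndecomposableFamily S A) (hx : IsBlocks x)
    (hnorm : ∀ i, ‖X01.ofFinsupp S (x i)‖ = 1) {ε : ℝ} (hε : 0 < ε) (hε1 : ε ≤ 1) :
    ∃ v, IsBlocksOver S x v ∧ (∀ j, ‖X01.ofFinsupp S (v j)‖ ≤ 1 + ε) ∧
      ∀ E ∈ S, ∀ a : ℕ+ → ℝ, ∑ i ∈ E, |a i| ≤ ‖X01.ofFinsupp S (∑ i ∈ E, a i • v i)‖ := by
  rcases isIndexZero_or_exists_ellOne hS hx with h | ⟨κ, hκ, g, hg, hlow⟩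
  -- Long sums have norm at most `1 + ε / 3` and lower `ℓ₁`-constant `(1 + ε / 3)⁻¹`. After scaling
  -- the lower constant to one, the norms are at most `(1 + ε / 3) ^ 2 ≤ 1 + ε`.
  · obtain ⟨g, hg, hup⟩ := h.exists_czero_subsequence hS hx (fun i => (hnorm i).le)
      (ε := ε / 3) (by positivity)
    obtain ⟨l, hl⟩ := hS.schreierOne_subset
    obtain ⟨B, hB1, hBl, hBlt, hBcard⟩ := exists_successive_schreierOne l
    have h0 : 0 < 1 + ε / 3 := by positivity
    obtain ⟨g', hg', hlow⟩ := exists_ellOne_of_averages hS (hx.comp hg) (c := (1 + ε / 3)⁻¹)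
      (by positivity) (fun i => by
        rw [hnorm]
        exact inv_lt_one_of_one_lt₀ (by linarith)) hBlt fun k => (hBcard k).ge
    refine ⟨fun j => (1 + ε / 3) • ∑ i ∈ B (g' j), x (g i), IsBlocksOver.smul ?_ _, fun j => ?_,
      fun E hE a => ?_⟩
    · refine IsBlocksOver.of_comp hS.regular_self hg ⟨fun j => B (g' j), fun _ _ => 1,
        fun j => hl _ (hB1 _) (hBl _), fun i j hij => hBlt _ _ (hg' hij), fun j => by simp⟩
    · have h1 := hup _ (hB1 (g' j)) (fun _ => 1) 1 zero_le_one (by simp)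
      simp only [one_smul, mul_one] at h1
      rw [map_smul, norm_smul, Real.norm_eq_abs, abs_of_pos h0]
      nlinarith
    · have h1 := hlow E hE fun i => a i * (1 + ε / 3)
      simp only [abs_mul, abs_of_pos h0, mul_smul] at h1
      rw [← Finset.sum_mul] at h1
      refine le_of_eq_of_le ?_ h1
      field_simp
  · obtain ⟨θ, hθ, F, b, hF, hFS, hb, hup, hE⟩ := exists_almost_isometric_ellOne_blocks hS
      (normSeminorm ℝ (X01 S)) (v := fun i => X01.ofFinsupp S (x (g i))) (C := 1)
      (fun i => (hnorm _).le) hκ (fun E hE a => by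
        have := hlow E hE a
        simpa using this) hε
    simp only [coe_normSeminorm] at hup hE
    refine ⟨fun j => θ⁻¹ • ∑ i ∈ F j, b j i • x (g i), IsBlocksOver.smul
      (IsBlocksOver.of_comp hS.regular_self hg ⟨F, b, hFS, hF, fun j => rfl⟩) _, fun j => ?_,
      fun E hES a => ?_⟩
    · have h1 := hup j
      rw [map_smul, norm_smul, norm_inv, Real.norm_eq_abs, abs_of_pos hθ, inv_mul_le_iff₀ hθ]
      simp only [map_sum, map_smul]
      linarith
    · have h1 := (hE E hES).2 fun i => a i * θ⁻¹
      simp only [abs_mul, abs_inv, abs_of_pos hθ] at h1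
      rw [← Finset.sum_mul] at h1
      simp only [map_sum, map_smul]
      simp only [mul_smul] at h1
      refine le_of_eq_of_le ?_ h1
      field_simp

end

section

/-! ## Basic sequences -/

section Basic

variable {X : Type*} [NormedAddCommGroup X] [NormedSpace ℝ X]

theorem exists_finset_sum_of_mem_span {x : ℕ+ → X} {z : X}
    (hz : z ∈ Submodule.span ℝ (Set.range x)) :
    ∃ (G : Finset ℕ+) (a : ℕ+ → ℝ), z = ∑ i ∈ G, a i • x i := by
  obtain ⟨c, rfl⟩ := Finsupp.mem_span_range_iff_exists_finsupp.1 hz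
  exact ⟨c.support, c, rfl⟩

/-- Uniformly bounded projections onto arbitrary finite sets give unconditional convergence of the
expansion on the closed span, which is stronger than the conditional convergence required. -/
theorem isBasicSeq_of_le {x : ℕ+ → X} (h0 : ∀ i, x i ≠ 0) {K : ℝ} (hK0 : 0 ≤ K)
    (hK : ∀ F G : Finset ℕ+, F ⊆ G → ∀ a : ℕ+ → ℝ,
      ‖∑ i ∈ F, a i • x i‖ ≤ K * ‖∑ i ∈ G, a i • x i‖) : IsBasicSeq x := by
  classical
  have hcoef : ∀ (G : Finset ℕ+) (a : ℕ+ → ℝ), ∀ i ∈ G,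
      |a i| * ‖x i‖ ≤ K * ‖∑ i ∈ G, a i • x i‖ := by
    intro G a i hi
    have := hK {i} G (by simpa using hi) a
    rwa [Finset.sum_singleton, norm_smul, Real.norm_eq_abs] at this
  have hli : LinearIndependent ℝ x := by
    refine linearIndependent_iff'.2 fun G a hG i hi => ?_
    have h1 := hcoef G a i hi
    rw [hG, norm_zero, mul_zero] at h1
    have h2 := norm_pos_iff.2 (h0 i)
    by_contra hne
    have := mul_pos (abs_pos.2 hne) h2
    linarith
  set b := Module.Basis.span hli with hb
  have hbx : ∀ i, (b i : X) = x i := fun i => congrArg Subtype.val (Module.Basis.span_apply hli i)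
  have hrepr : ∀ (G : Finset ℕ+) (a : ℕ+ → ℝ) (i : ℕ+),
      b.coord i (∑ j ∈ G, a j • b j) = if i ∈ G then a i else 0 := by
    intro G a i
    simp [Finsupp.single_apply]
  have hbound : ∀ i, ∀ z, ‖b.coord i z‖ ≤ K / ‖x i‖ * ‖z‖ := by
    intro i z
    obtain ⟨G, a, hz⟩ := exists_finset_sum_of_mem_span z.2
    have hz' : z = ∑ j ∈ G, a j • b j := by
      apply Subtype.ext
      rw [hz, AddSubmonoidClass.coe_finsetSum]
      simp [hbx]
    have h1 : ‖z‖ = ‖∑ j ∈ G, a j • x j‖ := by rw [← hz]; rfl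
    rw [div_mul_eq_mul_div, le_div_iff₀ (norm_pos_iff.2 (h0 i)), h1]
    conv_lhs => rw [hz', hrepr]
    split_ifs with hi
    · exact hcoef G a i hi
    · rw [norm_zero, zero_mul]; positivity
  -- The coordinate functionals are bounded on the linear span; Hahn–Banach extends them to the
  -- whole space, and hence to the closed span.
  choose f hf using fun i => (exists_extension_norm_eq (Submodule.span ℝ (Set.range x))
    ((b.coord i).mkContinuous _ (hbound i)))
  have hfx : ∀ i (G : Finset ℕ+) (a : ℕ+ → ℝ),
      f i (∑ j ∈ G, a j • x j) = if i ∈ G then a i else 0 := by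
    intro i G a
    have h1 := (hf i).1 (∑ j ∈ G, a j • b j)
    rw [LinearMap.mkContinuous_apply, hrepr] at h1
    rw [← h1, AddSubmonoidClass.coe_finsetSum]
    simp [hbx]
  have hproj : ∀ (F G : Finset ℕ+) (a : ℕ+ → ℝ),
      ∑ i ∈ F, f i (∑ j ∈ G, a j • x j) • x i = ∑ i ∈ F ∩ G, a i • x i := by
    intro F G a
    simp only [hfx, ite_smul, zero_smul]
    rw [Finset.sum_ite_mem]
  have hle : ∀ (F : Finset ℕ+), ∀ z ∈ closedSpan x, ‖∑ i ∈ F, f i z • x i‖ ≤ K * ‖z‖ := by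
    intro F z hz
    have hclosed : IsClosed {z : X | ‖∑ i ∈ F, f i z • x i‖ ≤ K * ‖z‖} :=
      isClosed_le (by fun_prop) (by fun_prop)
    refine closure_minimal (s := (Submodule.span ℝ (Set.range x) : Set X)) (fun z hz => ?_) hclosed hz
    obtain ⟨G, a, rfl⟩ := exists_finset_sum_of_mem_span hz
    simp only [Set.mem_ofPred_eq]
    rw [hproj]
    exact hK _ _ Finset.inter_subset_right a
  refine ⟨⟨toClosedSpan x, fun i => (f i).comp (closedSpan x).subtypeL, fun i j => ?_,
    fun z => ?_⟩, rfl⟩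
  · have := hfx i {j} fun _ => 1
    simp only [Finset.sum_singleton, one_smul, Finset.mem_singleton] at this
    simp [toClosedSpan, this, Pi.single_apply]
  · have hsum : HasSum (fun i => ((f i).comp (closedSpan x).subtypeL) z • toClosedSpan x i) z := by
      rw [HasSum, SummationFilter.unconditional_filter, Metric.tendsto_atTop]
      intro ε hε
      obtain ⟨w, hw, hzw⟩ := Metric.mem_closure_iff.1 z.2 (ε / (K + 2)) (by positivity)
      obtain ⟨G, a, rfl⟩ := exists_finset_sum_of_mem_span hw
      refine ⟨G, fun F hF => ?_⟩
      have hF' : G ⊆ F := hF.le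
      rw [dist_eq_norm]
      change ‖((∑ i ∈ F, ((f i).comp (closedSpan x).subtypeL) z • toClosedSpan x i - z :
        closedSpan x) : X)‖ < ε
      have heq : ((∑ i ∈ F, ((f i).comp (closedSpan x).subtypeL) z • toClosedSpan x i - z :
          closedSpan x) : X) = ∑ i ∈ F, f i (z - ∑ j ∈ G, a j • x j) • x i -
            (z - ∑ j ∈ G, a j • x j) := by
        have h1 := hproj F G a
        rw [Finset.inter_eq_right.2 hF'] at h1
        simp only [map_sub, sub_smul, Finset.sum_sub_distrib, h1]
        rw [Submodule.coe_sub, AddSubmonoidClass.coe_finsetSum]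
        simp [toClosedSpan]
      rw [heq]
      have h2 := hle F (z - ∑ j ∈ G, a j • x j) ((closedSpan x).sub_mem z.2
        (Submodule.le_topologicalClosure _ hw))
      rw [dist_eq_norm] at hzw
      rw [lt_div_iff₀ (by positivity)] at hzw
      calc _ ≤ ‖∑ i ∈ F, f i (z - ∑ j ∈ G, a j • x j) • x i‖ + ‖(z : X) - ∑ j ∈ G, a j • x j‖ :=
            norm_sub_le _ _
        _ ≤ (K + 1) * ‖(z : X) - ∑ j ∈ G, a j • x j‖ := by linarith
        _ ≤ ‖(z : X) - ∑ j ∈ G, a j • x j‖ * (K + 2) := by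
            rw [mul_comm]
            exact mul_le_mul_of_nonneg_left (by linarith) (norm_nonneg _)
        _ < ε := hzw
    exact hsum.mono_left (SummationFilter.LeAtTop.le_atTop)

end Basic

/-! ## Block sequences and their perturbations -/

variable {S : Set (Finset ℕ+)} {A : ℕ+ → Set (Finset ℕ+)} {x : ℕ+ → ℕ+ →₀ ℝ}

theorem norm_sum_le_of_subset (hS : IsRegularFamily S) (hx : IsBlocks x) {F G : Finset ℕ+}
    (hFG : F ⊆ G) (a : ℕ+ → ℝ) :
    ‖X01.ofFinsupp S (∑ i ∈ F, a i • x i)‖ ≤ ‖X01.ofFinsupp S (∑ i ∈ G, a i • x i)‖ := by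
  classical
  have heq : ∑ i ∈ F, a i • x i =
      (∑ i ∈ G, a i • x i).filter fun p => ∃ i ∈ F, p ∈ (x i).support := by
    ext p
    rw [Finsupp.filter_apply]
    split_ifs with h
    · obtain ⟨i, hi, hp⟩ := h
      have hz : ∀ j, j ≠ i → a j * x j p = 0 := fun j hj => by
        have : x j p = 0 := by
          by_contra h
          exact Finset.disjoint_left.1 (hx.disjoint hj) (Finsupp.mem_support_iff.2 h) hp
        rw [this, mul_zero]
      simp only [Finsupp.finsetSum_apply, Finsupp.smul_apply, smul_eq_mul]
      rw [Finset.sum_eq_single_of_mem i hi fun j _ hj => hz j hj,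
        Finset.sum_eq_single_of_mem i (hFG hi) fun j _ hj => hz j hj]
    · push Not at h
      simp only [Finsupp.finsetSum_apply, Finsupp.smul_apply, smul_eq_mul]
      exact Finset.sum_eq_zero fun i hi => by
        rw [Finsupp.notMem_support_iff.1 (h i hi), mul_zero]
  rw [heq]
  exact X01.norm_filter_le hS _ (∑ i ∈ G, a i • x i)

theorem abs_coeff_le (hS : IsRegularFamily S) (hx : IsBlocks x) {G : Finset ℕ+} (a : ℕ+ → ℝ)
    {i : ℕ+} (hi : i ∈ G) :
    |a i| * ‖X01.ofFinsupp S (x i)‖ ≤ ‖X01.ofFinsupp S (∑ i ∈ G, a i • x i)‖ := by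
  have := norm_sum_le_of_subset hS hx (F := {i}) (G := G) (by simpa using hi) a
  rwa [Finset.sum_singleton, map_smul, norm_smul, Real.norm_eq_abs] at this

theorem IsBlocks.isBasicSeq (hS : IsRegularFamily S) (hx : IsBlocks x) :
    IsBasicSeq fun i => X01.ofFinsupp S (x i) := by
  refine isBasicSeq_of_le (fun i => norm_pos_iff.1 (norm_ofFinsupp_pos (hx.ne_zero i)))
    zero_le_one fun F G hFG a => ?_
  rw [one_mul]
  simpa using norm_sum_le_of_subset hS hx hFG a

/-- The vectors `u' j` are summably close to the normalized blocks `u j`. -/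
def IsSmallPerturbation (u : ℕ+ → ℕ+ →₀ ℝ) (u' : ℕ+ → X01 S) : Prop :=
  ∀ E : Finset ℕ+, ∑ j ∈ E, ‖u' j - X01.ofFinsupp S (u j)‖ ≤ 1 / 4

/-- Unconditionality bounds every coefficient by the norm of the sum, so the total error is at most
a quarter of that norm. -/
theorem IsSmallPerturbation.norm_le (hS : IsRegularFamily S) (hx : IsBlocks x)
    (hnorm : ∀ i, ‖X01.ofFinsupp S (x i)‖ = 1) {x' : ℕ+ → X01 S} (h : IsSmallPerturbation x x')
    (G : Finset ℕ+) (a : ℕ+ → ℝ) :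
    3 / 4 * ‖X01.ofFinsupp S (∑ i ∈ G, a i • x i)‖ ≤ ‖∑ i ∈ G, a i • x' i‖ ∧
    ‖∑ i ∈ G, a i • x' i‖ ≤ 5 / 4 * ‖X01.ofFinsupp S (∑ i ∈ G, a i • x i)‖ := by
  have key : ‖∑ i ∈ G, a i • x' i - X01.ofFinsupp S (∑ i ∈ G, a i • x i)‖ ≤
      1 / 4 * ‖X01.ofFinsupp S (∑ i ∈ G, a i • x i)‖ := by
    rw [map_sum, ← Finset.sum_sub_distrib]
    calc _ ≤ ∑ i ∈ G, ‖a i • x' i - X01.ofFinsupp S (a i • x i)‖ := norm_sum_le _ _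
      _ ≤ ∑ i ∈ G, ‖x' i - X01.ofFinsupp S (x i)‖ * ‖X01.ofFinsupp S (∑ i ∈ G, a i • x i)‖ := by
          refine Finset.sum_le_sum fun i hi => ?_
          rw [map_smul, ← smul_sub, norm_smul, Real.norm_eq_abs, mul_comm]
          have := abs_coeff_le hS hx a hi
          rw [hnorm, mul_one] at this
          exact mul_le_mul_of_nonneg_left this (norm_nonneg _)
      _ ≤ 1 / 4 * ‖X01.ofFinsupp S (∑ i ∈ G, a i • x i)‖ := by
          rw [← Finset.sum_mul]
          exact mul_le_mul_of_nonneg_right (h G) (norm_nonneg _)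
      _ = _ := by rw [map_sum]
  have h1 := norm_sub_norm_le (X01.ofFinsupp S (∑ i ∈ G, a i • x i)) (∑ i ∈ G, a i • x' i)
  have h2 := norm_sub_norm_le (∑ i ∈ G, a i • x' i) (X01.ofFinsupp S (∑ i ∈ G, a i • x i))
  rw [norm_sub_rev] at h1
  constructor <;> linarith

theorem IsSmallPerturbation.isBasicSeq (hS : IsRegularFamily S) (hx : IsBlocks x)
    (hnorm : ∀ i, ‖X01.ofFinsupp S (x i)‖ = 1) {x' : ℕ+ → X01 S} (h : IsSmallPerturbation x x') :
    IsBasicSeq x' := by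
  refine isBasicSeq_of_le (K := 5 / 3) (fun i h0 => ?_) (by norm_num) fun F G hFG a => ?_
  · have := (h.norm_le hS hx hnorm {i} fun _ => 1).1
    simp only [Finset.sum_singleton, one_smul, hnorm, h0, norm_zero] at this
    linarith
  · have h1 := (h.norm_le hS hx hnorm F a).2
    have h2 := (h.norm_le hS hx hnorm G a).1
    have h3 := norm_sum_le_of_subset hS hx hFG a
    linarith

theorem sum_geometric_pnat_le (G : Finset ℕ+) : ∑ i ∈ G, (1 / 2 : ℝ) ^ (i : ℕ) ≤ 2 := by
  have h1 : ∑ i ∈ G, (1 / 2 : ℝ) ^ (i : ℕ) = ∑ n ∈ G.image ((↑) : ℕ+ → ℕ), (1 / 2 : ℝ) ^ n :=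
    (Finset.sum_image PNat.coe_injective.injOn).symm
  rw [h1]
  refine le_trans (Finset.sum_le_sum_of_subset_of_nonneg (t := Finset.range
    ((G.image ((↑) : ℕ+ → ℕ)).sup id + 1)) (fun n hn => ?_) fun n _ _ => by positivity)
    (sum_geometric_two_le _)
  exact Finset.mem_range.2 (Nat.lt_succ_of_le (Finset.le_sup (f := id) hn))

/-- The same combinations are taken of the nearby vectors in `Y`. Their coefficients have modulus at
most one and each index occurs once, so the errors add up to at most `2 / 8`. -/
theorem IsBlocksOver.exists_perturbation (hS : IsRegularFamily S) (hx : IsBlocks x)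
    (hnorm : ∀ i, ‖X01.ofFinsupp S (x i)‖ = 1) {x' : ℕ+ → X01 S}
    (hx' : ∀ i, ‖x' i - X01.ofFinsupp S (x i)‖ ≤ 1 / 8 * (1 / 2) ^ (i : ℕ))
    {F : Set (Finset ℕ+)} {u : ℕ+ → ℕ+ →₀ ℝ} (hu : IsBlocksOver F x u)
    (hunorm : ∀ i, ‖X01.ofFinsupp S (u i)‖ = 1) {Y : Submodule ℝ (X01 S)} (hY : ∀ i, x' i ∈ Y) :
    ∃ u', (∀ j, u' j ∈ Y) ∧ IsSmallPerturbation u u' := by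
  obtain ⟨B, a, -, hB, ha⟩ := hu
  refine ⟨fun j => ∑ i ∈ B j, a j i • x' i, fun j => Y.sum_mem fun i _ => Y.smul_mem _ (hY i),
    fun E => ?_⟩
  have hj : ∀ j, ‖∑ i ∈ B j, a j i • x' i - X01.ofFinsupp S (u j)‖ ≤
      ∑ i ∈ B j, 1 / 8 * (1 / 2 : ℝ) ^ (i : ℕ) := by
    intro j
    rw [ha, map_sum, ← Finset.sum_sub_distrib]
    refine (norm_sum_le _ _).trans (Finset.sum_le_sum fun i hi => ?_)
    rw [map_smul, ← smul_sub, norm_smul, Real.norm_eq_abs]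
    have h1 := abs_coeff_le hS hx (a j) hi
    rw [hnorm, mul_one, ← ha, hunorm] at h1
    exact (mul_le_of_le_one_left (norm_nonneg _) h1).trans (hx' i)
  refine (Finset.sum_le_sum fun j _ => hj j).trans ?_
  have hdisj := (exists_glue (E := (E : Set ℕ+)) (fun i _ j _ => hB i j) fun _ _ => (0 : ℝ)).1
  rw [← Finset.sum_biUnion hdisj, ← Finset.mul_sum]
  have := sum_geometric_pnat_le (E.biUnion B)
  linarith

/-! ## Restrictions to intervals -/

namespace X01

theorem restrict_ofFinsupp (a b : ℕ+) (x : ℕ+ →₀ ℝ) :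
    restrict S a b (ofFinsupp S x) = ofFinsupp S (x.filter fun i => a ≤ i ∧ i ≤ b) := by
  rw [restrict]
  simp only [coord_ofFinsupp, e_eq, ← map_smul, ← map_sum]
  congr 1
  ext i
  simp only [Finsupp.finsetSum_apply, Finsupp.smul_apply, smul_eq_mul, Finsupp.filter_apply,
    Finsupp.single_apply, mul_ite, mul_one, mul_zero, Finset.sum_ite_eq', Finset.mem_Icc]

theorem restrict_sub (a b : ℕ+) (x y : X01 S) :
    restrict S a b (x - y) = restrict S a b x - restrict S a b y := by
  simp [restrict, sub_smul, Finset.sum_sub_distrib]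

theorem restrict_add (a b : ℕ+) (x y : X01 S) :
    restrict S a b (x + y) = restrict S a b x + restrict S a b y := by
  simp [restrict, add_smul, Finset.sum_add_distrib]

theorem restrict_smul (a b : ℕ+) (c : ℝ) (x : X01 S) :
    restrict S a b (c • x) = c • restrict S a b x := by
  simp [restrict, Finset.smul_sum, smul_smul]

theorem denseRange_ofFinsupp : DenseRange (ofFinsupp S) :=
  UniformSpace.Completion.denseRange_coe.comp
    (PreX01.vec S).symm.surjective.denseRange (UniformSpace.Completion.continuous_coe _)

theorem exists_ofFinsupp_near (x : X01 S) {ε : ℝ} (hε : 0 < ε) :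
    ∃ y, ‖x - ofFinsupp S y‖ < ε := by
  obtain ⟨y, hy⟩ := denseRange_ofFinsupp.exists_dist_lt x hε
  exact ⟨y, by rwa [← dist_eq_norm]⟩

theorem continuous_restrict (a b : ℕ+) : Continuous (restrict S a b) := by
  unfold restrict
  fun_prop

theorem norm_restrict_le (hS : IsRegularFamily S) (a b : ℕ+) (x : X01 S) :
    ‖restrict S a b x‖ ≤ ‖x‖ := by
  refine denseRange_ofFinsupp.induction_on x
    (isClosed_le (continuous_restrict a b).norm continuous_norm) fun y => ?_
  rw [restrict_ofFinsupp]
  exact norm_filter_le hS _ y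

end X01

/-- The first `N` coordinates cannot separate points of an infinite-dimensional `Y`, so `Y` has a
unit vector vanishing on them. It is approximated by a finitely supported vector, which is cut off
and normalized. -/
theorem exists_near_of_not_finiteDimensional (hS : IsRegularFamily S) (Y : Submodule ℝ (X01 S))
    (hY : ¬FiniteDimensional ℝ Y) (N : ℕ+) {ε : ℝ} (hε : 0 < ε) :
    ∃ y ∈ Y, ∃ z : ℕ+ →₀ ℝ, (∀ p ∈ z.support, N < p) ∧ ‖X01.ofFinsupp S z‖ = 1 ∧
      ‖y - X01.ofFinsupp S z‖ ≤ ε := by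
  classical
  set T : Y →ₗ[ℝ] (Finset.Icc 1 N → ℝ) :=
    LinearMap.pi fun i => (X01.coord S i).toLinearMap ∘ₗ Y.subtype with hT
  have hker : ∃ y ∈ LinearMap.ker T, y ≠ 0 := by
    by_contra! h
    exact hY (FiniteDimensional.of_injective T (LinearMap.ker_eq_bot.1 ((Submodule.eq_bot_iff _).2 h)))
  obtain ⟨y₀, hy₀, hne⟩ := hker
  have hpos : 0 < ‖(y₀ : X01 S)‖ := norm_pos_iff.2 fun h => hne (Subtype.ext h)
  set y : X01 S := ‖(y₀ : X01 S)‖⁻¹ • (y₀ : X01 S) with hy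
  have hynorm : ‖y‖ = 1 := by rw [hy, norm_smul, norm_inv, norm_norm, inv_mul_cancel₀ hpos.ne']
  have hyr : X01.restrict S 1 N y = 0 := by
    rw [hy, X01.restrict_smul, X01.restrict, Finset.sum_eq_zero, smul_zero]
    intro i hi
    have := congrFun (LinearMap.mem_ker.1 hy₀) ⟨i, hi⟩
    simp only [hT, LinearMap.pi_apply, LinearMap.comp_apply, Submodule.subtype_apply,
      ContinuousLinearMap.coe_coe, Pi.zero_apply] at this
    rw [this, zero_smul]
  -- Cutting off costs `2 * δ` and normalizing another `2 * δ`; the second bound keeps the cut-off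
  -- vector away from zero.
  set δ := min (ε / 4) (1 / 4) with hδ
  have hδ0 : 0 < δ := by positivity
  obtain ⟨w, hw⟩ := X01.exists_ofFinsupp_near y hδ0
  set z₀ : ℕ+ →₀ ℝ := w.filter fun i => N < i with hz₀
  have hsplit : X01.ofFinsupp S z₀ = X01.ofFinsupp S w - X01.restrict S 1 N (X01.ofFinsupp S w) := by
    rw [X01.restrict_ofFinsupp, ← map_sub]
    congr 1
    ext i
    simp only [hz₀, Finsupp.sub_apply, Finsupp.filter_apply]
    by_cases h : N < i
    · simp [h, not_le.2 h]
    · simp [h, not_lt.1 h]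
  have hz₀y : ‖y - X01.ofFinsupp S z₀‖ ≤ 2 * δ := by
    have h1 : y - X01.ofFinsupp S z₀ = (y - X01.ofFinsupp S w) -
        X01.restrict S 1 N (y - X01.ofFinsupp S w) := by
      rw [X01.restrict_sub, hyr, hsplit]; abel
    rw [h1]
    have h2 := norm_sub_le (y - X01.ofFinsupp S w) (X01.restrict S 1 N (y - X01.ofFinsupp S w))
    have h3 := X01.norm_restrict_le hS 1 N (y - X01.ofFinsupp S w)
    linarith
  have hnear : |1 - ‖X01.ofFinsupp S z₀‖| ≤ 2 * δ := by
    rw [← hynorm]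
    exact (abs_norm_sub_norm_le _ _).trans hz₀y
  have hδ1 : δ ≤ 1 / 4 := min_le_right _ _
  have hδ2 : δ ≤ ε / 4 := min_le_left _ _
  have hz₀pos : 0 < ‖X01.ofFinsupp S z₀‖ := by
    have := (abs_le.1 hnear).2
    linarith
  refine ⟨y, Y.smul_mem _ y₀.2, ‖X01.ofFinsupp S z₀‖⁻¹ • z₀, fun p hp => ?_, ?_, ?_⟩
  · have := Finsupp.support_smul hp
    rw [hz₀, Finsupp.support_filter] at this
    exact (Finset.mem_filter.1 this).2
  · rw [map_smul, norm_smul, norm_inv, norm_norm, inv_mul_cancel₀ hz₀pos.ne']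
  · have h1 : ‖X01.ofFinsupp S z₀ - X01.ofFinsupp S (‖X01.ofFinsupp S z₀‖⁻¹ • z₀)‖ ≤ 2 * δ := by
      have : X01.ofFinsupp S z₀ - X01.ofFinsupp S (‖X01.ofFinsupp S z₀‖⁻¹ • z₀) =
          (1 - ‖X01.ofFinsupp S z₀‖⁻¹) • X01.ofFinsupp S z₀ := by
        rw [map_smul, sub_smul, one_smul]
      rw [this, norm_smul, Real.norm_eq_abs]
      refine le_trans (le_of_eq ?_) hnear
      rw [← abs_of_pos hz₀pos, ← abs_mul, sub_mul, abs_of_pos hz₀pos, inv_mul_cancel₀ hz₀pos.ne',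
        one_mul, abs_sub_comm]
    have h2 := norm_sub_le_norm_sub_add_norm_sub y (X01.ofFinsupp S z₀)
      (X01.ofFinsupp S (‖X01.ofFinsupp S z₀‖⁻¹ • z₀))
    linarith

theorem exists_blocks_near (hS : IsRegularFamily S) (Y : Submodule ℝ (X01 S))
    (hY : ¬FiniteDimensional ℝ Y) : ∃ (z : ℕ+ → ℕ+ →₀ ℝ) (y : ℕ+ → X01 S), IsBlocks z ∧
      (∀ i, ‖X01.ofFinsupp S (z i)‖ = 1) ∧ (∀ i, y i ∈ Y) ∧
      ∀ i, ‖y i - X01.ofFinsupp S (z i)‖ ≤ 1 / 8 * (1 / 2) ^ (i : ℕ) := by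
  obtain ⟨τ, hτ, hlt⟩ := exists_seq (T := X01 S × (ℕ+ →₀ ℝ))
    (fun i τ => τ.1 ∈ Y ∧ ‖X01.ofFinsupp S τ.2‖ = 1 ∧
      ‖τ.1 - X01.ofFinsupp S τ.2‖ ≤ 1 / 8 * (1 / 2) ^ (i : ℕ))
    (fun n τ => ∀ p ∈ τ.2.support, n < p) (fun τ => maxSupp τ.2)
    (fun m n τ hmn h p hp => hmn.trans_lt (h p hp)) (fun i n => by
      obtain ⟨y, hy, z, h1, h2, h3⟩ := exists_near_of_not_finiteDimensional hS Y hY n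
        (ε := 1 / 8 * (1 / 2) ^ (i : ℕ)) (by positivity)
      exact ⟨(y, z), ⟨hy, h2, h3⟩, h1⟩)
  refine ⟨fun i => (τ i).2, fun i => (τ i).1, ⟨fun i h => ?_, fun i j hij p hp q hq =>
    (le_maxSupp hp).trans_lt (hlt i j hij q hq)⟩, fun i => (hτ i).2.1, fun i => (hτ i).1,
    fun i => (hτ i).2.2⟩
  have := (hτ i).2.1
  rw [h, map_zero, norm_zero] at this
  exact zero_ne_one this

/-! ## Spreading models in subspaces -/

theorem coe_sup_nnnorm_le {E : Finset ℕ+} {a : ℕ+ → ℝ} {M : ℝ} (hM : 0 ≤ M)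
    (h : ∀ i ∈ E, |a i| ≤ M) : ((E.sup fun i => ‖a i‖₊ : NNReal) : ℝ) ≤ M := by
  lift M to NNReal using hM
  exact_mod_cast Finset.sup_le fun i hi => by
    rw [← NNReal.coe_le_coe, coe_nnnorm]
    exact h i hi

theorem abs_le_coe_sup_nnnorm {E : Finset ℕ+} (a : ℕ+ → ℝ) {i : ℕ+} (hi : i ∈ E) :
    |a i| ≤ ((E.sup fun i => ‖a i‖₊ : NNReal) : ℝ) := by
  rw [← Real.norm_eq_abs, ← coe_nnnorm, NNReal.coe_le_coe]
  exact Finset.le_sup (f := fun i => ‖a i‖₊) hi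

theorem exists_czero_spreadingModel (hS : IsIndecomposableFamily S A) (Y : Submodule ℝ (X01 S))
    (hY : ¬FiniteDimensional ℝ Y) :
    ∃ K ≥ 1, ∃ y : ℕ+ → X01 S, (∀ i, y i ∈ Y) ∧ IsCZeroSpreadingModel schreierOne K y := by
  have hreg := hS.regular_self
  obtain ⟨z, y, hz, hz1, hy, hyz⟩ := exists_blocks_near hreg Y hY
  obtain ⟨u, hu, hu1, hup⟩ := exists_czero_blocks hS hz hz1 one_pos
  have hub : IsBlocks u := hu.isBlocks hz fun j h => by
    have := hu1 j
    rw [h, map_zero, norm_zero] at this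
    exact zero_ne_one this
  obtain ⟨u', hu'Y, hu'⟩ := hu.exists_perturbation hreg hz hz1 hyz hu1 hy
  -- The `c₀`-constants `1` and `2` of the blocks are multiplied by the perturbation factors `3 / 4`
  -- and `5 / 4`.
  refine ⟨4, by norm_num, u', hu'Y, hu'.isBasicSeq hreg hub hu1, 4 / 3, by norm_num, 5 / 2,
    by norm_num, by norm_num, fun E hE a => ?_⟩
  obtain ⟨h1, h2⟩ := hu'.norm_le hreg hub hu1 E a
  have h3 := hup E hE a _ NNReal.zero_le_coe fun i hi => abs_le_coe_sup_nnnorm a hi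
  have h4 : ((E.sup fun i => ‖a i‖₊ : NNReal) : ℝ) ≤ ‖X01.ofFinsupp S (∑ i ∈ E, a i • u i)‖ :=
    coe_sup_nnnorm_le (norm_nonneg _) fun i hi => by
      have := abs_coeff_le hreg hub a hi
      rwa [hu1, mul_one] at this
  constructor <;> linarith

theorem exists_normalized_ellOne_blocks (hS : IsIndecomposableFamily S A) (hx : IsBlocks x)
    (hnorm : ∀ i, ‖X01.ofFinsupp S (x i)‖ = 1) :
    ∃ v, IsBlocksOver S x v ∧ (∀ j, ‖X01.ofFinsupp S (v j)‖ = 1) ∧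
      ∀ E ∈ S, ∀ a : ℕ+ → ℝ, 1 / 2 * ∑ i ∈ E, |a i| ≤ ‖X01.ofFinsupp S (∑ i ∈ E, a i • v i)‖ := by
  obtain ⟨v, hv, hv2, hlow⟩ := exists_ellOne_blocks hS hx hnorm one_pos le_rfl
  have hv1 : ∀ j, 1 ≤ ‖X01.ofFinsupp S (v j)‖ := fun j => by
    simpa using hlow {j} (hS.regular_self.singleton j) fun _ => 1
  have hpos : ∀ j, 0 < ‖X01.ofFinsupp S (v j)‖ := fun j => one_pos.trans_le (hv1 j)
  refine ⟨fun j => ‖X01.ofFinsupp S (v j)‖⁻¹ • v j, hv.smul _, fun j => ?_, fun E hE a => ?_⟩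
  · rw [map_smul, norm_smul, norm_inv, norm_norm, inv_mul_cancel₀ (hpos j).ne']
  · have h1 := hlow E hE fun i => a i * ‖X01.ofFinsupp S (v i)‖⁻¹
    simp only [mul_smul] at h1
    refine le_trans ?_ h1
    rw [Finset.mul_sum]
    refine Finset.sum_le_sum fun i _ => ?_
    rw [abs_mul, abs_inv, abs_norm, mul_comm]
    have h2 : (1 / 2 : ℝ) ≤ ‖X01.ofFinsupp S (v i)‖⁻¹ := by
      rw [one_div]
      have := hv2 i
      exact inv_anti₀ (hpos i) (by linarith)
    exact mul_le_mul_of_nonneg_left h2 (abs_nonneg _)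

theorem exists_ellOne_spreadingModel (hS : IsIndecomposableFamily S A) (Y : Submodule ℝ (X01 S))
    (hY : ¬FiniteDimensional ℝ Y) :
    ∃ K ≥ 1, ∃ y : ℕ+ → X01 S, (∀ i, y i ∈ Y) ∧ IsEllOneSpreadingModel S K y := by
  have hreg := hS.regular_self
  obtain ⟨z, y, hz, hz1, hy, hyz⟩ := exists_blocks_near hreg Y hY
  obtain ⟨u, hu, hu1, hlow⟩ := exists_normalized_ellOne_blocks hS hz hz1
  have hub : IsBlocks u := hu.isBlocks hz fun j h => by
    have := hu1 j
    rw [h, map_zero, norm_zero] at this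
    exact zero_ne_one this
  obtain ⟨u', hu'Y, hu'⟩ := hu.exists_perturbation hreg hz hz1 hyz hu1 hy
  refine ⟨4, by norm_num, u', hu'Y, hu'.isBasicSeq hreg hub hu1, 8 / 3, by norm_num, 5 / 4,
    by norm_num, by norm_num, fun E hE a => ?_⟩
  obtain ⟨h1, h2⟩ := hu'.norm_le hreg hub hu1 E a
  have h3 := hlow E hE a
  have h4 := norm_sum_smul_le (S := S) E a fun i => (hu1 i).le
  constructor <;> linarith

end

section

/-! ## Reflexivity -/

variable {S : Set (Finset ℕ+)} {A : ℕ+ → Set (Finset ℕ+)} {x : ℕ+ → ℕ+ →₀ ℝ}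

/-- The vector with the coordinates `c i`, `i ≤ n`. -/
def truncation (c : ℕ+ → ℝ) (n : ℕ+) : ℕ+ →₀ ℝ :=
  Finsupp.onFinset (Finset.Icc 1 n) (fun i => if i ≤ n then c i else 0) fun i h => by
    by_contra h'
    exact h (if_neg fun h'' => h' (Finset.mem_Icc.2 ⟨one_le, h''⟩))

theorem truncation_apply (c : ℕ+ → ℝ) (n i : ℕ+) :
    truncation c n i = if i ≤ n then c i else 0 := rfl

theorem truncation_sub_apply (c : ℕ+ → ℝ) {m n : ℕ+} (hmn : m ≤ n) (i : ℕ+) :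
    (truncation c n - truncation c m) i = if m < i ∧ i ≤ n then c i else 0 := by
  rw [Finsupp.sub_apply, truncation_apply, truncation_apply]
  by_cases h1 : i ≤ m
  · simp [h1, h1.trans hmn, not_lt.2 h1]
  · simp [h1, not_le.1 h1]

/-- Bounded truncations converge. -/
theorem cauchySeq_truncation (hS : IsIndecomposableFamily S A) (c : ℕ+ → ℝ) {C : ℝ}
    (hC : ∀ n, ‖X01.ofFinsupp S (truncation c n)‖ ≤ C) :
    CauchySeq fun n => X01.ofFinsupp S (truncation c n) := by
  classical
  rw [Metric.cauchySeq_iff']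
  by_contra! hcon
  obtain ⟨ε, hε, hcon⟩ := hcon
  -- If the truncations are not Cauchy, their differences over successive intervals contain blocks
  -- of norm at least `ε`. By unconditionality all finite sums of these blocks have norm at most
  -- `C`.
  obtain ⟨τ, hτ, hlt⟩ := exists_seq (T := ℕ+ × ℕ+)
    (fun _ τ => τ.1 ≤ τ.2 ∧ ε ≤ ‖X01.ofFinsupp S (truncation c τ.2 - truncation c τ.1)‖)
    (fun m τ => m ≤ τ.1) (fun τ => τ.2) (fun m n τ hmn h => hmn.trans h) (fun _ N => by
      obtain ⟨n, hn, h⟩ := hcon N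
      rw [dist_eq_norm, ← map_sub] at h
      exact ⟨(N, n), ⟨hn, h⟩, le_refl N⟩)
  set x : ℕ+ → ℕ+ →₀ ℝ := fun i => truncation c (τ i).2 - truncation c (τ i).1 with hx
  have hsupp : ∀ i, ∀ p ∈ (x i).support, (τ i).1 < p ∧ p ≤ (τ i).2 := fun i p hp => by
    by_contra h
    rw [Finsupp.mem_support_iff, hx, truncation_sub_apply c (hτ i).1, if_neg h] at hp
    exact hp rfl
  have hxb : IsBlocks x := by
    refine ⟨fun i h => ?_, fun i j hij p hp q hq => ?_⟩
    · have := (hτ i).2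
      change ε ≤ ‖X01.ofFinsupp S (x i)‖ at this
      rw [h, map_zero, norm_zero] at this
      linarith
    · exact (hsupp i p hp).2.trans_lt ((hlt i j hij).trans_lt (hsupp j q hq).1)
  have hup : ∀ F : Finset ℕ+, ‖X01.ofFinsupp S (∑ j ∈ F, x j)‖ ≤ C := by
    intro F
    have heq : ∑ j ∈ F, x j =
        (truncation c (F.sup fun j => (τ j).2)).filter fun p => ∃ j ∈ F, (τ j).1 < p ∧ p ≤ (τ j).2 := by
      ext p
      rw [Finsupp.filter_apply, Finsupp.finsetSum_apply]
      split_ifs with h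
      · obtain ⟨j, hj, hp⟩ := h
        rw [Finset.sum_eq_single_of_mem j hj fun k _ hkj => ?_, hx, truncation_sub_apply c (hτ j).1,
          if_pos hp, truncation_apply, if_pos (hp.2.trans (Finset.le_sup (f := fun j => (τ j).2) hj))]
        rw [hx, truncation_sub_apply c (hτ k).1, if_neg]
        rintro ⟨h1, h2⟩
        rcases lt_or_gt_of_ne hkj with h | h
        · exact absurd (h2.trans (hlt k j h)) (not_le.2 hp.1)
        · exact absurd (hp.2.trans (hlt j k h)) (not_le.2 h1)
      · push Not at h
        exact Finset.sum_eq_zero fun j hj => by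
          rw [hx, truncation_sub_apply c (hτ j).1, if_neg fun h' => absurd h'.2 (not_le.2 (h j hj h'.1))]
    rw [heq]
    exact (X01.norm_filter_le hS.regular_self _ _).trans (hC _)
  obtain ⟨B, -, -, hBlt, hBcard⟩ := exists_successive_schreierOne 1
  obtain ⟨g, hg, hlow⟩ := exists_ellOne_of_averages hS hxb (c := ε / 2) (by positivity)
    (fun i => (half_lt_self hε).trans_le (hτ i).2) hBlt fun k => (hBcard k).ge
  obtain ⟨l, hl⟩ := hS.schreierOne_subset
  -- Adding `K` long sums gives norm at least `K * (ε / 2) > C`, although this is again a finite sum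
  -- of the blocks.
  obtain ⟨K, hK⟩ := exists_pnat_gt (C / (ε / 2))
  have hE := hl _ (Ico_mem_schreierOne (le_max_left K l)) fun i hi =>
    (le_max_right K l).trans (Finset.mem_Ico.1 hi).1
  have h1 := hlow _ hE fun _ => 1
  have hBg : ∀ i ∈ ((Finset.Ico (max K l) (max K l + K) : Finset ℕ+) : Set ℕ+),
      ∀ j ∈ ((Finset.Ico (max K l) (max K l + K) : Finset ℕ+) : Set ℕ+), i < j →
      FinsetBefore (B (g i)) (B (g j)) := fun i _ j _ hij => hBlt _ _ (hg hij)
  have h2 := (exists_glue hBg fun _ _ => (0 : ℝ)).1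
  simp only [abs_one, one_smul, Finset.sum_const, card_Ico_pnat, nsmul_eq_mul, mul_one] at h1
  rw [← Finset.sum_biUnion h2] at h1
  have h3 := hup ((Finset.Ico (max K l) (max K l + K)).biUnion fun i => B (g i))
  rw [div_lt_iff₀ (by positivity)] at hK
  linarith

/-- Functionals are small on vectors that are supported far out. -/
theorem exists_abs_functional_le (hS : IsIndecomposableFamily S A) (f : StrongDual ℝ (X01 S))
    {ε : ℝ} (hε : 0 < ε) : ∃ N : ℕ+, ∀ z : ℕ+ →₀ ℝ, (∀ p ∈ z.support, N < p) →
      |f (X01.ofFinsupp S z)| ≤ ε * ‖X01.ofFinsupp S z‖ := by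
  by_contra! hcon
  obtain ⟨x, hx, hlt⟩ := exists_seq (T := ℕ+ →₀ ℝ)
    (fun _ z => z ≠ 0 ∧ ‖X01.ofFinsupp S z‖ = 1 ∧ ε ≤ f (X01.ofFinsupp S z))
    (fun m z => ∀ p ∈ z.support, m < p) maxSupp (fun m n z hmn h p hp => hmn.trans_lt (h p hp))
    (fun _ N => by
      obtain ⟨z, hz, h⟩ := hcon N
      have hz0 : z ≠ 0 := by
        rintro rfl
        simp at h
      have hpos := norm_ofFinsupp_pos (S := S) hz0
      -- The sign `s` turns the bound on the modulus into a lower bound for `f`, as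
      -- `not_forall_le_functional` requires.
      have key : ∀ s : ℝ, |s| = 1 → s * f (X01.ofFinsupp S z) = |f (X01.ofFinsupp S z)| →
          ∃ z : ℕ+ →₀ ℝ, (z ≠ 0 ∧ ‖X01.ofFinsupp S z‖ = 1 ∧ ε ≤ f (X01.ofFinsupp S z)) ∧
            ∀ p ∈ z.support, N < p := fun s hs hsf => by
        have hs0 : s ≠ 0 := by
          rintro rfl
          simp at hs
        refine ⟨(s * ‖X01.ofFinsupp S z‖⁻¹) • z,
          ⟨smul_ne_zero (mul_ne_zero hs0 (inv_ne_zero hpos.ne')) hz0, ?_, ?_⟩,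
          fun p hp => hz p (Finsupp.support_smul hp)⟩
        · rw [map_smul, norm_smul, norm_mul, Real.norm_eq_abs, hs, norm_inv, norm_norm, one_mul,
            inv_mul_cancel₀ hpos.ne']
        · rw [map_smul, map_smul, smul_eq_mul, mul_right_comm, hsf, ← div_eq_mul_inv,
            le_div_iff₀ hpos]
          exact h.le
      rcases le_total 0 (f (X01.ofFinsupp S z)) with h0 | h0
      · exact key 1 abs_one (by rw [abs_of_nonneg h0, one_mul])
      · exact key (-1) (by simp) (by rw [abs_of_nonpos h0, neg_one_mul]))
  exact not_forall_le_functional hS ⟨fun i => (hx i).1, fun i j hij p hp q hq =>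
    (le_maxSupp hp).trans_lt (hlt i j hij q hq)⟩ (fun i => (hx i).2.1) f hε fun i => (hx i).2.2

/-- The values of `Φ` on the coordinate functionals are the candidate coordinates. Their truncations
are bounded by `‖Φ‖`, hence converge to some `x`. The functionals `T f n`, which are `f` composed
with the first `n` coordinates, tend to `f` in norm by the shrinking property, and this identifies
`Φ f` with `f x`. -/
theorem X01.isReflexiveSpace (hS : IsIndecomposableFamily S A) : IsReflexiveSpace (X01 S) := by
  classical
  intro Φ
  have hreg := hS.regular_self
  set c : ℕ+ → ℝ := fun i => Φ (X01.coord S i) with hc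
  set T : StrongDual ℝ (X01 S) → ℕ+ → StrongDual ℝ (X01 S) :=
    fun f n => ∑ i ∈ Finset.Icc 1 n, f (X01.e S i) • X01.coord S i with hT
  have hTapply : ∀ f n y, T f n y = f (X01.restrict S 1 n y) := fun f n y => by
    simp only [hT, X01.restrict, map_sum, map_smul, sum_apply,
      smul_apply, smul_eq_mul]
    exact Finset.sum_congr rfl fun i _ => mul_comm _ _
  have hTnorm : ∀ f n, ‖T f n‖ ≤ ‖f‖ := fun f n =>
    ContinuousLinearMap.opNorm_le_bound _ (norm_nonneg _) fun y => by
      rw [hTapply]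
      exact (f.le_opNorm _).trans
        (mul_le_mul_of_nonneg_left (X01.norm_restrict_le hreg 1 n y) (norm_nonneg _))
  have hJ : ∀ n, X01.ofFinsupp S (truncation c n) = ∑ i ∈ Finset.Icc 1 n, c i • X01.e S i := by
    intro n
    simp only [X01.e_eq, ← map_smul, ← map_sum]
    congr 1
    ext p
    simp only [truncation_apply, Finsupp.finsetSum_apply, Finsupp.smul_apply, smul_eq_mul,
      Finsupp.single_apply, mul_ite, mul_one, mul_zero, Finset.sum_ite_eq', Finset.mem_Icc,
      one_le, true_and]
  have hΦT : ∀ f n, Φ (T f n) = f (X01.ofFinsupp S (truncation c n)) := fun f n => by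
    rw [hJ, hT, map_sum, map_sum]
    exact Finset.sum_congr rfl fun i _ => by
      rw [map_smul, map_smul, smul_eq_mul, smul_eq_mul, mul_comm]
  have hbdd : ∀ n, ‖X01.ofFinsupp S (truncation c n)‖ ≤ ‖Φ‖ := fun n =>
    NormedSpace.norm_le_dual_bound ℝ _ (norm_nonneg Φ) fun f => by
      rw [← hΦT]
      exact (Φ.le_opNorm _).trans (mul_le_mul_of_nonneg_left (hTnorm f n) (norm_nonneg _))
  obtain ⟨x, hx⟩ := cauchySeq_tendsto_of_complete (cauchySeq_truncation hS c hbdd)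
  refine ⟨x, ?_⟩
  ext f
  rw [NormedSpace.dual_def]
  have h1 : Filter.Tendsto (fun n => f (X01.ofFinsupp S (truncation c n))) Filter.atTop
      (nhds (f x)) := (f.continuous.tendsto x).comp hx
  refine tendsto_nhds_unique h1 ?_
  simp only [← hΦT]
  refine (Φ.continuous.tendsto f).comp ?_
  rw [Metric.tendsto_atTop]
  intro ε hε
  obtain ⟨N, hN⟩ := exists_abs_functional_le hS f (half_pos hε)
  refine ⟨N, fun n hn => ?_⟩
  rw [dist_comm, dist_eq_norm]
  refine lt_of_le_of_lt (ContinuousLinearMap.opNorm_le_bound _ (half_pos hε).le fun y => ?_)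
    (half_lt_self hε)
  rw [sub_apply]
  refine X01.denseRange_ofFinsupp.induction_on (p := fun y => ‖f y - T f n y‖ ≤ ε / 2 * ‖y‖) y
    (isClosed_le (by fun_prop) (by fun_prop)) fun y => ?_
  have hz : X01.ofFinsupp S y - X01.restrict S 1 n (X01.ofFinsupp S y) =
      X01.ofFinsupp S (y.filter fun i => n < i) := by
    rw [X01.restrict_ofFinsupp, ← map_sub]
    congr 1
    ext i
    simp only [Finsupp.sub_apply, Finsupp.filter_apply, one_le, true_and]
    by_cases h : n < i
    · simp [h, not_le.2 h]
    · simp [h, not_lt.1 h]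
  rw [hTapply, ← map_sub, hz, Real.norm_eq_abs]
  refine (hN _ fun p hp => ?_).trans
    (mul_le_mul_of_nonneg_left ?_ (half_pos hε).le)
  · rw [Finsupp.support_filter] at hp
    exact hn.trans_lt (Finset.mem_filter.1 hp).2
  · exact X01.norm_filter_le hreg _ y

end

section

/-! ## Block sequences of the unit vector basis -/

section BlockSeq

variable {X : Type*} [NormedAddCommGroup X] [NormedSpace ℝ X]

theorem IsBlockSeq.of_coeff {e y : ℕ+ → X} {B : ℕ+ → Finset ℕ+} {a : ℕ+ → ℕ+ → ℝ}
    (hB : ∀ i j, i < j → FinsetBefore (B i) (B j)) (hy : ∀ i, y i = ∑ j ∈ B i, a i j • e j)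
    (h0 : ∀ i, y i ≠ 0) : IsBlockSeq e y := by
  obtain ⟨-, a', ha'⟩ := exists_glue (E := Set.univ) (fun i _ j _ => hB i j) a
  refine ⟨B, a', hB, fun i => ⟨?_, h0 i⟩⟩
  rw [hy]
  exact Finset.sum_congr rfl fun j hj => by rw [ha' i (Set.mem_univ i) j hj]

theorem IsBlockSeq.trans {e x y : ℕ+ → X} (hx : IsBlockSeq e x) (hy : IsBlockSeq x y) :
    IsBlockSeq e y := by
  obtain ⟨G, b, hG, hxb⟩ := hx
  obtain ⟨E, a, hE, hya⟩ := hy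
  have hex : ∀ i, ∃ w : ℕ+ → ℝ, ∑ k ∈ (E i).biUnion G, w k • e k = y i := fun i => by
    obtain ⟨w, -, hw⟩ := exists_glue_smul (E := E i) (F := G) (fun i _ j _ => hG i j) a
      (fun _ => b) e
    refine ⟨w, hw.trans ?_⟩
    rw [(hya i).1]
    exact Finset.sum_congr rfl fun j _ => by rw [(hxb j).1]
  choose w hw using hex
  refine IsBlockSeq.of_coeff (B := fun i => (E i).biUnion G) (fun i j hij p hp q hq => ?_)
    (fun i => (hw i).symm) fun i => (hya i).2
  obtain ⟨k, hk, hp⟩ := Finset.mem_biUnion.1 hp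
  obtain ⟨l, hl, hq⟩ := Finset.mem_biUnion.1 hq
  exact hG k l (hE i j hij k hk l hl) p hp q hq

theorem le_of_mem_successive {B : ℕ+ → Finset ℕ+} (hB : ∀ i j, i < j → FinsetBefore (B i) (B j))
    (hne : ∀ i, (B i).Nonempty) {j p : ℕ+} (hp : p ∈ B j) : j ≤ p := by
  have hmono : StrictMono fun i => (B i).min' (hne i) := fun i k hik =>
    hB i k hik _ (Finset.min'_mem _ _) _ (Finset.min'_mem _ _)
  exact hmono.le_apply.trans (Finset.min'_le _ _ hp)

end BlockSeq

theorem biUnion_mem_familyComp {κ : Type*} [LinearOrder κ] {G : Set (Finset ℕ+)} {D : Finset κ}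
    {B : κ → Finset ℕ+} (hG : ∀ i ∈ D, B i ∈ G)
    (hlt : ∀ i ∈ D, ∀ j ∈ D, i < j → FinsetBefore (B i) (B j))
    (hD : ∀ i ∈ D, ∀ n ∈ B i, D.card ≤ (n : ℕ)) : D.biUnion B ∈ familyComp schreierOne G := by
  classical
  have hmem := fun q => D.orderEmbOfFin_mem rfl q
  have := familyComp_schreierOne_mk (fun q => B (D.orderEmbOfFin rfl q)) (fun q => hG _ (hmem q))
    (fun q r hqr => hlt _ (hmem q) _ (hmem r) ((D.orderEmbOfFin rfl).strictMono hqr))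
    fun q => hD _ (hmem q)
  convert this using 1
  ext p
  simp only [Finset.mem_biUnion, Finset.mem_univ, true_and]
  constructor
  · rintro ⟨i, hi, hp⟩
    have : i ∈ Set.range (D.orderEmbOfFin rfl) := by rw [Finset.range_orderEmbOfFin]; exact hi
    obtain ⟨q, rfl⟩ := this
    exact ⟨q, hp⟩
  · rintro ⟨q, hp⟩
    exact ⟨_, hmem q, hp⟩

variable {S : Set (Finset ℕ+)} {A : ℕ+ → Set (Finset ℕ+)} {x : ℕ+ → ℕ+ →₀ ℝ}

theorem IsBlockSeq.exists_isBlocks {X : ℕ+ → X01 S} (h : IsBlockSeq (X01.e S) X) :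
    ∃ x, IsBlocks x ∧ X = fun i => X01.ofFinsupp S (x i) := by
  obtain ⟨E, a, hE, ha⟩ := h
  have heq : X = fun i => X01.ofFinsupp S (∑ j ∈ E i, Finsupp.single j (a j)) := by
    ext1 i
    rw [(ha i).1, map_sum]
    exact Finset.sum_congr rfl fun j _ => by
      rw [X01.e_eq, ← map_smul, Finsupp.smul_single, smul_eq_mul, mul_one]
  refine ⟨_, ⟨fun i h0 => (ha i).2 ?_, fun i j hij => (hE i j hij).mono ?_ ?_⟩, heq⟩
  · rw [heq]
    simp only [h0, map_zero]
  all_goals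
    intro p hp
    obtain ⟨k, hk, hp⟩ := Finset.mem_biUnion.1 (Finsupp.support_finsetSum hp)
    rwa [Finset.mem_singleton.1 (Finsupp.support_single_subset hp)]

/-! ## The norms `|·|_n` -/

namespace X01

theorem exists_norm_sub_restrict_lt (hS : IsRegularFamily S) (x : X01 S) {ε : ℝ} (hε : 0 < ε) :
    ∃ M, ‖x - restrict S 1 M x‖ < ε := by
  obtain ⟨y, hy⟩ := exists_ofFinsupp_near x (half_pos hε)
  refine ⟨maxSupp y, ?_⟩
  have hr : restrict S 1 (maxSupp y) (ofFinsupp S y) = ofFinsupp S y := by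
    rw [restrict_ofFinsupp]
    congr 1
    exact Finsupp.filter_eq_self_iff _ _ |>.2 fun i hi =>
      ⟨one_le, le_maxSupp (Finsupp.mem_support_iff.2 hi)⟩
  have heq : x - restrict S 1 (maxSupp y) x =
      (x - ofFinsupp S y) - restrict S 1 (maxSupp y) (x - ofFinsupp S y) := by
    rw [restrict_sub, hr]
    abel
  rw [heq]
  have h1 := norm_sub_le (x - ofFinsupp S y) (restrict S 1 (maxSupp y) (x - ofFinsupp S y))
  have h2 := norm_restrict_le hS 1 (maxSupp y) (x - ofFinsupp S y)
  linarith

theorem intervalSums_le (hS : IsRegularFamily S) {n : ℕ} {x : X01 S} {r : ℝ}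
    (hr : r ∈ intervalSums S n x) : r ≤ n * ‖x‖ := by
  obtain ⟨a, b, -, -, rfl⟩ := hr
  calc _ ≤ ∑ _q : Fin n, ‖x‖ := Finset.sum_le_sum fun q _ => norm_restrict_le hS _ _ x
    _ = n * ‖x‖ := by simp

theorem intervalSums_nonempty (n : ℕ) (x : X01 S) : (intervalSums S n x).Nonempty :=
  ⟨_, fun q => (q : ℕ).succPNat, fun q => (q : ℕ).succPNat, fun _ => le_rfl,
    fun _ _ hqr => Nat.succPNat_strictMono hqr, rfl⟩

theorem exists_intervalSeminorm (hS : IsRegularFamily S) (n : ℕ) :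
    ∃ p : Seminorm ℝ (X01 S), ∀ x, IsLUB (intervalSums S n x) (p x) := by
  have hlub : ∀ x : X01 S, IsLUB (intervalSums S n x) (sSup (intervalSums S n x)) := fun x =>
    isLUB_csSup (intervalSums_nonempty n x) ⟨_, fun r hr => intervalSums_le hS hr⟩
  refine ⟨Seminorm.ofSMulLE (fun x => sSup (intervalSums S n x)) ?_ (fun x y => ?_)
    (fun c x => ?_), hlub⟩
  · refine le_antisymm ((hlub 0).2 fun r hr => ?_) ?_
    · simpa using intervalSums_le hS hr
    · obtain ⟨r, hr⟩ := intervalSums_nonempty n (0 : X01 S)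
      refine le_trans ?_ ((hlub 0).1 hr)
      obtain ⟨a, b, -, -, rfl⟩ := hr
      positivity
  · refine (hlub _).2 ?_
    rintro _ ⟨a, b, h1, h2, rfl⟩
    refine le_trans ?_ (add_le_add ((hlub x).1 ⟨a, b, h1, h2, rfl⟩) ((hlub y).1 ⟨a, b, h1, h2, rfl⟩))
    rw [← Finset.sum_add_distrib]
    exact Finset.sum_le_sum fun q _ => by
      rw [restrict_add]
      exact norm_add_le _ _
  · refine (hlub _).2 ?_
    rintro _ ⟨a, b, h1, h2, rfl⟩
    refine le_trans (le_of_eq ?_) (mul_le_mul_of_nonneg_left ((hlub x).1 ⟨a, b, h1, h2, rfl⟩)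
      (norm_nonneg c))
    rw [Finset.mul_sum]
    exact Finset.sum_congr rfl fun q _ => by rw [restrict_smul, norm_smul]

variable {n : ℕ} {p : X01 S → ℝ}

theorem norm_le_of_isLUB (hS : IsRegularFamily S) (hn : 1 ≤ n)
    (hp : ∀ x, IsLUB (intervalSums S n x) (p x)) (x : X01 S) : ‖x‖ ≤ p x := by
  refine le_of_forall_pos_le_add fun ε hε => ?_
  obtain ⟨M, hM⟩ := exists_norm_sub_restrict_lt hS x hε
  have h1 : ‖restrict S 1 M x‖ ≤ p x := by
    -- Exactly `n` intervals are required, so `[1, M]` is followed by singletons beyond `M`.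
    set c : ℕ → ℕ+ := fun q => if q = 0 then 1 else M + q.toPNat' with hc
    set d : ℕ → ℕ+ := fun q => if q = 0 then M else M + q.toPNat' with hd
    have hmem : ∑ q : Fin n, ‖restrict S (c q) (d q) x‖ ∈ intervalSums S n x := by
      refine ⟨fun q => c q, fun q => d q, fun q => ?_, fun q r hqr => ?_, rfl⟩
      · simp only [hc, hd]
        split_ifs
        · exact one_le
        · exact le_rfl
      · have hr : (r : ℕ) ≠ 0 := by omega
        have hr' : (((r : ℕ).toPNat' : ℕ+) : ℕ) = r := by
          rw [Nat.toPNat'_coe, if_pos (by omega)]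
        simp only [hc, hd, hr, if_false]
        split_ifs with hq
        · exact PNat.lt_add_right _ _
        · have hq' : (((q : ℕ).toPNat' : ℕ+) : ℕ) = q := by
            rw [Nat.toPNat'_coe, if_pos (by omega)]
          rw [← PNat.coe_lt_coe, PNat.add_coe, PNat.add_coe, hr', hq']
          omega
    have h0 : ‖restrict S 1 M x‖ ≤ ∑ q : Fin n, ‖restrict S (c q) (d q) x‖ := by
      have h := Finset.single_le_sum (f := fun q : Fin n => ‖restrict S (c q) (d q) x‖)
        (fun q _ => norm_nonneg _) (Finset.mem_univ (⟨0, hn⟩ : Fin n))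
      simpa only [hc, hd, if_true] using h
    exact h0.trans ((hp x).1 hmem)
  have h2 := norm_sub_norm_le x (restrict S 1 M x)
  linarith

theorem card_le_of_isLUB (hp : ∀ x, IsLUB (intervalSums S n x) (p x)) (hx : IsBlocks x)
    (hnorm : ∀ i, ‖ofFinsupp S (x i)‖ = 1) {D : Finset ℕ+} (hD : D.card = n) :
    (n : ℝ) ≤ p (ofFinsupp S (∑ i ∈ D, x i)) := by
  have hr : ∀ k ∈ D, restrict S (minSupp (x k)) (maxSupp (x k)) (ofFinsupp S (∑ i ∈ D, x i)) =
      ofFinsupp S (x k) := by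
    intro k hk
    rw [restrict_ofFinsupp]
    congr 1
    ext m
    rw [Finsupp.filter_apply, Finsupp.finsetSum_apply]
    split_ifs with hm
    · refine Finset.sum_eq_single_of_mem k hk fun i _ hik => ?_
      by_contra h
      have hmi := Finsupp.mem_support_iff.2 h
      rcases lt_or_gt_of_ne hik with h | h
      · exact absurd hm.1 (not_le.2 (hx.lt i k h m hmi _ (minSupp_mem (hx.ne_zero k))))
      · exact absurd hm.2 (not_le.2 (hx.lt k i h _ (maxSupp_mem (hx.ne_zero k)) m hmi))
    · by_contra h
      have hmk := Finsupp.mem_support_iff.2 (Ne.symm h)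
      exact hm ⟨minSupp_le hmk, le_maxSupp hmk⟩
  refine le_of_eq_of_le ?_ ((hp _).1 ⟨fun q => minSupp (x (D.orderEmbOfFin hD q)),
    fun q => maxSupp (x (D.orderEmbOfFin hD q)), fun q => minSupp_le_maxSupp (hx.ne_zero _),
    fun q r hqr => hx.lt _ _ ((D.orderEmbOfFin hD).strictMono hqr) _ (maxSupp_mem (hx.ne_zero _)) _
      (minSupp_mem (hx.ne_zero _)), rfl⟩)
  simp only [hr _ (D.orderEmbOfFin_mem hD _), hnorm]
  simp

/-- If `n` intervals and the blocks with indices in `D` are given, at most `|D| + n` pairs of an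
interval and a block meet. -/
theorem card_meeting_le (hx : IsBlocks x) (D : Finset ℕ+) {a b : Fin n → ℕ+}
    (hab : ∀ q r, q < r → b q < a r) (P : Finset (Fin n × ℕ+)) (hPD : ∀ π ∈ P, π.2 ∈ D)
    (hP : ∀ π ∈ P, ∃ m ∈ (x π.2).support, a π.1 ≤ m ∧ m ≤ b π.1) : P.card ≤ D.card + n := by
  classical
  -- A pair whose interval is the first to meet its block is determined by the block. For any other
  -- pair the block reaches back to an earlier interval, so it is the first block met by the
  -- interval and is determined by it.
  rw [← Finset.card_filter_add_card_filter_not (s := P) fun π => ∀ q < π.1, (q, π.2) ∉ P]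
  refine add_le_add ?_ ?_
  · refine Finset.card_le_card_of_injOn Prod.snd (fun π hπ => hPD π (Finset.mem_filter.1 hπ).1) ?_
    intro π hπ ρ hρ h
    obtain ⟨hπ1, hπ2⟩ := Finset.mem_filter.1 hπ
    obtain ⟨hρ1, hρ2⟩ := Finset.mem_filter.1 hρ
    rcases lt_trichotomy π.1 ρ.1 with h' | h' | h'
    · exact absurd hπ1 (by rw [show π = (π.1, ρ.2) from Prod.ext rfl h]; exact hρ2 _ h')
    · exact Prod.ext h' h
    · exact absurd hρ1 (by rw [show ρ = (ρ.1, π.2) from Prod.ext rfl h.symm]; exact hπ2 _ h')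
  · refine le_of_le_of_eq ?_ (Finset.card_fin n)
    refine Finset.card_le_card_of_injOn Prod.fst (fun π _ => Finset.mem_univ _) ?_
    have key : ∀ π ∈ P, ∀ ρ ∈ P, (∃ q < ρ.1, (q, ρ.2) ∈ P) → π.1 = ρ.1 → ¬π.2 < ρ.2 := by
      intro π hπ ρ hρ ⟨q, hq, hqP⟩ h hlt
      obtain ⟨m, hm, hm1, -⟩ := hP π hπ
      obtain ⟨m', hm', -, hm'2⟩ := hP _ hqP
      have h1 := hx.lt _ _ hlt m hm m' hm'
      have h2 := hab q ρ.1 hq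
      rw [h] at hm1
      exact absurd (h1.trans_le hm'2) (not_lt.2 (h2.le.trans hm1))
    intro π hπ ρ hρ h
    obtain ⟨hπ1, hπ2⟩ := Finset.mem_filter.1 hπ
    obtain ⟨hρ1, hρ2⟩ := Finset.mem_filter.1 hρ
    push Not at hπ2 hρ2
    refine Prod.ext h (le_antisymm ?_ ?_)
    · exact not_lt.1 (key ρ hρ1 π hπ1 hπ2 h.symm)
    · exact not_lt.1 (key π hπ1 ρ hρ1 hρ2 h)

theorem isLUB_le_of_norm_le (hS : IsRegularFamily S)
    (hp : ∀ x, IsLUB (intervalSums S n x) (p x)) (hx : IsBlocks x)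
    {C : ℝ} (hC : ∀ i, ‖ofFinsupp S (x i)‖ ≤ C) (D : Finset ℕ+) :
    p (ofFinsupp S (∑ i ∈ D, x i)) ≤ (D.card + n) * C := by
  classical
  have hC0 : 0 ≤ C := (norm_nonneg _).trans (hC 1)
  refine (hp _).2 ?_
  rintro _ ⟨a, b, -, hab, rfl⟩
  set P : Finset (Fin n × ℕ+) := (Finset.univ ×ˢ D).filter fun π =>
    ∃ m ∈ (x π.2).support, a π.1 ≤ m ∧ m ≤ b π.1 with hP
  have hcard : P.card ≤ D.card + n := card_meeting_le hx D hab P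
    (fun π hπ => (Finset.mem_product.1 (Finset.mem_filter.1 hπ).1).2)
    fun π hπ => (Finset.mem_filter.1 hπ).2
  calc ∑ q, ‖restrict S (a q) (b q) (ofFinsupp S (∑ i ∈ D, x i))‖
      ≤ ∑ q, ∑ i ∈ D, ‖restrict S (a q) (b q) (ofFinsupp S (x i))‖ :=
        Finset.sum_le_sum fun q _ => by
          have : restrict S (a q) (b q) (ofFinsupp S (∑ i ∈ D, x i)) =
              ∑ i ∈ D, restrict S (a q) (b q) (ofFinsupp S (x i)) := by
            simp only [restrict_ofFinsupp, ← map_sum]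
            rw [Finsupp.filter_sum]
          rw [this]
          exact norm_sum_le _ _
    _ = ∑ π ∈ Finset.univ ×ˢ D, ‖restrict S (a π.1) (b π.1) (ofFinsupp S (x π.2))‖ := by
        rw [Finset.sum_product]
    _ = ∑ π ∈ P, ‖restrict S (a π.1) (b π.1) (ofFinsupp S (x π.2))‖ := by
        refine (Finset.sum_subset (Finset.filter_subset _ _) fun π hπ hπP => ?_).symm
        have h0 : (x π.2).filter (fun i => a π.1 ≤ i ∧ i ≤ b π.1) = 0 := by
          refine (Finsupp.filter_eq_zero_iff _ _).2 fun m hm => ?_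
          by_contra h
          exact hπP (Finset.mem_filter.2 ⟨hπ, m, Finsupp.mem_support_iff.2 h, hm⟩)
        rw [restrict_ofFinsupp, h0, map_zero, norm_zero]
    _ ≤ ∑ _π ∈ P, C := Finset.sum_le_sum fun π _ =>
        (norm_restrict_le hS (a π.1) (b π.1) (ofFinsupp S (x π.2))).trans (hC π.2)
    _ = P.card * C := by rw [Finset.sum_const, nsmul_eq_mul]
    _ ≤ (D.card + n) * C := mul_le_mul_of_nonneg_right (by exact_mod_cast hcard) hC0

end X01

end

/-! ### Distortion by the norms `|·|_n` -/

section

variable {S : Set (Finset ℕ+)} {A : ℕ+ → Set (Finset ℕ+)} {x : ℕ+ → ℕ+ →₀ ℝ}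

theorem IsBlocks.normalize (hx : IsBlocks x) :
    IsBlocks (fun i => ‖X01.ofFinsupp S (x i)‖⁻¹ • x i) ∧
      ∀ i, ‖X01.ofFinsupp S (‖X01.ofFinsupp S (x i)‖⁻¹ • x i)‖ = 1 :=
  ⟨hx.smul fun i => inv_ne_zero (norm_ofFinsupp_pos (hx.ne_zero i)).ne', fun i => by
    rw [map_smul, norm_smul, norm_inv, norm_norm,
      inv_mul_cancel₀ (norm_ofFinsupp_pos (hx.ne_zero i)).ne']⟩

/-- The three factors `1 + ε` come from the norm of the `c₀`-sum, the norms of the `ℓ₁`-blocks, and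
the `n` additional meetings of intervals and blocks. -/
theorem sub_lt_div_one_add_pow {n δ ε : ℝ} (hn : 0 < n) (hε : 0 < ε)
    (h : 3 * ε * n < δ) : n - δ < n / (1 + ε) ^ 3 := by
  rw [lt_div_iff₀ (by positivity)]
  have h1 : n - δ < n * (1 - 3 * ε) := by linarith
  have h2 : (1 - 3 * ε) * (1 + ε) ^ 3 ≤ 1 := by
    have : 0 ≤ 6 * ε ^ 2 + 8 * ε ^ 3 + 3 * ε ^ 4 := by positivity
    nlinarith
  calc (n - δ) * (1 + ε) ^ 3 < n * (1 - 3 * ε) * (1 + ε) ^ 3 :=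
        mul_lt_mul_of_pos_right h1 (by positivity)
    _ = n * ((1 - 3 * ε) * (1 + ε) ^ 3) := by ring
    _ ≤ n * 1 := mul_le_mul_of_nonneg_left h2 hn.le
    _ = n := mul_one n

theorem nonempty_of_blocksOver {B : ℕ+ → Finset ℕ+} {a : ℕ+ → ℕ+ → ℝ} {u : ℕ+ → ℕ+ →₀ ℝ}
    (hu : ∀ j, u j = ∑ i ∈ B j, a j i • x i) (h0 : ∀ j, u j ≠ 0) (j : ℕ+) : (B j).Nonempty := by
  rw [Finset.nonempty_iff_ne_empty]
  intro h
  exact h0 j (by rw [hu, h, Finset.sum_empty])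

/-- `|·|_n` distorts by almost `n`, uniformly on the members of `𝓢₁[S]`. -/
theorem isDistortion_intervalSums (hS : IsIndecomposableFamily S A) {n : ℕ} (hn : 1 ≤ n) {δ : ℝ}
    (hδ : 0 < δ) {p : Seminorm ℝ (X01 S)} (hp : ∀ x, IsLUB (X01.intervalSums S n x) (p x)) :
    IsDistortion (familyComp schreierOne S) ((n : ℝ) - δ) (X01.e S) p := by
  classical
  have hreg := hS.regular_self
  have hpn := X01.norm_le_of_isLUB hreg hn hp
  have hn0 : (0 : ℝ) < n := by exact_mod_cast hn
  refine ⟨⟨1, one_pos, n, hn0, fun x => ⟨by rw [one_mul]; exact hpn x,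
    (hp x).2 fun r hr => X01.intervalSums_le hreg hr⟩⟩, fun X hX hX1 => ?_⟩
  obtain ⟨x, hx, rfl⟩ := hX.exists_isBlocks
  -- With `ε = 1 / K` and `N = n * K` below, the count `N + n` equals `(1 + ε) * N` exactly.
  obtain ⟨K, hK⟩ := exists_pnat_gt (3 * n / δ)
  have hK0 : (0 : ℝ) < (K : ℕ) := by exact_mod_cast K.pos
  have hK1 : (1 : ℝ) ≤ (K : ℕ) := by exact_mod_cast K.pos
  set ε : ℝ := ((K : ℕ) : ℝ)⁻¹ with hε
  have hε0 : 0 < ε := by positivity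
  obtain ⟨u, ⟨Bu, au, hBuS, hBu, hu⟩, hu1, hup⟩ := exists_czero_blocks hS hx hX1 hε0
  obtain ⟨v, ⟨Bv, av, hBvS, hBv, hv⟩, hv1, hlow⟩ := exists_ellOne_blocks hS hx hX1 hε0
    (inv_le_one_of_one_le₀ hK1)
  have hv2 : ∀ j, 1 ≤ ‖X01.ofFinsupp S (v j)‖ := fun j => by
    simpa using hlow {j} (hreg.singleton j) fun _ => 1
  have hu0 : ∀ j, u j ≠ 0 := fun j h => by
    have := hu1 j
    rw [h, map_zero, norm_zero] at this
    exact zero_ne_one this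
  have hv0 : ∀ j, v j ≠ 0 := fun j h => by
    have := hv2 j
    rw [h, map_zero, norm_zero] at this
    linarith
  have hub : IsBlocks u := IsBlocksOver.isBlocks hx ⟨Bu, au, hBuS, hBu, hu⟩ hu0
  have hvb : IsBlocks v := IsBlocksOver.isBlocks hx ⟨Bv, av, hBvS, hBv, hv⟩ hv0
  obtain ⟨ν, rfl⟩ : ∃ ν : ℕ+, n = ν := ⟨⟨n, hn⟩, rfl⟩
  set N : ℕ+ := ν * K with hN
  -- `L` is the total number of blocks used for both vectors. All indices start at `L`, so the union
  -- of the sets from `S` belongs to `𝓢₁[S]`.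
  set L : ℕ+ := ν + N with hL
  set Du := Finset.Ico L (L + ν) with hDu
  obtain ⟨l, hl⟩ := hS.schreierOne_subset
  -- The `ℓ₁`-part starts where its index set lies in `S` and after the `c₀`-part, both in block
  -- indices and in supports.
  set M : ℕ+ := max (max N l) (max (L + ν) ((Du.biUnion Bu).sup id + 1)) with hM
  set Dv := Finset.Ico M (M + N) with hDv
  have hNM : N ≤ M := (le_max_left N l).trans (le_max_left _ _)
  have hlM : l ≤ M := (le_max_right N l).trans (le_max_left _ _)
  have hLM : L + ν ≤ M := (le_max_left _ _).trans (le_max_right _ _)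
  have hBM : ∀ i ∈ Du, ∀ m ∈ Bu i, m < M := fun i hi m hm =>
    (Finset.le_sup (f := id) (Finset.mem_biUnion.2 ⟨i, hi, hm⟩)).trans_lt
      ((PNat.lt_add_right _ 1).trans_le ((le_max_right _ _).trans (le_max_right _ _)))
  have hDv : Dv ∈ S := hl _ (Ico_mem_schreierOne hNM) fun i hi => hlM.trans (Finset.mem_Ico.1 hi).1
  have hBune := nonempty_of_blocksOver hu hu0
  have hBvne := nonempty_of_blocksOver hv hv0
  set G : ℕ+ → Finset ℕ+ := fun i => if i < L + ν then Bu i else Bv i with hG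
  have hGu : ∀ i ∈ Du, G i = Bu i := fun i hi => if_pos (Finset.mem_Ico.1 hi).2
  have hGv : ∀ i ∈ Dv, G i = Bv i := fun i hi =>
    if_neg (not_lt.2 (hLM.trans (Finset.mem_Ico.1 hi).1))
  have hcard : (Du ∪ Dv).card ≤ (L : ℕ) := by
    refine (Finset.card_union_le _ _).trans ?_
    rw [card_Ico_pnat, card_Ico_pnat, hL, PNat.add_coe]
  have hE : (Du ∪ Dv).biUnion G ∈ familyComp schreierOne S := by
    refine biUnion_mem_familyComp (fun i _ => ?_) (fun i hi j hj hij => ?_) fun i hi m hm => ?_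
    · simp only [hG]
      split_ifs
      exacts [hBuS i, hBvS i]
    · rcases Finset.mem_union.1 hi with hi | hi <;> rcases Finset.mem_union.1 hj with hj | hj
      · rw [hGu i hi, hGu j hj]
        exact hBu i j hij
      · rw [hGu i hi, hGv j hj]
        exact fun m hm k hk => (hBM i hi m hm).trans_le
          ((Finset.mem_Ico.1 hj).1.trans (le_of_mem_successive hBv hBvne hk))
      · exact absurd (((Finset.mem_Ico.1 hj).2.trans_le hLM).trans_le (Finset.mem_Ico.1 hi).1)
          (not_lt.2 hij.le)
      · rw [hGv i hi, hGv j hj]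
        exact hBv i j hij
    · refine hcard.trans ?_
      have hLm : L ≤ m := by
        rcases Finset.mem_union.1 hi with hi | hi
        · rw [hGu i hi] at hm
          exact (Finset.mem_Ico.1 hi).1.trans (le_of_mem_successive hBu hBune hm)
        · rw [hGv i hi] at hm
          exact ((PNat.lt_add_right L ν).le.trans hLM).trans
            ((Finset.mem_Ico.1 hi).1.trans (le_of_mem_successive hBv hBvne hm))
      exact_mod_cast hLm
  have hmem : ∀ (D : Finset ℕ+) (B : ℕ+ → Finset ℕ+) (a : ℕ+ → ℕ+ → ℝ) (w : ℕ+ → ℕ+ →₀ ℝ),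
      D ⊆ Du ∪ Dv → (∀ i ∈ D, G i = B i) → (∀ j, w j = ∑ i ∈ B j, a j i • x i) →
      X01.ofFinsupp S (∑ j ∈ D, w j) ∈ Submodule.span ℝ
        ((fun i => X01.ofFinsupp S (x i)) '' (((Du ∪ Dv).biUnion G : Finset ℕ+) : Set ℕ+)) := by
    intro D B a w hD hB hw
    rw [map_sum]
    refine Submodule.sum_mem _ fun j hj => ?_
    rw [hw, map_sum]
    refine Submodule.sum_mem _ fun i hi => ?_
    rw [map_smul]
    refine Submodule.smul_mem _ _ (Submodule.subset_span ⟨i, ?_, rfl⟩)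
    rw [← hB j hj] at hi
    exact_mod_cast Finset.mem_biUnion.2 ⟨j, hD hj, hi⟩
  set U := X01.ofFinsupp S (∑ j ∈ Du, u j) with hU
  set V := X01.ofFinsupp S (∑ j ∈ Dv, v j) with hV
  have hpU : ((ν : ℕ) : ℝ) ≤ p U := X01.card_le_of_isLUB hp hub hu1 (card_Ico_pnat _ _)
  have hU1 : ‖U‖ ≤ 1 + ε := by
    have := hup Du (Ico_mem_schreierOne (PNat.lt_add_right ν N).le) (fun _ => 1) 1 zero_le_one
      (by simp)
    simpa only [one_smul, mul_one] using this
  have hU0 : 0 < ‖U‖ := by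
    refine norm_ofFinsupp_pos fun h => ?_
    rw [hU, h, map_zero, map_zero] at hpU
    linarith
  have hpV : p V ≤ (1 + ε) ^ 2 * (N : ℕ) := by
    have h1 := X01.isLUB_le_of_norm_le hreg hp hvb hv1 Dv
    rw [card_Ico_pnat] at h1
    refine h1.trans (le_of_eq ?_)
    rw [hN, PNat.mul_coe, Nat.cast_mul, hε]
    field_simp
  have hN0 : (0 : ℝ) < (N : ℕ) := by exact_mod_cast N.pos
  have hVN : ((N : ℕ) : ℝ) ≤ ‖V‖ := by
    have h1 := hlow Dv hDv fun _ => 1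
    simp only [abs_one, one_smul, Finset.sum_const, nsmul_eq_mul, mul_one] at h1
    rwa [card_Ico_pnat] at h1
  have hV0 : 0 < ‖V‖ := hN0.trans_le hVN
  refine ⟨_, hE, ‖U‖⁻¹ • U, Submodule.smul_mem _ _ (hmem Du Bu au u Finset.subset_union_left hGu hu),
    ‖V‖⁻¹ • V, Submodule.smul_mem _ _ (hmem Dv Bv av v Finset.subset_union_right hGv hv), ?_, ?_, ?_⟩
  · rw [norm_smul, norm_inv, norm_norm, inv_mul_cancel₀ hU0.ne']
  · rw [norm_smul, norm_inv, norm_norm, inv_mul_cancel₀ hV0.ne']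
  · rw [map_smul_eq_mul, map_smul_eq_mul, norm_inv, norm_norm, norm_inv, norm_norm]
    have h3 : 3 * ε * (ν : ℕ) < δ := by
      rw [div_lt_iff₀ hδ] at hK
      rw [hε, mul_comm (3 : ℝ), mul_assoc, inv_mul_lt_iff₀ hK0]
      exact hK
    refine (sub_lt_div_one_add_pow hn0 hε0 h3).trans_le ?_
    have h4 : ((ν : ℕ) : ℝ) / (1 + ε) ^ 3 = ((1 + ε)⁻¹ * (ν : ℕ)) / (1 + ε) ^ 2 := by
      field_simp
    rw [h4]
    refine div_le_div₀ (by positivity) ?_ ?_ ?_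
    · exact mul_le_mul (inv_anti₀ hU0 hU1) hpU hn0.le (by positivity)
    · exact mul_pos (inv_pos.2 hV0) (hV0.trans_le (hpn V))
    · rw [inv_mul_le_iff₀ hV0, mul_comm]
      exact hpV.trans (mul_le_mul_of_nonneg_left hVN (by positivity))

/-! ## The distortion index of block subspaces -/

section Subspace

variable {X : Type*} [NormedAddCommGroup X] [NormedSpace ℝ X]

/-- Distortions pass to block subspaces. -/
theorem IsDistortion.comp_subtype {F : Set (Finset ℕ+)} {t t' : ℝ} {e x : ℕ+ → X}
    {p : Seminorm ℝ X} (h : IsDistortion F t e p) (hx : IsBlockSeq e x) (ht : t' ≤ t) :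
    IsDistortion F t' (toClosedSpan x) (p.comp (closedSpan x).subtype) := by
  obtain ⟨⟨c, hc, C, hC, hcC⟩, h⟩ := h
  refine ⟨⟨c, hc, C, hC, fun y => hcC y⟩, fun z hz hz1 => ?_⟩
  obtain ⟨E, a, hE, hza⟩ := hz
  have hz' : IsBlockSeq x fun i => (z i : X) := by
    refine ⟨E, a, hE, fun i => ⟨?_, fun h0 => (hza i).2 (Subtype.ext h0)⟩⟩
    change (z i : X) = _
    rw [(hza i).1, AddSubmonoidClass.coe_finsetSum]
    rfl
  obtain ⟨D, hD, u, hu, v, hv, hu1, hv1, huv⟩ := h _ (hx.trans hz') hz1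
  have key : ∀ w ∈ Submodule.span ℝ ((fun i => (z i : X)) '' (D : Set ℕ+)),
      ∃ w' ∈ Submodule.span ℝ (z '' (D : Set ℕ+)), (w' : X) = w := by
    intro w hw
    have himg : (fun i => (z i : X)) '' (D : Set ℕ+) =
        (closedSpan x).subtype '' (z '' (D : Set ℕ+)) := by
      rw [Set.image_image]
      rfl
    rw [himg, Submodule.span_image] at hw
    exact hw
  obtain ⟨u', hu', rfl⟩ := key u hu
  obtain ⟨v', hv', rfl⟩ := key v hv
  exact ⟨D, hD, u', hu', v', hv', hu1, hv1, ht.trans_lt huv⟩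

end Subspace

theorem isArbitrarilyDistortable_toClosedSpan (hS : IsIndecomposableFamily S A) {X : ℕ+ → X01 S}
    (hX : IsBlockSeq (X01.e S) X) :
    IsArbitrarilyDistortable (familyComp schreierOne S) (toClosedSpan X) := by
  intro t ht
  -- With `δ = 1` this norm distorts by `⌈t⌉₊ ≥ t`.
  obtain ⟨p, hp⟩ := X01.exists_intervalSeminorm hS.regular_self (⌈t⌉₊ + 1)
  refine ⟨_, (isDistortion_intervalSums hS (Nat.le_add_left 1 _) one_pos hp).comp_subtype hX ?_⟩
  push_cast
  rw [add_sub_cancel_right]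
  exact Nat.le_ceil t

/-- Families that embed into `S` by a shift admit no uniform distortion by more than `4`. -/
theorem not_isArbitrarilyDistortable (hS : IsIndecomposableFamily S A) {X : ℕ+ → X01 S}
    (hX : IsBlockSeq (X01.e S) X) {F : Set (Finset ℕ+)} (hF : IsRegularFamily F) {l : ℕ+}
    (hl : ∀ E ∈ F, (∀ i ∈ E, l ≤ i) → E ∈ S) : ¬IsArbitrarilyDistortable F (toClosedSpan X) := by
  classical
  intro h
  obtain ⟨p, ⟨c, hc, C, hC, hcC⟩, hdist⟩ := h 4 (by norm_num)
  have hreg := hS.regular_self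
  obtain ⟨x, hx, hXx⟩ := hX.exists_isBlocks
  obtain ⟨hxb, hx1⟩ := hx.normalize (S := S)
  -- The original norm is first made `2`-equivalent to `ℓ₁` over `S`; then James's argument does the
  -- same for `p` on further blocks. The product of the two factors is the constant `4`.
  obtain ⟨v, hv, hv2, hlow⟩ := exists_ellOne_blocks hS hxb hx1 one_pos le_rfl
  obtain ⟨B, a, -, hB, hva⟩ := hv.of_smul
  set V : ℕ+ → closedSpan X := fun j => ∑ i ∈ B j, a j i • toClosedSpan X i with hV
  have hcoe : ∀ j, (V j : X01 S) = X01.ofFinsupp S (v j) := fun j => by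
    rw [hV, hva, map_sum, AddSubmonoidClass.coe_finsetSum]
    exact Finset.sum_congr rfl fun i _ => by
      rw [map_smul, Submodule.coe_smul]
      simp only [toClosedSpan, hXx]
  have hsumV : ∀ (E : Finset ℕ+) (b : ℕ+ → ℝ),
      ‖∑ i ∈ E, b i • V i‖ = ‖X01.ofFinsupp S (∑ i ∈ E, b i • v i)‖ := fun E b => by
    change ‖((∑ i ∈ E, b i • V i : closedSpan X) : X01 S)‖ = _
    rw [AddSubmonoidClass.coe_finsetSum, map_sum]
    simp only [Submodule.coe_smul, hcoe, map_smul]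
  have hVlow : ∀ E ∈ S, ∀ b : ℕ+ → ℝ, ∑ i ∈ E, |b i| ≤ ‖∑ i ∈ E, b i • V i‖ := fun E hE b => by
    rw [hsumV]
    exact hlow E hE b
  have hVup : ∀ (E : Finset ℕ+) (b : ℕ+ → ℝ), ‖∑ i ∈ E, b i • V i‖ ≤ 2 * ∑ i ∈ E, |b i| :=
    fun E b => by
      rw [hsumV]
      have := norm_sum_smul_le (S := S) E b hv2
      linarith
  have hV1 : ∀ j, 1 ≤ ‖V j‖ := fun j => by
    simpa using hVlow {j} (hreg.singleton j) fun _ => 1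
  have hV2 : ∀ j, ‖V j‖ ≤ 2 := fun j => by simpa using hVup {j} fun _ => 1
  have hVblock : IsBlockSeq (toClosedSpan X) V := IsBlockSeq.of_coeff hB (fun _ => rfl) fun j h => by
    have := hV1 j
    rw [h, norm_zero] at this
    linarith
  obtain ⟨θ, hθ, G, b, hG, -, hb, hup, hE⟩ := exists_almost_isometric_ellOne_blocks hS p (v := V)
    (C := C * 2) (fun i => (hcC _).2.trans (mul_le_mul_of_nonneg_left (hV2 i) hC.le)) hc
    (fun E hE b => (mul_le_mul_of_nonneg_left (hVlow E hE b) hc.le).trans (hcC _).1) one_pos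
  set z : ℕ+ → closedSpan X := fun j => ∑ i ∈ G j, b j i • V i with hz
  have hz0 : ∀ j, z j ≠ 0 := fun j h => by
    have := (hE {j} (hreg.singleton j)).2 fun _ => 1
    simp only [Finset.sum_singleton, abs_one, one_smul, mul_one] at this
    change θ ≤ p (z j) at this
    rw [h, map_zero] at this
    linarith
  have hzpos : ∀ j, 0 < ‖z j‖ := fun j => norm_pos_iff.2 (hz0 j)
  -- The shift by `l` moves the index sets from `F`, by spreading, to a range where they belong to
  -- `S`.
  have hwblock : IsBlockSeq V fun j => ‖z (l + j)‖⁻¹ • z (l + j) := by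
    refine IsBlockSeq.of_coeff (B := fun j => G (l + j))
      (a := fun j i => ‖z (l + j)‖⁻¹ * b (l + j) i)
      (fun i j hij => hG _ _ (by simpa using hij)) (fun j => ?_)
      fun j => smul_ne_zero (inv_ne_zero (hzpos _).ne') (hz0 _)
    simp only [hz, Finset.smul_sum, smul_smul]
  obtain ⟨E, hEF, u, hu, w, hw, hu1, hw1, huw⟩ := hdist _ (hVblock.trans hwblock) fun j => by
    rw [norm_smul, norm_inv, norm_norm, inv_mul_cancel₀ (hzpos _).ne']
  have hES : E.image (l + ·) ∈ S := by
    refine hl _ (hF.spreading E hEF _ (fun i _ j _ hij => by simpa using hij)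
      fun i _ => (PNat.lt_add_left i l).le) fun i hi => ?_
    obtain ⟨j, -, rfl⟩ := Finset.mem_image.1 hi
    exact (PNat.lt_add_right l j).le
  have key : ∀ y ∈ Submodule.span ℝ ((fun j => ‖z (l + j)‖⁻¹ • z (l + j)) '' (E : Set ℕ+)),
      ‖y‖ = 1 → p y ≤ 2 * θ ∧ θ / 2 ≤ p y := by
    intro y hy hy1
    have hy' : y ∈ Submodule.span ℝ (z '' ((E.image (l + ·) : Finset ℕ+) : Set ℕ+)) := by
      refine Submodule.span_le.2 ?_ hy
      rintro _ ⟨j, hj, rfl⟩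
      refine Submodule.smul_mem _ _ (Submodule.subset_span ⟨l + j, ?_, rfl⟩)
      exact_mod_cast Finset.mem_image_of_mem _ hj
    obtain ⟨α, rfl⟩ := (Submodule.mem_span_image_finset_iff_exists_fun' ℝ).1 hy'
    obtain ⟨w, hw1, hw2⟩ := exists_glue_smul (E := E.image (l + ·)) (fun i _ j _ => hG i j) α b V
    simp only [hb, mul_one] at hw1
    obtain ⟨h1, h2⟩ := hE _ hES
    have h3 := hVlow _ h1 w
    have h4 := hVup ((E.image (l + ·)).biUnion G) w
    rw [hw2, hw1] at h3 h4
    change _ ≤ ‖∑ j ∈ E.image (l + ·), α j • z j‖ at h3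
    change ‖∑ j ∈ E.image (l + ·), α j • z j‖ ≤ _ at h4
    rw [hy1] at h3 h4
    -- For a unit vector `y` the coefficient sum of `α` lies between `1 / 2` and `1`, and `p y` lies
    -- between `θ` and `2 * θ` times this sum.
    constructor
    · calc _ ≤ ∑ j ∈ E.image (l + ·), p (α j • z j) := 
          Finset.le_sum_of_subadditive p (map_zero p).le (map_add_le_add p) _ _
        _ ≤ ∑ j ∈ E.image (l + ·), |α j| * (2 * θ) := Finset.sum_le_sum fun j _ => by
            rw [map_smul_eq_mul, Real.norm_eq_abs]
            refine mul_le_mul_of_nonneg_left ?_ (abs_nonneg _)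
            have := hup j
            rwa [one_add_one_eq_two] at this
        _ ≤ _ := by
            rw [← Finset.sum_mul]
            exact mul_le_of_le_one_left (by positivity) h3
    · have := h2 α
      change _ ≤ p (∑ j ∈ E.image (l + ·), α j • z j) at this
      nlinarith
  obtain ⟨h1, -⟩ := key u hu hu1
  obtain ⟨-, h2⟩ := key w hw hw1
  rw [lt_div_iff₀ (by linarith)] at huw
  linarith

/-- An order `ζ ≤ η` is excluded because its family is eventually contained in that of order `η`,
which is all that `not_isArbitrarilyDistortable` asks besides regularity. -/
theorem distortionIndex_toClosedSpan {φ : Ordinal.{0} → ℕ+ → Ordinal.{0}} (hφ : IsSchreierChoice φ)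
    {η : Ordinal.{0}} (hη : η < ω₁) (hS : IsIndecomposableFamily (schreier φ η) A)
    {X : ℕ+ → X01 (schreier φ η)} (hX : IsBlockSeq (X01.e (schreier φ η)) X) :
    distortionIndex φ (toClosedSpan X) = η + 1 := by
  have hη1 : η + 1 < ω₁ := by
    rw [← Cardinal.ord_aleph] at hη ⊢
    exact (Cardinal.isSuccLimit_ord (Cardinal.aleph0_le_aleph 1)).add_one_lt hη
  refine le_antisymm (csInf_le' (Or.inr ⟨hη1, ?_⟩)) (le_csInf ⟨_, Or.inl rfl⟩ ?_)
  · rw [schreier_add_one]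
    exact isArbitrarilyDistortable_toClosedSpan hS hX
  · rintro ζ (rfl | ⟨hζ, h⟩)
    · exact hη1.le
    · by_contra hlt
      have hle : ζ ≤ η := Order.lt_add_one_iff.1 (not_le.1 hlt)
      obtain ⟨l, hl⟩ := exists_schreier_subset hφ ζ η hle hη
      exact not_isArbitrarilyDistortable hS hX (isRegularFamily_schreier hφ ζ hζ) hl h

end

end

theorem theorem2 (φ : Ordinal.{0} → ℕ+ → Ordinal.{0}) (hφ : IsSchreierChoice φ)
    (ξ : Ordinal.{0}) (hξ : ξ < ω₁) :
    IsReflexiveSpace (X01 (schreier φ (ω ^ ξ))) ∧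
    (∀ x : ℕ+ → X01 (schreier φ (ω ^ ξ)), IsBlockSeq (X01.e (schreier φ (ω ^ ξ))) x →
      IsBasicSeq x ∧ distortionIndex φ (toClosedSpan x) = ω ^ ξ + 1) ∧
    (∀ Y : Submodule ℝ (X01 (schreier φ (ω ^ ξ))), ¬ FiniteDimensional ℝ Y →
      (∃ K ≥ 1, ∃ y : ℕ+ → X01 (schreier φ (ω ^ ξ)), (∀ i, y i ∈ Y) ∧
        IsCZeroSpreadingModel (schreier φ 1) K y) ∧
      (∃ K ≥ 1, ∃ y : ℕ+ → X01 (schreier φ (ω ^ ξ)), (∀ i, y i ∈ Y) ∧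
        IsEllOneSpreadingModel (schreier φ (ω ^ ξ)) K y)) ∧
    (∀ n : ℕ, 1 ≤ n → ∀ δ : ℝ, 0 < δ → ∃ p : Seminorm ℝ (X01 (schreier φ (ω ^ ξ))),
      (∀ x, IsLUB (X01.intervalSums (schreier φ (ω ^ ξ)) n x) (p x)) ∧
      IsDistortion (schreier φ (ω ^ ξ + 1)) ((n : ℝ) - δ) (X01.e (schreier φ (ω ^ ξ))) p) := by
  obtain ⟨A, hS⟩ := exists_isIndecomposableFamily hφ hξ
  refine ⟨X01.isReflexiveSpace hS, fun X hX => ⟨?_, distortionIndex_toClosedSpan hφ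
    (omega0_opow_lt_omega_one hξ) hS hX⟩, fun Y hY => ⟨?_, exists_ellOne_spreadingModel hS Y hY⟩,
    fun n hn δ hδ => ?_⟩
  · obtain ⟨x, hx, rfl⟩ := hX.exists_isBlocks
    exact hx.isBasicSeq hS.regular_self
  · rw [schreier_one]
    exact exists_czero_spreadingModel hS Y hY
  · obtain ⟨p, hp⟩ := X01.exists_intervalSeminorm hS.regular_self n
    refine ⟨p, hp, ?_⟩
    rw [schreier_add_one]
    exact isDistortion_intervalSums hS hn hδ hp
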